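/- Let $M$ be a smooth $3$-manifold (Hausdorff, second countable, without boundary; not necessarily compact, connected or oriented) with a cooriented contact structure $\xi$, i.e. $\xi=\ker\alpha$, cooriented by $\alpha$, for some smooth $1$-form $\alpha$ on $M$ with $\alpha\wedge d\alpha$ nowhere zero. A contactomorphism of $(M,\xi)$ is a diffeomorphism $g\colon M\to M$ with $Tg(\xi)=\xi$ that preserves the coorientation. Two contactomorphisms $g,h$ of $(M,\xi)$ are contact isotopic if there is a family $(\varphi_t)_{t\in[0,1]}$ of contactomorphisms of $(M,\xi)$, with $(t,x)\mapsto\varphi_t(x)$ smooth on $[0,1]\times M$, such that $\varphi_0=g$ and $\varphi_1=h$. Let $K\subset M$ be a Legendrian knot, i.e. the image of a smooth embedding of $S^1$ into $M$ that is everywhere tangent to $\xi$, and let $g$ be a contactomorphism of $(M,\xi)$ that fixes $K$ pointwise. Then $g$ is contact isotopic to a contactomorphism $h$ of $(M,\xi)$ that is the identity on some open neighbourhood of $K$. -/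

import Mathlib

open scoped Manifold ContDiff

noncomputable section

namespace ContactTopology

/-- The model space `ℝ³`. -/
abbrev E3 : Type := EuclideanSpace ℝ (Fin 3)

section OneForms

variable (M : Type*) [TopologicalSpace M] [ChartedSpace E3 M] [IsManifold (𝓡 3) ∞ M]

/-- Smooth `1`-forms on a smooth `3`-manifold: smooth sections of the cotangent bundle. -/
abbrev OneForm : Type _ :=
  Cₛ^∞⟮𝓡 3; E3 →L[ℝ] ℝ, fun x : M => TangentSpace (𝓡 3) x →L[ℝ] Bundle.Trivial M ℝ x⟯

variable {M}

/-- The `1`-form `α` read in the preferred chart `e` at `x`, i.e. the pullback `(e⁻¹)^* α`,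
a `1`-form on (an open subset of) `ℝ³`. -/
def OneForm.inChart (α : OneForm M) (x : M) (y : E3) : E3 →L[ℝ] ℝ :=
  (α ((extChartAt (𝓡 3) x).symm y) :
      TangentSpace (𝓡 3) ((extChartAt (𝓡 3) x).symm y) →L[ℝ] ℝ).comp
    (mfderiv 𝓘(ℝ, E3) (𝓡 3) (extChartAt (𝓡 3) x).symm y)

/-- The exterior derivative `dα` at `x`: with `e` the preferred chart at `x`, it is
`e^* d((e⁻¹)^* α)`. -/
def OneForm.d (α : OneForm M) (x : M) : TangentSpace (𝓡 3) x [⋀^Fin 2]→L[ℝ] ℝ :=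
  (extDeriv (fun y : E3 => ContinuousAlternatingMap.ofSubsingleton ℝ E3 ℝ (0 : Fin 1)
      (α.inChart x y)) (extChartAt (𝓡 3) x x)).compContinuousLinearMap
    (mfderiv (𝓡 3) 𝓘(ℝ, E3) (extChartAt (𝓡 3) x) x)

/-- The value of the `3`-form `α ∧ dα` at `x` on tangent vectors `u, v, w`. -/
def OneForm.wedgeD (α : OneForm M) (x : M) (u v w : TangentSpace (𝓡 3) x) : ℝ :=
  (α x u : ℝ) * α.d x ![v, w] + (α x v : ℝ) * α.d x ![w, u] + (α x w : ℝ) * α.d x ![u, v]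

/-- A contact form: a smooth `1`-form `α` such that `α ∧ dα` vanishes nowhere. -/
def OneForm.IsContact (α : OneForm M) : Prop :=
  ∀ x : M, ∃ u v w : TangentSpace (𝓡 3) x, α.wedgeD x u v w ≠ 0

end OneForms

variable (M : Type*) [TopologicalSpace M] [ChartedSpace E3 M] [IsManifold (𝓡 3) ∞ M]

/-- A cooriented contact structure on a `3`-manifold: a plane field `ξ ⊂ TM` together with a choice
of positive side of each plane `ξ_x` in `T_x M` (an orientation of the line `T_x M / ξ_x`), which
are given as the kernel and the positive half-spaces of some contact form. -/
structure CoorientedContactStructure where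
  /-- the contact plane `ξ_x` -/
  plane : ∀ x : M, Submodule ℝ (TangentSpace (𝓡 3) x)
  /-- the open half-space of `T_x M` on the positive side of `ξ_x` -/
  pos : ∀ x : M, Set (TangentSpace (𝓡 3) x)
  exists_form : ∃ α : OneForm M, α.IsContact ∧
    ∀ (x : M) (v : TangentSpace (𝓡 3) x),
      (v ∈ plane x ↔ (α x v : ℝ) = 0) ∧ (v ∈ pos x ↔ 0 < (α x v : ℝ))

variable {M}

namespace CoorientedContactStructure

variable (ξ : CoorientedContactStructure M)

/-- A contactomorphism of `(M, ξ)`: a diffeomorphism `g` of `M` with `Tg(ξ) = ξ` that preserves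
the coorientation. -/
def IsContactomorphism (g : M ≃ₘ^∞⟮𝓡 3, 𝓡 3⟯ M) : Prop :=
  ∀ x : M,
    (ξ.plane x).map (mfderiv (𝓡 3) (𝓡 3) g x).toLinearMap = ξ.plane (g x) ∧
    mfderiv (𝓡 3) (𝓡 3) g x '' ξ.pos x = ξ.pos (g x)

/-- `g` and `h` are contact isotopic: they are joined by a family `φ_t`, `t ∈ [0,1]`, of
contactomorphisms that is smooth on `[0,1] × M`. The values `φ_t` for `t ∉ [0,1]` play no role. -/
def ContactIsotopic (g h : M ≃ₘ^∞⟮𝓡 3, 𝓡 3⟯ M) : Prop :=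
  ∃ φ : ℝ → (M ≃ₘ^∞⟮𝓡 3, 𝓡 3⟯ M),
    ContMDiffOn (𝓘(ℝ, ℝ).prod (𝓡 3)) (𝓡 3) ∞ (fun p : ℝ × M => φ p.1 p.2)
      (Set.Icc (0 : ℝ) 1 ×ˢ Set.univ) ∧
    (∀ t ∈ Set.Icc (0 : ℝ) 1, ξ.IsContactomorphism (φ t)) ∧
    φ 0 = g ∧ φ 1 = h

/-- A Legendrian knot: a smoothly embedded circle that is everywhere tangent to `ξ`. -/
def IsLegendrianKnot (K : Set M) : Prop :=
  ∃ γ : Circle → M, Manifold.IsSmoothEmbedding (𝓡 1) (𝓡 3) ∞ γ ∧ Set.range γ = K ∧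
    ∀ (z : Circle) (v : TangentSpace (𝓡 1) z), mfderiv (𝓡 1) (𝓡 3) γ z v ∈ ξ.plane (γ z)

end CoorientedContactStructure

end ContactTopology

end

/-! Around each point of `K` there are Darboux coordinates `(x, y, z)` in which `ξ` is the kernel
of `dz - y dx` and `K` is the `x`-axis. In them, a contactomorphism `(x, y, z) ↦ (X, Y, Z)` fixing
`K` has `(x, Y, z)` as coordinates near `K` and is recovered there from its generating function
`W (x, Y, z) = Z - X Y`, which is subject only to `∂W/∂z > 0` and, on the axis, to `W = 0` and
`∂W/∂Y = -x`. These conditions are convex, so `W` can be joined affinely to the generating function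
`z - x Y` of the identity. The path of germs is followed in small steps, each of which is cut off
near a compact piece of `K` and extended by the identity to a contact isotopy of `M`. Where `W`
already generates the identity the path is constant, so that finitely many charts covering `K` can
be treated one after the other.
-/
noncomputable section

namespace ContactTopology

open scoped Topology

section LocalDiffeo

variable {E F : Type*} [NormedAddCommGroup E] [NormedSpace ℝ E] [CompleteSpace E]
  [NormedAddCommGroup F] [NormedSpace ℝ F] {f : E → F} {S : Set E}

theorem exists_openPartialHomeomorph_of_hasFDerivAt (hS : IsOpen S) (hf : ContDiffOn ℝ ∞ f S)
    {x₀ : E} (hx₀ : x₀ ∈ S) {A : E ≃L[ℝ] F} (hA : HasFDerivAt f (A : E →L[ℝ] F) x₀) :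
    ∃ e : OpenPartialHomeomorph E F, x₀ ∈ e.source ∧ e.source ⊆ S ∧ (∀ x, e x = f x) ∧
      ContDiffOn ℝ ∞ e.symm e.target := by
  have hfx : ContDiffAt ℝ ∞ f x₀ := hf.contDiffAt (hS.mem_nhds hx₀)
  let e₀ := hfx.toOpenPartialHomeomorph f hA (by simp)
  have hev : ∀ᶠ x in 𝓝 x₀, x ∈ S ∧
      fderiv ℝ f x ∈ Set.range (ContinuousLinearEquiv.toContinuousLinearMap (M₁ := E) (M₂ := F)
        (σ₁₂ := RingHom.id ℝ)) := by
    refine (hS.eventually_mem hx₀).and ?_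
    have hcont := hf.continuousOn_fderiv_of_isOpen hS (by simp)
    refine (hcont.continuousAt (hS.mem_nhds hx₀)).eventually_mem ?_
    rw [hA.fderiv]
    exact A.nhds
  obtain ⟨T, hT, hTo, hxT⟩ := eventually_nhds_iff.1 hev
  refine ⟨e₀.restrOpen T hTo, ⟨hfx.mem_toOpenPartialHomeomorph_source hA (by simp), hxT⟩,
    fun x hx => (hT x hx.2).1, fun x => rfl, fun y hy => ?_⟩
  have hy' := (e₀.restrOpen T hTo).map_target hy
  obtain ⟨hyS, B, hB⟩ := hT _ hy'.2
  have hfy : ContDiffAt ℝ ∞ f ((e₀.restrOpen T hTo).symm y) := hf.contDiffAt (hS.mem_nhds hyS)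
  refine ((e₀.restrOpen T hTo).contDiffAt_symm (f₀' := B) hy ?_ hfy).contDiffWithinAt
  rw [hB]
  exact (hfy.differentiableAt (by simp)).hasFDerivAt

theorem exists_openPartialHomeomorph_of_injOn [Nonempty E] (hS : IsOpen S)
    (hf : ContDiffOn ℝ ∞ f S) (hinj : Set.InjOn f S)
    (hA : ∀ x ∈ S, ∃ A : E ≃L[ℝ] F, HasFDerivAt f (A : E →L[ℝ] F) x) :
    ∃ e : OpenPartialHomeomorph E F, e.source = S ∧ (∀ x, e x = f x) ∧
      ContDiffOn ℝ ∞ e.symm e.target := by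
  have hopen : IsOpenMap (S.domRestrict f) := by
    rw [isOpenMap_iff_nhds_le]
    rintro ⟨x, hx⟩
    obtain ⟨A, hAx⟩ := hA x hx
    have hmap : Filter.map f (𝓝 x) = 𝓝 (f x) :=
      ((hf.contDiffAt (hS.mem_nhds hx)).hasStrictFDerivAt' hAx (by simp)).map_nhds_eq_of_equiv
    change 𝓝 (f x) ≤ Filter.map (f ∘ ((↑) : S → E)) _
    rw [← Filter.map_map, map_nhds_subtype_coe_eq_nhds hx (hS.mem_nhds hx), hmap]
  let e := OpenPartialHomeomorph.ofContinuousOpenRestrict (hinj.toPartialEquiv f S)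
    hf.continuousOn hopen hS
  refine ⟨e, rfl, fun x => rfl, fun y hy => ?_⟩
  have hyS : e.symm y ∈ S := e.map_target hy
  obtain ⟨A, hAx⟩ := hA _ hyS
  exact (e.contDiffAt_symm (f₀' := A) hy hAx
    (hf.contDiffAt (hS.mem_nhds hyS))).contDiffWithinAt

end LocalDiffeo

section SuperpositionOperators

universe u

variable {K : Type*} [TopologicalSpace K] [CompactSpace K]
  {E F : Type u} [NormedAddCommGroup E] [NormedSpace ℝ E]
  [NormedAddCommGroup F] [NormedSpace ℝ F]

/-- Pointwise application `(L, h) ↦ (k ↦ L k (h k))` of a family of operators to a function, as a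
bounded bilinear map. It is the shape of the derivative of a superposition operator. -/
def pointwiseApply : C(K, E →L[ℝ] F) →L[ℝ] C(K, E) →L[ℝ] C(K, F) :=
  LinearMap.mkContinuous₂
    (LinearMap.mk₂ ℝ (fun (L : C(K, E →L[ℝ] F)) (h : C(K, E)) =>
        (⟨fun k => L k (h k), by fun_prop⟩ : C(K, F)))
      (fun _ _ _ => by ext; simp) (fun _ _ _ => by ext; simp)
      (fun _ _ _ => by ext; simp) (fun _ _ _ => by ext; simp)) 1
    (fun L h => by
      rw [ContinuousMap.norm_le _ (by positivity)]
      intro k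
      rw [one_mul]
      refine ((L k).le_opNorm (h k)).trans ?_
      gcongr
      exacts [L.norm_coe_le_norm k, h.norm_coe_le_norm k])

@[simp]
theorem pointwiseApply_apply (L : C(K, E →L[ℝ] F)) (h : C(K, E)) (k : K) :
    pointwiseApply L h k = L k (h k) := rfl

theorem hasFDerivAt_comp_continuousMap (v : C(E, F)) (v' : C(E, E →L[ℝ] F))
    (hv : ∀ x, HasFDerivAt v (v' x) x) (y : C(K, E)) :
    HasFDerivAt (fun y : C(K, E) => v.comp y) (pointwiseApply (v'.comp y)) y := by
  rw [hasFDerivAt_iff_isLittleO_nhds_zero, Asymptotics.isLittleO_iff]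
  intro ε hε
  have hcont : ContinuousAt (fun y : C(K, E) => v'.comp y) y :=
    (ContinuousMap.continuous_postcomp v').continuousAt
  obtain ⟨δ, hδ, hball⟩ := (Metric.continuousAt_iff (α := C(K, E))
    (β := C(K, E →L[ℝ] F))).1 hcont ε hε
  filter_upwards [Metric.ball_mem_nhds (0 : C(K, E)) hδ] with h hh
  rw [mem_ball_zero_iff] at hh
  rw [ContinuousMap.norm_le _ (by positivity)]
  intro k
  have hderiv : ∀ x ∈ segment ℝ (y k) (y k + h k), ‖v' x - v' (y k)‖ ≤ ε := by
    intro x hx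
    rw [segment_eq_image'] at hx
    obtain ⟨θ, hθ, rfl⟩ := hx
    have hdist : dist (y + θ • h) y < δ := by
      rw [dist_eq_norm, add_sub_cancel_left, norm_smul, Real.norm_of_nonneg hθ.1]
      exact (mul_le_of_le_one_left (norm_nonneg _) hθ.2).trans_lt hh
    have hclose := (ContinuousMap.dist_lt_iff hε).1 (hball hdist) k
    rw [dist_eq_norm] at hclose
    simpa using hclose.le
  calc ‖(v.comp (y + h) - v.comp y - pointwiseApply (v'.comp y) h) k‖
      = ‖v (y k + h k) - v (y k) - v' (y k) (y k + h k - y k)‖ := by simp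
    _ ≤ ε * ‖y k + h k - y k‖ := Convex.norm_image_sub_le_of_norm_hasFDerivWithin_le' (𝕜 := ℝ)
        (fun x _ => (hv x).hasFDerivWithinAt) hderiv
        (convex_segment _ _) (left_mem_segment _ _ _) (right_mem_segment _ _ _)
    _ ≤ ε * ‖h‖ := by
        rw [add_sub_cancel_left]
        gcongr
        exact h.norm_coe_le_norm k

theorem contDiff_nat_comp_continuousMap (n : ℕ) (v : C(E, F)) (hv : ContDiff ℝ ∞ v) :
    ContDiff ℝ n (fun y : C(K, E) => v.comp y) := by
  induction n generalizing F with
  | zero => exact contDiff_zero.2 (ContinuousMap.continuous_postcomp v)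
  | succ n ih =>
    have hv' : ContDiff ℝ ∞ (fderiv ℝ v) := (contDiff_infty_iff_fderiv.1 hv).2
    let v' : C(E, E →L[ℝ] F) := ⟨fderiv ℝ v, hv'.continuous⟩
    refine contDiff_succ_iff_hasFDerivAt.2 ⟨fun y => pointwiseApply (v'.comp y), ?_, fun y =>
      hasFDerivAt_comp_continuousMap v v' (fun x => ?_) y⟩
    · exact pointwiseApply.contDiff.comp (ih v' hv')
    · exact (hv.differentiable (by simp) x).hasFDerivAt

theorem contDiff_comp_continuousMap (v : C(E, F)) (hv : ContDiff ℝ ∞ v) :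
    ContDiff ℝ ∞ (fun y : C(K, E) => v.comp y) :=
  contDiff_infty.2 fun n => contDiff_nat_comp_continuousMap n v hv

end SuperpositionOperators

section LocalFlow

variable {E : Type*} [NormedAddCommGroup E] [NormedSpace ℝ E]

/-- The indefinite integral `u ↦ (τ ↦ ∫ s in 0..τ, u s)` on `[0, 1]`, as a bounded operator. -/
def integralOp : C(unitInterval, E) →L[ℝ] C(unitInterval, E) :=
  LinearMap.mkContinuous
    { toFun := fun u => ⟨fun τ => ∫ s in (0 : ℝ)..τ, u (Set.projIcc 0 1 zero_le_one s),
        (intervalIntegral.continuous_primitive (fun a b =>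
          (u.continuous.comp continuous_projIcc).intervalIntegrable a b) 0).comp
          continuous_subtype_val⟩
      map_add' := fun u v => by
        ext τ
        exact intervalIntegral.integral_add
          ((u.continuous.comp continuous_projIcc).intervalIntegrable _ _)
          ((v.continuous.comp continuous_projIcc).intervalIntegrable _ _)
      map_smul' := fun c u => by
        ext τ
        exact intervalIntegral.integral_smul c _ } 1
    (fun u => by
      rw [ContinuousMap.norm_le _ (by positivity)]
      intro τ
      refine (intervalIntegral.norm_integral_le_of_norm_le_const (C := ‖u‖)
        (fun s _ => u.norm_coe_le_norm _)).trans ?_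
      rw [sub_zero, abs_of_nonneg τ.2.1, one_mul]
      exact mul_le_of_le_one_right (norm_nonneg _) τ.2.2)

theorem integralOp_apply (u : C(unitInterval, E)) (τ : unitInterval) :
    integralOp u τ = ∫ s in (0 : ℝ)..τ, u (Set.projIcc 0 1 zero_le_one s) := rfl

/-- The defect `y - c - t ∫ F(y)` of the integral equation of `y' = t F(y)`, `y(0) = c`, whose
solution is `y(τ) = φ_{tτ}(c)` for the flow `φ` of `F`. Rescaling time puts all solutions on
`[0, 1]`. -/
def picardMap (F : C(E, E)) (q : (ℝ × E) × C(unitInterval, E)) : C(unitInterval, E) :=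
  q.2 - ContinuousLinearMap.const ℝ _ q.1.2 - q.1.1 • integralOp (F.comp q.2)

/-- The curve `y` on `[0, 1]` run at `t ∈ [0, 1]` times its speed. -/
def slowDown {X : Type*} [TopologicalSpace X] (t : unitInterval) (y : C(unitInterval, X)) :
    C(unitInterval, X) :=
  ⟨fun s => y (t * s), by fun_prop⟩

theorem slowDown_apply {X : Type*} [TopologicalSpace X] (t s : unitInterval)
    (y : C(unitInterval, X)) : slowDown t y s = y (t * s) := rfl

theorem dist_slowDown_const_le {X : Type*} [PseudoMetricSpace X] (t : unitInterval)
    (y : C(unitInterval, X)) (c : X) :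
    dist (slowDown t y) (.const _ c) ≤ dist y (.const _ c) :=
  (ContinuousMap.dist_le dist_nonneg).2 fun s =>
    ContinuousMap.dist_apply_le_dist (f := y) (g := .const _ c) (t * s)

variable {F : C(E, E)}

theorem picardMap_eq_zero_iff {q : (ℝ × E) × C(unitInterval, E)} :
    picardMap F q = 0 ↔ ∀ τ : unitInterval, q.2 τ = q.1.2 + q.1.1 •
      ∫ s in (0 : ℝ)..τ, F (q.2 (Set.projIcc 0 1 zero_le_one s)) := by
  rw [ContinuousMap.ext_iff]
  refine forall_congr' fun τ => ?_
  change q.2 τ - q.1.2 - q.1.1 • integralOp (F.comp q.2) τ = 0 ↔ _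
  rw [integralOp_apply, sub_sub, sub_eq_zero]
  rfl

theorem picardMap_const (c : E) : picardMap F ((0, c), .const _ c) = 0 :=
  picardMap_eq_zero_iff.2 fun τ => by simp

theorem picardMap_slowDown {p : ℝ × E} {y : C(unitInterval, E)} (h : picardMap F (p, y) = 0)
    (t : unitInterval) : picardMap F ((t * p.1, p.2), slowDown t y) = 0 := by
  rw [picardMap_eq_zero_iff] at h ⊢
  intro τ
  have hsub := intervalIntegral.smul_integral_comp_mul_left (a := 0) (b := (τ : ℝ)) (c := (t : ℝ))
    (f := fun s => F (y (Set.projIcc 0 1 zero_le_one s)))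
  simp only [mul_zero] at hsub
  dsimp only
  rw [slowDown_apply, h (t * τ), Set.Icc.coe_mul, ← hsub, mul_comm (t : ℝ) p.1, mul_smul]
  congr 3
  refine intervalIntegral.integral_congr fun s hs => ?_
  rw [Set.uIcc_of_le τ.2.1] at hs
  have hs₁ : s ∈ Set.Icc (0 : ℝ) 1 := ⟨hs.1, hs.2.trans τ.2.2⟩
  have hts : (t : ℝ) * s ∈ Set.Icc (0 : ℝ) 1 :=
    ⟨mul_nonneg t.2.1 hs₁.1, mul_le_one₀ t.2.2 hs₁.1 hs₁.2⟩
  simp only [slowDown_apply, Set.projIcc_of_mem zero_le_one hs₁,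
    Set.projIcc_of_mem zero_le_one hts]
  rfl

theorem contDiff_picardMap (hF : ContDiff ℝ ∞ F) : ContDiff ℝ ∞ (picardMap F) := by
  have hintegral : ContDiff ℝ ∞ (fun q : (ℝ × E) × C(unitInterval, E) =>
      integralOp (F.comp q.2)) :=
    integralOp.contDiff.comp ((contDiff_comp_continuousMap F hF).comp contDiff_snd)
  exact (contDiff_snd.sub
    ((ContinuousLinearMap.const ℝ unitInterval).contDiff.comp contDiff_fst.snd)).sub
    (contDiff_fst.fst.smul hintegral)

theorem exists_equiv_hasFDerivAt_picardMap (hF : ContDiff ℝ ∞ F) (c : E) :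
    ∃ A : ((ℝ × E) × C(unitInterval, E)) ≃L[ℝ] ((ℝ × E) × C(unitInterval, E)),
      HasFDerivAt (fun q => (q.1, picardMap F q))
        (A : ((ℝ × E) × C(unitInterval, E)) →L[ℝ] ((ℝ × E) × C(unitInterval, E)))
        ((0, c), .const _ c) := by
  let Q : C(unitInterval, E) → C(unitInterval, E) := fun y => integralOp (F.comp y)
  let T : ℝ × E →L[ℝ] C(unitInterval, E) :=
    -((ContinuousLinearMap.fst ℝ ℝ E).smulRight (Q (.const _ c)) +
      (ContinuousLinearMap.const ℝ unitInterval).comp (.snd ℝ ℝ E))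
  have hQ : DifferentiableAt ℝ (fun q : (ℝ × E) × C(unitInterval, E) => Q q.2)
      ((0, c), .const _ c) :=
    (integralOp.contDiff.comp ((contDiff_comp_continuousMap F hF).comp contDiff_snd)).differentiable
      (by simp) _
  let c' : (ℝ × E) × C(unitInterval, E) →L[ℝ] C(unitInterval, E) :=
    (ContinuousLinearMap.const ℝ unitInterval).comp
      ((ContinuousLinearMap.snd ℝ ℝ E).comp (.fst ℝ _ _))
  let t' : (ℝ × E) × C(unitInterval, E) →L[ℝ] ℝ := (ContinuousLinearMap.fst ℝ ℝ E).comp (.fst ℝ _ _)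
  refine ⟨.skewProd (.refl ℝ _) (.refl ℝ _) T, ?_⟩
  refine (hasFDerivAt_fst.prodMk
    ((hasFDerivAt_snd.sub c'.hasFDerivAt).sub (t'.hasFDerivAt.smul hQ.hasFDerivAt))).congr_fderiv ?_
  refine ContinuousLinearMap.ext fun q => Prod.ext rfl ?_
  simp [T, Q, c', t', sub_eq_add_neg, add_assoc]

theorem exists_smooth_solution_picardMap [CompleteSpace E] (hF : ContDiff ℝ ∞ F) (c₀ : E) :
    ∃ (S : Set (ℝ × E)) (Y : ℝ × E → C(unitInterval, E)), IsOpen S ∧ (0, c₀) ∈ S ∧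
      ContDiffOn ℝ ∞ Y S ∧ (∀ p ∈ S, picardMap F (p, Y p) = 0) ∧
      ∀ p ∈ S, ∀ t : unitInterval, Y (t * p.1, p.2) = slowDown t (Y p) := by
  obtain ⟨A, hA⟩ := exists_equiv_hasFDerivAt_picardMap hF c₀
  obtain ⟨e, he₀, -, he, hesymm⟩ := exists_openPartialHomeomorph_of_hasFDerivAt isOpen_univ
    (contDiff_fst.prodMk (contDiff_picardMap hF)).contDiffOn (Set.mem_univ _) hA
  obtain ⟨ρ, hρ, hball⟩ := Metric.isOpen_iff.1 e.open_source _ he₀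
  let Y : ℝ × E → C(unitInterval, E) := fun p => (e.symm (p, 0)).2
  let D : Set (ℝ × E) := {p | (p, (0 : C(unitInterval, E))) ∈ e.target}
  have hD : IsOpen D := e.open_target.preimage (by fun_prop)
  have hY : ContDiffOn ℝ ∞ Y D := contDiff_snd.comp_contDiffOn
    (hesymm.comp (contDiff_prodMk_left _).contDiffOn fun _ hp => hp)
  have hsolves : ∀ p ∈ D, picardMap F (p, Y p) = 0 := by
    intro p hp
    obtain ⟨hfst, hsnd⟩ := Prod.ext_iff.1 ((he _).symm.trans (e.right_inv hp))
    rwa [show e.symm (p, 0) = (p, Y p) from Prod.ext hfst rfl] at hsnd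
  have hunique : ∀ p y, dist p (0, c₀) < ρ → dist y (.const _ c₀) < ρ →
      picardMap F (p, y) = 0 → p ∈ D ∧ Y p = y := by
    intro p y hp hy hpy
    have hs : (p, y) ∈ e.source := hball (max_lt hp hy)
    have hpy₀ : e (p, y) = (p, 0) := by rw [he, hpy]
    refine ⟨?_, by simp only [Y, ← hpy₀, e.left_inv hs]⟩
    change (p, _) ∈ e.target
    exact hpy₀ ▸ e.map_source hs
  refine ⟨Metric.ball (0, c₀) ρ ∩ (D ∩ Y ⁻¹' Metric.ball (.const _ c₀) ρ), Y,
    Metric.isOpen_ball.inter (hY.continuousOn.isOpen_inter_preimage hD Metric.isOpen_ball), ?_,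
    hY.mono fun p hp => hp.2.1, fun p hp => hsolves p hp.2.1, fun p hp t => ?_⟩
  · obtain ⟨hmem, hconst⟩ := hunique (0, c₀) (.const _ c₀) (by simpa) (by simpa)
      (picardMap_const c₀)
    exact ⟨Metric.mem_ball_self hρ, hmem, by simpa [hconst] using hρ⟩
  · refine (hunique _ _ ?_ ((dist_slowDown_const_le t _ _).trans_lt hp.2.2)
      (picardMap_slowDown (hsolves p hp.2.1) t)).2
    refine lt_of_le_of_lt (max_le_max ?_ le_rfl) (Metric.mem_ball.1 hp.1)
    rw [Real.dist_0_eq_abs, Real.dist_0_eq_abs, abs_mul, abs_of_nonneg t.2.1]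
    exact mul_le_of_le_one_left (abs_nonneg _) t.2.2

theorem smul_fderiv_eq_of_picardMap {P : ℝ × E → E} {t : ℝ} {c : E} {y : C(unitInterval, E)}
    [CompleteSpace E] (hy : picardMap F ((t, c), y) = 0)
    (hP : ∀ τ : unitInterval, P (τ * t, c) = y τ) {τ : unitInterval}
    (hdiff : DifferentiableAt ℝ P (τ * t, c)) :
    t • fderiv ℝ P (τ * t, c) (1, 0) = t • F (P (τ * t, c)) := by
  let f : ℝ → E := fun s => F (y (Set.projIcc 0 1 zero_le_one s))
  have hf : Continuous f := F.continuous.comp (y.continuous.comp continuous_projIcc)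
  have hintegral : HasDerivAt (fun s : ℝ => c + t • ∫ r in (0 : ℝ)..s, f r) (t • f τ) τ :=
    ((hf.integral_hasStrictDerivAt 0 τ).hasDerivAt.const_smul t).const_add c
  have hline : HasDerivAt (fun s : ℝ => (s * t, c)) (t • ((1, 0) : ℝ × E)) τ := by
    simpa using ((hasDerivAt_id (τ : ℝ)).mul_const t).prodMk (hasDerivAt_const (τ : ℝ) c)
  have heq : Set.EqOn (fun s : ℝ => P (s * t, c)) (fun s : ℝ => c + t • ∫ r in (0 : ℝ)..s, f r)
      (Set.Icc 0 1) :=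
    fun s hs => (hP ⟨s, hs⟩).trans (picardMap_eq_zero_iff.1 hy ⟨s, hs⟩)
  have hcurve : HasDerivAt (fun s : ℝ => P (s * t, c))
      (fderiv ℝ P (τ * t, c) (t • ((1, 0) : ℝ × E))) τ :=
    hdiff.hasFDerivAt.comp_hasDerivAt (τ : ℝ) hline
  rw [← map_smul, hP]
  refine ((uniqueDiffOn_Icc (zero_lt_one' ℝ) τ τ.2).eq_deriv _ hcurve.hasDerivWithinAt
    (hintegral.hasDerivWithinAt.congr heq (heq τ.2))).trans ?_
  simp only [f, Set.projIcc_val]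

theorem exists_smooth_flow [CompleteSpace E] (hF : ContDiff ℝ ∞ F) (c₀ : E) :
    ∃ (S : Set (ℝ × E)) (P : ℝ × E → E), IsOpen S ∧ (0, c₀) ∈ S ∧ ContDiffOn ℝ ∞ P S ∧
      (∀ c, (0, c) ∈ S → P (0, c) = c) ∧ ∀ p ∈ S, fderiv ℝ P p (1, 0) = F (P p) := by
  obtain ⟨S, Y, hSo, hcS, hY, hsolves, hscale⟩ := exists_smooth_solution_picardMap hF c₀
  let P : ℝ × E → E := fun p => Y p 1
  have hP : ContDiffOn ℝ ∞ P S :=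
    (ContinuousMap.evalCLM (M := E) ℝ (1 : unitInterval)).contDiff.comp_contDiffOn hY
  have hPY : ∀ p ∈ S, ∀ τ : unitInterval, P (τ * p.1, p.2) = Y p τ := fun p hp τ => by
    simp only [P, hscale p hp, slowDown_apply, mul_one]
  have hdiff : ∀ p ∈ S, DifferentiableAt ℝ P p := fun p hp =>
    (hP.contDiffAt (hSo.mem_nhds hp)).differentiableAt (by simp)
  refine ⟨S, P, hSo, hcS, hP, fun c hc => ?_, ?_⟩
  · simpa using picardMap_eq_zero_iff.1 (hsolves _ hc) 1
  rintro ⟨t, c⟩ hp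
  rcases eq_or_ne t 0 with rfl | ht
  · obtain ⟨t, hpt, ht⟩ : ∃ t : ℝ, (t, c) ∈ S ∧ t ≠ 0 :=
      (((by fun_prop : Continuous fun t : ℝ => (t, c)).continuousAt.eventually_mem
        (hSo.mem_nhds hp)).filter_mono nhdsWithin_le_nhds |>.and
        (self_mem_nhdsWithin (s := {0}ᶜ))).exists
    have hzero := smul_fderiv_eq_of_picardMap (hsolves _ hpt) (hPY _ hpt) (τ := 0)
      (by simpa using hdiff _ hp)
    simpa [ht] using hzero
  · have hone := smul_fderiv_eq_of_picardMap (hsolves _ hp) (hPY _ hp) (τ := 1)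
      (by simpa using hdiff _ hp)
    simpa [ht] using hone

end LocalFlow

section Perturbation

theorem exists_pos_le_forall_Ioo_of_isOpen {X : Type*} [TopologicalSpace X] {C : Set X}
    (hC : IsCompact C) {O : Set (ℝ × X)} (hO : IsOpen O) (hCO : ∀ q ∈ C, ((0 : ℝ), q) ∈ O)
    {r₁ : ℝ} (hr₁ : 0 < r₁) :
    ∃ r > 0, r ≤ r₁ ∧ ∀ s ∈ Set.Ioo (-r) r, ∀ q ∈ C, (s, q) ∈ O := by
  obtain ⟨u, v, hu, -, h0u, hCv, huv⟩ := generalized_tube_lemma (isCompact_singleton (x := (0 : ℝ)))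
    hC hO (by rintro ⟨s, q⟩ ⟨rfl, hq⟩; exact hCO q hq)
  obtain ⟨r, hr, hball⟩ := Metric.isOpen_iff.1 hu 0 (h0u rfl)
  refine ⟨min r r₁, lt_min hr hr₁, min_le_right _ _, fun s hs q hq => huv ⟨hball ?_, hCv hq⟩⟩
  rw [mem_ball_zero_iff, Real.norm_eq_abs, abs_lt]
  exact Set.Ioo_subset_Ioo (neg_le_neg (min_le_left _ _)) (min_le_left _ _) hs

theorem Ioo_neg_subset {r r₁ : ℝ} (h : r ≤ r₁) : Set.Ioo (-r) r ⊆ Set.Ioo (-r₁) r₁ :=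
  Set.Ioo_subset_Ioo (neg_le_neg h) h

theorem exists_equiv_of_norm_sub_id_lt_one {E : Type*} [NormedAddCommGroup E] [NormedSpace ℝ E]
    [CompleteSpace E] {B : E →L[ℝ] E} (hB : ‖B - .id ℝ E‖ < 1) :
    ∃ A : E ≃L[ℝ] E, (A : E →L[ℝ] E) = B := by
  refine ⟨ContinuousLinearEquiv.unitsEquiv ℝ E (Units.oneSub (.id ℝ E - B) ?_), ?_⟩
  · rwa [norm_sub_rev]
  · ext v
    simp [Units.oneSub]

theorem norm_sub_sub_le_of_norm_fderiv_sub_id_le {E : Type*} [NormedAddCommGroup E]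
    [NormedSpace ℝ E] {f : E → E} (hf : Differentiable ℝ f) {c : ℝ}
    (hc : ∀ q, ‖fderiv ℝ f q - .id ℝ E‖ ≤ c) (p q : E) :
    ‖f p - f q - (p - q)‖ ≤ c * ‖p - q‖ :=
  Convex.norm_image_sub_le_of_norm_hasFDerivWithin_le' (φ := .id ℝ E)
    (fun x _ => (hf x).hasFDerivAt.hasFDerivWithinAt) (fun x _ => hc x) convex_univ
    (Set.mem_univ _) (Set.mem_univ _)

theorem bijective_of_norm_fderiv_sub_id_le {E : Type*} [NormedAddCommGroup E] [NormedSpace ℝ E]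
    [CompleteSpace E] {f : E → E} (hf : Differentiable ℝ f) {c : NNReal} (hc₁ : c < 1)
    (hc : ∀ q, ‖fderiv ℝ f q - .id ℝ E‖ ≤ c) : Function.Bijective f := by
  have happrox : ApproximatesLinearOn f (ContinuousLinearEquiv.refl ℝ E : E →L[ℝ] E)
      Set.univ c := fun p _ q _ => norm_sub_sub_le_of_norm_fderiv_sub_id_le hf hc p q
  refine (happrox.toHomeomorph f ?_).bijective
  rcases subsingleton_or_nontrivial E with hE | hE
  · exact .inl hE
  · have hnorm : ‖((ContinuousLinearEquiv.refl ℝ E).symm : E →L[ℝ] E)‖₊ = 1 :=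
      NNReal.eq ContinuousLinearMap.norm_id
    exact .inr (by rwa [hnorm, inv_one])

/-- A family of diffeomorphisms `map s`, `s ∈ I`, of a normed space, smooth in both variables
together with its inverses `inv s`, and equal to the identity off `C`. Values for `s ∉ I` are
unconstrained. -/
structure DiffeoFamily {E : Type*} [NormedAddCommGroup E] [NormedSpace ℝ E] (I : Set ℝ)
    (C : Set E) where
  map : ℝ → E → E
  inv : ℝ → E → E
  contDiffOn_map : ContDiffOn ℝ ∞ (fun p : ℝ × E => map p.1 p.2) (I ×ˢ Set.univ)
  contDiffOn_inv : ContDiffOn ℝ ∞ (fun p : ℝ × E => inv p.1 p.2) (I ×ˢ Set.univ)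
  inv_map : ∀ s ∈ I, ∀ q, inv s (map s q) = q
  map_inv : ∀ s ∈ I, ∀ q, map s (inv s q) = q
  map_eq_self : ∀ s ∈ I, ∀ q ∉ C, map s q = q

variable {E : Type*} [NormedAddCommGroup E] [NormedSpace ℝ E] {C : Set E} {Θ : ℝ → E → E}

theorem hasFDerivAt_slice {r : ℝ}
    (hΘ : ContDiffOn ℝ ∞ (fun p : ℝ × E => Θ p.1 p.2) (Set.Ioo (-r) r ×ˢ Set.univ)) {s : ℝ}
    (hs : s ∈ Set.Ioo (-r) r) (q : E) :
    HasFDerivAt (Θ s) ((fderiv ℝ (fun p : ℝ × E => Θ p.1 p.2) (s, q)).comp (.inr ℝ ℝ E)) q :=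
  HasFDerivAt.comp (g := fun p : ℝ × E => Θ p.1 p.2) q
    ((hΘ.contDiffAt ((isOpen_Ioo.prod isOpen_univ).mem_nhds ⟨hs, trivial⟩)).differentiableAt
      (by simp)).hasFDerivAt (hasFDerivAt_prodMk_right s q)

theorem exists_pos_forall_norm_fderiv_sub_id_le (hC : IsCompact C) {r₁ : ℝ} (hr₁ : 0 < r₁)
    (hΘ : ContDiffOn ℝ ∞ (fun p : ℝ × E => Θ p.1 p.2) (Set.Ioo (-r₁) r₁ ×ˢ Set.univ))
    (hΘC : ∀ s ∈ Set.Ioo (-r₁) r₁, ∀ q ∉ C, Θ s q = q) (hΘ₀ : ∀ q, Θ 0 q = q) {ε : ℝ}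
    (hε : 0 < ε) :
    ∃ r > 0, r ≤ r₁ ∧ ∀ s ∈ Set.Ioo (-r) r, ∀ q, ‖fderiv ℝ (Θ s) q - .id ℝ E‖ ≤ ε := by
  have hopen : IsOpen (Set.Ioo (-r₁) r₁ ×ˢ (Set.univ : Set E)) := isOpen_Ioo.prod isOpen_univ
  let D : ℝ × E → E →L[ℝ] E := fun p =>
    (fderiv ℝ (fun p : ℝ × E => Θ p.1 p.2) p).comp (.inr ℝ ℝ E)
  have hD : ContinuousOn D (Set.Ioo (-r₁) r₁ ×ˢ Set.univ) :=
    (hΘ.continuousOn_fderiv_of_isOpen hopen (by simp)).clm_comp continuousOn_const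
  have hDeq : ∀ s ∈ Set.Ioo (-r₁) r₁, ∀ q, fderiv ℝ (Θ s) q = D (s, q) := fun s hs q =>
    (hasFDerivAt_slice hΘ hs q).fderiv
  have h₀ : (0 : ℝ) ∈ Set.Ioo (-r₁) r₁ := by simpa using hr₁
  have hD₀ : ∀ q, D (0, q) = .id ℝ E := fun q => by
    rw [← hDeq 0 h₀, show Θ 0 = id from funext hΘ₀, fderiv_id]
  obtain ⟨r, hr, hle, hrC⟩ := exists_pos_le_forall_Ioo_of_isOpen hC
    (hD.isOpen_inter_preimage hopen (Metric.isOpen_ball (x := .id ℝ E) (ε := ε)))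
    (fun q _ => ⟨⟨h₀, trivial⟩, by simpa [hD₀] using hε⟩) hr₁
  refine ⟨r, hr, hle, fun s hs q => ?_⟩
  by_cases hq : q ∈ C
  · rw [hDeq s (Ioo_neg_subset hle hs)]
    exact (mem_ball_iff_norm.1 (hrC s hs q hq).2).le
  · have hid : Θ s =ᶠ[𝓝 q] id := by
      filter_upwards [hC.isClosed.isOpen_compl.mem_nhds hq] with p hp
      exact hΘC s (Ioo_neg_subset hle hs) p hp
    rw [hid.fderiv_eq, fderiv_id, sub_self, norm_zero]
    exact hε.le

theorem contDiffOn_extend_id {I : Set ℝ} (hI : IsOpen I) {N T : Set E} (hN : IsOpen N)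
    (hC : IsClosed C) (hCN : C ⊆ N) {ρ : ℝ → E → E}
    (hρ : ContDiffOn ℝ ∞ (fun p : ℝ × E => ρ p.1 p.2) (I ×ˢ N)) {σ : E → E} (hT : IsOpen T)
    (hσ : ContDiffOn ℝ ∞ σ T) (hρT : ∀ s ∈ I, ∀ q ∈ N, ρ s q ∈ T)
    (hΘN : ∀ s ∈ I, ∀ q ∈ N, Θ s q = σ (ρ s q)) (hΘC : ∀ s ∈ I, ∀ q ∉ C, Θ s q = q) :
    ContDiffOn ℝ ∞ (fun p : ℝ × E => Θ p.1 p.2) (I ×ˢ Set.univ) := by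
  rintro ⟨s, q⟩ ⟨hs, -⟩
  refine ContDiffAt.contDiffWithinAt ?_
  by_cases hqC : q ∈ C
  · have hmem : I ×ˢ N ∈ 𝓝 (s, q) := (hI.prod hN).mem_nhds ⟨hs, hCN hqC⟩
    have hσρ := ContDiffAt.comp (g := σ) (s, q)
      (hσ.contDiffAt (hT.mem_nhds (hρT s hs q (hCN hqC)))) (hρ.contDiffAt hmem)
    refine hσρ.congr_of_eventuallyEq ?_
    filter_upwards [hmem] with p hp using hΘN _ hp.1 _ hp.2
  · refine contDiffAt_snd.congr_of_eventuallyEq ?_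
    filter_upwards [(hI.prod hC.isOpen_compl).mem_nhds ⟨hs, hqC⟩] with p hp
    exact hΘC _ hp.1 _ hp.2

variable [CompleteSpace E]

theorem exists_equiv_hasFDerivAt_prodMk_family {r : ℝ}
    (hΘ : ContDiffOn ℝ ∞ (fun p : ℝ × E => Θ p.1 p.2) (Set.Ioo (-r) r ×ˢ Set.univ))
    {p : ℝ × E} (hp : p.1 ∈ Set.Ioo (-r) r) (hlt : ‖fderiv ℝ (Θ p.1) p.2 - .id ℝ E‖ < 1) :
    ∃ A : (ℝ × E) ≃L[ℝ] (ℝ × E),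
      HasFDerivAt (fun p => (p.1, Θ p.1 p.2)) (A : (ℝ × E) →L[ℝ] (ℝ × E)) p := by
  obtain ⟨B, hB⟩ := exists_equiv_of_norm_sub_id_lt_one hlt
  set L := fderiv ℝ (fun p : ℝ × E => Θ p.1 p.2) p
  have hLd : HasFDerivAt (fun p : ℝ × E => Θ p.1 p.2) L p :=
    ((hΘ.contDiffAt ((isOpen_Ioo.prod isOpen_univ).mem_nhds ⟨hp, trivial⟩)).differentiableAt
      (by simp)).hasFDerivAt
  refine ⟨.skewProd (.refl ℝ ℝ) B (L.comp (.inl ℝ ℝ E)), ?_⟩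
  refine (hasFDerivAt_fst.prodMk hLd).congr_fderiv
    (ContinuousLinearMap.ext fun v => Prod.ext rfl ?_)
  have hBv : B v.2 = L (0, v.2) :=
    DFunLike.congr_fun (hB.trans (hasFDerivAt_slice hΘ hp p.2).fderiv) v.2
  simp [hBv, ← map_add]

theorem exists_diffeoFamily (hC : IsCompact C) {r₁ : ℝ} (hr₁ : 0 < r₁)
    (hΘ : ContDiffOn ℝ ∞ (fun p : ℝ × E => Θ p.1 p.2) (Set.Ioo (-r₁) r₁ ×ˢ Set.univ))
    (hΘC : ∀ s ∈ Set.Ioo (-r₁) r₁, ∀ q ∉ C, Θ s q = q) (hΘ₀ : ∀ q, Θ 0 q = q) :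
    ∃ r > 0, r ≤ r₁ ∧ ∃ Ψ : DiffeoFamily (Set.Ioo (-r) r) C, Ψ.map = Θ := by
  obtain ⟨r, hr, hle, hclose⟩ := exists_pos_forall_norm_fderiv_sub_id_le hC hr₁ hΘ hΘC hΘ₀
    (ε := (1 / 2 : NNReal)) (by norm_num)
  have hΘr := hΘ.mono (Set.prod_mono (Ioo_neg_subset hle) subset_rfl)
  have hbij : ∀ s ∈ Set.Ioo (-r) r, Function.Bijective (Θ s) := fun s hs =>
    bijective_of_norm_fderiv_sub_id_le
      (fun q => (hasFDerivAt_slice hΘr hs q).differentiableAt) (by norm_num) (hclose s hs)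
  obtain ⟨e, hes, he, hsymm⟩ := exists_openPartialHomeomorph_of_injOn
    (f := fun p : ℝ × E => (p.1, Θ p.1 p.2)) (isOpen_Ioo.prod isOpen_univ)
    (contDiffOn_fst.prodMk hΘr)
    (by
      rintro ⟨s, p⟩ ⟨hs, -⟩ ⟨s', q⟩ - hpq
      obtain ⟨rfl, hΘpq⟩ := Prod.mk.inj hpq
      exact congrArg (Prod.mk s) ((hbij s hs).1 hΘpq))
    fun p hp => exists_equiv_hasFDerivAt_prodMk_family hΘr hp.1
      ((hclose p.1 hp.1 p.2).trans_lt (by norm_num))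
  have hleft : ∀ s ∈ Set.Ioo (-r) r, ∀ q, e.symm (s, Θ s q) = (s, q) := fun s hs q => by
    rw [← he (s, q), e.left_inv (hes ▸ ⟨hs, trivial⟩)]
  have htarget : Set.Ioo (-r) r ×ˢ (Set.univ : Set E) ⊆ e.target := by
    rintro ⟨s, q⟩ ⟨hs, -⟩
    obtain ⟨p, rfl⟩ := (hbij s hs).2 q
    rw [← he (s, p)]
    exact e.map_source (hes ▸ ⟨hs, trivial⟩)
  refine ⟨r, hr, hle,
    { map := Θ
      inv := fun s q => (e.symm (s, q)).2
      contDiffOn_map := hΘr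
      contDiffOn_inv := contDiff_snd.comp_contDiffOn (hsymm.mono htarget)
      inv_map := fun s hs q => by rw [hleft s hs]
      map_inv := fun s hs q => ?_
      map_eq_self := fun s hs => hΘC s (Ioo_neg_subset hle hs) }, rfl⟩
  obtain ⟨p, rfl⟩ := (hbij s hs).2 q
  rw [hleft s hs]

theorem exists_diffeoFamily_comp_eq {N : Set E} (hN : IsOpen N) (hC : IsCompact C)
    (hCN : C ⊆ N) {r₀ : ℝ} (hr₀ : 0 < r₀) {ρ : ℝ → E → E}
    (hρ : ContDiffOn ℝ ∞ (fun p : ℝ × E => ρ p.1 p.2) (Set.Ioo (-r₀) r₀ ×ˢ N))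
    (hfix : ∀ s ∈ Set.Ioo (-r₀) r₀, ∀ q ∈ N, q ∉ C → ρ s q = ρ 0 q)
    {e : OpenPartialHomeomorph E E} (hes : e.source = N) (he : ∀ q ∈ N, e q = ρ 0 q)
    (hsymm : ContDiffOn ℝ ∞ e.symm e.target) :
    ∃ r > 0, r ≤ r₀ ∧ ∃ Θ : DiffeoFamily (Set.Ioo (-r) r) C, (∀ q, Θ.map 0 q = q) ∧
      ∀ s ∈ Set.Ioo (-r) r, ∀ q ∈ N, Θ.map s q ∈ N ∧ ρ 0 (Θ.map s q) = ρ s q := by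
  classical
  have hemaps : ∀ q ∈ N, ρ 0 q ∈ e.target := fun q hq => by
    rw [← he q hq]
    exact e.map_source (hes ▸ hq)
  obtain ⟨r, hr, hle, hrC⟩ := exists_pos_le_forall_Ioo_of_isOpen hC
    (hρ.continuousOn.isOpen_inter_preimage (isOpen_Ioo.prod hN) e.open_target)
    (fun q hq => ⟨⟨by simpa using hr₀, hCN hq⟩, hemaps q (hCN hq)⟩) hr₀
  have htarget : ∀ s ∈ Set.Ioo (-r) r, ∀ q ∈ N, ρ s q ∈ e.target := fun s hs q hq => by
    by_cases hqC : q ∈ C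
    · exact (hrC s hs q hqC).2
    · rw [hfix s (Ioo_neg_subset hle hs) q hq hqC]
      exact hemaps q hq
  let Θ : ℝ → E → E := fun s q => if q ∈ N then e.symm (ρ s q) else q
  have hΘN : ∀ s, ∀ q ∈ N, Θ s q = e.symm (ρ s q) := fun s q hq => if_pos hq
  have hΘ_eq_self : ∀ s q, (q ∈ N → ρ s q = ρ 0 q) → Θ s q = q := fun s q hq => by
    by_cases hqN : q ∈ N
    · rw [hΘN s q hqN, hq hqN, ← he q hqN, e.left_inv (hes ▸ hqN)]
    · exact if_neg hqN
  have hΘC : ∀ s ∈ Set.Ioo (-r) r, ∀ q ∉ C, Θ s q = q := fun s hs q hq =>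
    hΘ_eq_self s q fun hqN => hfix s (Ioo_neg_subset hle hs) q hqN hq
  have hΘ₀ : ∀ q, Θ 0 q = q := fun q => hΘ_eq_self 0 q fun _ => rfl
  have hΘ := contDiffOn_extend_id isOpen_Ioo hN hC.isClosed hCN
    (hρ.mono (Set.prod_mono (Ioo_neg_subset hle) subset_rfl)) e.open_target hsymm htarget
    (fun s _ => hΘN s) hΘC
  obtain ⟨r', hr', hle', Ψ, hΨ⟩ := exists_diffeoFamily hC hr hΘ hΘC hΘ₀
  refine ⟨r', hr', hle'.trans hle, Ψ, hΨ ▸ hΘ₀, fun s hs q hq => ?_⟩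
  have hmem := htarget s (Ioo_neg_subset hle' hs) q hq
  rw [hΨ]
  have hΘmem : Θ s q ∈ N := by
    rw [hΘN s q hq]
    exact hes ▸ e.map_target hmem
  exact ⟨hΘmem, by rw [← he _ hΘmem, hΘN s q hq, e.right_inv hmem]⟩

end Perturbation

section EmbeddingNearCompact

theorem hasFDerivAt_fderiv_of_contDiffOn {E F : Type*} [NormedAddCommGroup E] [NormedSpace ℝ E]
    [NormedAddCommGroup F] [NormedSpace ℝ F] {f : E → F} {N : Set E} (hN : IsOpen N)
    (hf : ContDiffOn ℝ ∞ f N) {q : E} (hq : q ∈ N) : HasFDerivAt f (fderiv ℝ f q) q :=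
  ((hf.contDiffAt (hN.mem_nhds hq)).differentiableAt (by simp)).hasFDerivAt

variable {E : Type*} [NormedAddCommGroup E] [NormedSpace ℝ E] [FiniteDimensional ℝ E]

theorem exists_equiv_of_injective (L : E →L[ℝ] E) (hL : ∀ v, L v = 0 → v = 0) :
    ∃ A : E ≃L[ℝ] E, (A : E →L[ℝ] E) = L := by
  have hinj : Function.Injective L.toLinearMap := by
    rw [← LinearMap.ker_eq_bot, LinearMap.ker_eq_bot']
    exact hL
  exact ⟨(LinearEquiv.ofInjectiveEndo L.toLinearMap hinj).toContinuousLinearEquiv,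
    ContinuousLinearMap.ext fun v => rfl⟩

theorem exists_openPartialHomeomorph_of_isCompact {f : E → E} {N J : Set E} (hN : IsOpen N)
    (hf : ContDiffOn ℝ ∞ f N) (hJ : IsCompact J) (hJN : J ⊆ N) (hinj : Set.InjOn f J)
    (hd : ∀ q ∈ J, ∀ v, fderiv ℝ f q v = 0 → v = 0) :
    ∃ e : OpenPartialHomeomorph E E, J ⊆ e.source ∧ e.source ⊆ N ∧ (∀ q, e q = f q) ∧
      ContDiffOn ℝ ∞ e.symm e.target := by
  have : CompleteSpace E := FiniteDimensional.complete ℝ E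
  have hloc : ∀ q ∈ J, ∃ U ∈ 𝓝 q, Set.InjOn f U := by
    intro q hq
    obtain ⟨A, hA⟩ := exists_equiv_of_injective _ (hd q hq)
    obtain ⟨e, hqe, -, hef, -⟩ := exists_openPartialHomeomorph_of_hasFDerivAt hN hf (hJN hq)
      (A := A) (hA ▸ hasFDerivAt_fderiv_of_contDiffOn hN hf (hJN hq))
    have heinj := e.injOn
    rw [show (e : E → E) = f from funext hef] at heinj
    exact ⟨e.source, e.open_source.mem_nhds hqe, heinj⟩
  obtain ⟨t, ht, htinj⟩ := hinj.exists_mem_nhdsSet hJ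
    (fun q hq => (hasFDerivAt_fderiv_of_contDiffOn hN hf (hJN hq)).continuousAt) hloc
  obtain ⟨T, hT, hJT, hTt⟩ := mem_nhdsSet_iff_exists.1 ht
  let R : Set (E →L[ℝ] E) := Set.range (ContinuousLinearEquiv.toContinuousLinearMap (M₁ := E)
    (M₂ := E) (σ₁₂ := RingHom.id ℝ))
  have hNR : IsOpen (N ∩ fderiv ℝ f ⁻¹' R) :=
    (hf.continuousOn_fderiv_of_isOpen hN (by simp)).isOpen_inter_preimage hN
      ContinuousLinearEquiv.isOpen
  obtain ⟨e, hes, hef, hsymm⟩ := exists_openPartialHomeomorph_of_injOn (hT.inter hNR)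
    (hf.mono fun q hq => hq.2.1) (htinj.mono fun q hq => hTt hq.1) (by
      rintro q ⟨-, hqN, A, hA⟩
      exact ⟨A, hA ▸ hasFDerivAt_fderiv_of_contDiffOn hN hf hqN⟩)
  refine ⟨e, fun q hq => ?_, fun q hq => (hes ▸ hq : q ∈ T ∩ (N ∩ fderiv ℝ f ⁻¹' R)).2.1, hef,
    hsymm⟩
  rw [hes]
  exact ⟨hJT hq, hJN hq, exists_equiv_of_injective _ (hd q hq)⟩

end EmbeddingNearCompact

/-- Coordinate space `ℝ³`, with coordinates named `(x, y, z)`. -/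
abbrev V3 : Type := ℝ × ℝ × ℝ

section Axis

theorem hasDerivAt_axis (x : ℝ) : HasDerivAt (fun t : ℝ => ((t, 0, 0) : V3)) (1, 0, 0) x :=
  (hasDerivAt_id x).prodMk (hasDerivAt_const x (0 : ℝ × ℝ))

theorem continuous_axis : Continuous fun t : ℝ => ((t, 0, 0) : V3) := by fun_prop

theorem axis_eq_of_snd_eq_zero {q : V3} (hq : q.2 = 0) : (q.1, 0, 0) = q := Prod.ext rfl hq.symm

theorem fderiv_axis_of_hasDerivAt {F : Type*} [NormedAddCommGroup F] [NormedSpace ℝ F]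
    {f : V3 → F} {N : Set V3} (hN : IsOpen N) (hf : ContDiffOn ℝ ∞ f N) {g : ℝ → F} {g' : F}
    {x : ℝ} (hg : HasDerivAt g g' x) (hfg : ∀ t, (t, 0, 0) ∈ N → f (t, 0, 0) = g t)
    (hx : (x, 0, 0) ∈ N) : fderiv ℝ f (x, 0, 0) (1, 0, 0) = g' := by
  have hcomp := HasFDerivAt.comp_hasDerivAt (l := f) x
    (hasFDerivAt_fderiv_of_contDiffOn hN hf hx) (hasDerivAt_axis x)
  refine hcomp.unique (hg.congr_of_eventuallyEq ?_)
  filter_upwards [continuous_axis.continuousAt.eventually_mem (hN.mem_nhds hx)] with t ht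
    using hfg t ht

theorem clm_apply_eq (L : V3 →L[ℝ] ℝ) (v : V3) :
    L v = v.1 * L (1, 0, 0) + v.2.1 * L (0, 1, 0) + v.2.2 * L (0, 0, 1) := by
  have hv : v = v.1 • ((1, 0, 0) : V3) + v.2.1 • ((0, 1, 0) : V3) + v.2.2 • ((0, 0, 1) : V3) := by
    ext <;> simp
  conv_lhs => rw [hv]
  simp only [map_add, map_smul, smul_eq_mul]

theorem exists_openPartialHomeomorph_near_axis {f : V3 → V3} {N J : Set V3} (hN : IsOpen N)
    (hf : ContDiffOn ℝ ∞ f N) (hfix : ∀ x, (x, 0, 0) ∈ N → f (x, 0, 0) = (x, 0, 0))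
    (hd : ∀ x, (x, 0, 0) ∈ N → ∀ v, fderiv ℝ f (x, 0, 0) v = 0 → v = 0)
    (hJ : IsCompact J) (hJN : J ⊆ N) (hJ₀ : ∀ q ∈ J, q.2 = 0) :
    ∃ e : OpenPartialHomeomorph V3 V3, J ⊆ e.source ∧ e.source ⊆ N ∧ (∀ q, e q = f q) ∧
      ContDiffOn ℝ ∞ e.symm e.target := by
  have haxis : ∀ q ∈ J, (q.1, 0, 0) = q := fun q hq => axis_eq_of_snd_eq_zero (hJ₀ q hq)
  have hfixJ : ∀ q ∈ J, f q = q := fun q hq => by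
    have hq₀ := hfix q.1
    rw [haxis q hq] at hq₀
    exact hq₀ (hJN hq)
  refine exists_openPartialHomeomorph_of_isCompact hN hf hJ hJN
    (fun p hp q hq hpq => by rwa [hfixJ p hp, hfixJ q hq] at hpq) fun q hq => ?_
  have hqd := hd q.1
  rw [haxis q hq] at hqd
  exact hqd (hJN hq)

end Axis

section GeneratingFunctions

/-- The standard contact form `dz - y dx` on `ℝ³`, evaluated at the point `q` on the vector
`v`. -/
def stdForm (q v : V3) : ℝ := v.2.2 - q.2.1 * v.1

/-- The partial derivative `∂W/∂x`. -/
def partialX (W : V3 → ℝ) (q : V3) : ℝ := fderiv ℝ W q (1, 0, 0)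

/-- The partial derivative `∂W/∂y`. -/
def partialY (W : V3 → ℝ) (q : V3) : ℝ := fderiv ℝ W q (0, 1, 0)

/-- The partial derivative `∂W/∂z`. -/
def partialZ (W : V3 → ℝ) (q : V3) : ℝ := fderiv ℝ W q (0, 0, 1)

/-- A generating function `W (x, Y, z)` describes a contact transformation by mixed
coordinates: `x` and `z` belong to the source, `Y` to the target. This map recovers the source
point `(x, y, z)`. -/
def genSource (W : V3 → ℝ) (q : V3) : V3 := (q.1, -(partialX W q / partialZ W q), q.2.2)

/-- The target point `(X, Y, Z)` of the contact transformation with generating function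
`W (x, Y, z)`, as a function of the mixed coordinates. -/
def genTarget (W : V3 → ℝ) (q : V3) : V3 := (-partialY W q, q.2.1, W q - q.2.1 * partialY W q)

variable {W : V3 → ℝ} {N : Set V3}

theorem genSource_congr {W' : V3 → ℝ} {q : V3} (h : W =ᶠ[𝓝 q] W') :
    genSource W q = genSource W' q := by
  simp only [genSource, partialX, partialZ, h.fderiv_eq]

theorem genTarget_congr {W' : V3 → ℝ} {q : V3} (h : W =ᶠ[𝓝 q] W') :
    genTarget W q = genTarget W' q := by
  simp only [genTarget, partialY, h.fderiv_eq, h.eq_of_nhds]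

theorem contDiffOn_fderiv_apply (hN : IsOpen N) (hW : ContDiffOn ℝ ∞ W N) (v : V3) :
    ContDiffOn ℝ ∞ (fun q => fderiv ℝ W q v) N :=
  ((contDiffOn_infty_iff_fderiv_of_isOpen hN).1 hW).2.clm_apply contDiffOn_const

theorem contDiffOn_partialX (hN : IsOpen N) (hW : ContDiffOn ℝ ∞ W N) :
    ContDiffOn ℝ ∞ (partialX W) N := contDiffOn_fderiv_apply hN hW _

theorem contDiffOn_partialY (hN : IsOpen N) (hW : ContDiffOn ℝ ∞ W N) :
    ContDiffOn ℝ ∞ (partialY W) N := contDiffOn_fderiv_apply hN hW _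

theorem contDiffOn_partialZ (hN : IsOpen N) (hW : ContDiffOn ℝ ∞ W N) :
    ContDiffOn ℝ ∞ (partialZ W) N := contDiffOn_fderiv_apply hN hW _

theorem contDiffOn_genSource (hN : IsOpen N) (hW : ContDiffOn ℝ ∞ W N)
    (hz : ∀ q ∈ N, partialZ W q ≠ 0) : ContDiffOn ℝ ∞ (genSource W) N :=
  contDiffOn_fst.prodMk (((contDiffOn_partialX hN hW).div (contDiffOn_partialZ hN hW) hz).neg.prodMk
    contDiff_snd.snd.contDiffOn)

theorem contDiffOn_genTarget (hN : IsOpen N) (hW : ContDiffOn ℝ ∞ W N) :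
    ContDiffOn ℝ ∞ (genTarget W) N :=
  have hY := contDiffOn_partialY hN hW
  have hy : ContDiffOn ℝ ∞ (fun q : V3 => q.2.1) N := contDiff_snd.fst.contDiffOn
  hY.neg.prodMk (hy.prodMk (hW.sub (hy.mul hY)))

theorem fderiv_genSource_apply (hN : IsOpen N) (hW : ContDiffOn ℝ ∞ W N) {q : V3} (hq : q ∈ N)
    (hz : partialZ W q ≠ 0) (v : V3) :
    fderiv ℝ (genSource W) q v =
      (v.1, -(fderiv ℝ (partialX W) q v / partialZ W q -
        partialX W q * fderiv ℝ (partialZ W) q v / partialZ W q ^ 2), v.2.2) := by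
  have hX := hasFDerivAt_fderiv_of_contDiffOn hN (contDiffOn_partialX hN hW) hq
  have hZ : HasFDerivAt (fun p => (partialZ W p)⁻¹) _ q := (hasDerivAt_inv hz).comp_hasFDerivAt q
    (hasFDerivAt_fderiv_of_contDiffOn hN (contDiffOn_partialZ hN hW) hq)
  have hS : HasFDerivAt (fun p => (p.1, -(partialX W p * (partialZ W p)⁻¹), p.2.2)) _ q :=
    hasFDerivAt_fst.prodMk ((hX.mul hZ).neg.prodMk hasFDerivAt_snd.snd)
  rw [show genSource W = _ from funext fun p => by rw [genSource, div_eq_mul_inv], hS.fderiv]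
  refine Prod.ext rfl (Prod.ext ?_ rfl)
  simp [field]
  ring

theorem fderiv_genTarget_apply (hN : IsOpen N) (hW : ContDiffOn ℝ ∞ W N) {q : V3} (hq : q ∈ N)
    (v : V3) :
    fderiv ℝ (genTarget W) q v =
      (-fderiv ℝ (partialY W) q v, v.2.1, fderiv ℝ W q v -
        (q.2.1 * fderiv ℝ (partialY W) q v + v.2.1 * partialY W q)) := by
  have hY := hasFDerivAt_fderiv_of_contDiffOn hN (contDiffOn_partialY hN hW) hq
  have hy : HasFDerivAt (fun q : V3 => q.2.1) _ q :=
    (hasFDerivAt_snd (𝕜 := ℝ) (p := q)).fst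
  have hT : HasFDerivAt (genTarget W) _ q :=
    hY.neg.prodMk (hy.prodMk ((hasFDerivAt_fderiv_of_contDiffOn hN hW hq).sub (hy.mul hY)))
  rw [hT.fderiv]
  refine Prod.ext rfl (Prod.ext rfl ?_)
  simp [mul_comm]

theorem stdForm_genTarget (hN : IsOpen N) (hW : ContDiffOn ℝ ∞ W N) {q : V3} (hq : q ∈ N)
    (hz : partialZ W q ≠ 0) (v : V3) :
    stdForm (genTarget W q) (fderiv ℝ (genTarget W) q v) =
      partialZ W q * stdForm (genSource W q) (fderiv ℝ (genSource W) q v) := by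
  have hWv : fderiv ℝ W q v = v.1 * partialX W q + v.2.1 * partialY W q + v.2.2 * partialZ W q :=
    clm_apply_eq _ v
  rw [fderiv_genTarget_apply hN hW hq, fderiv_genSource_apply hN hW hq hz, hWv]
  simp only [stdForm, genTarget, genSource]
  field_simp
  ring

theorem fderiv_fderiv_apply_comm (hN : IsOpen N) (hW : ContDiffOn ℝ ∞ W N) {q : V3}
    (hq : q ∈ N) (u v : V3) :
    fderiv ℝ (fun p => fderiv ℝ W p u) q v = fderiv ℝ (fun p => fderiv ℝ W p v) q u := by
  have hd := hasFDerivAt_fderiv_of_contDiffOn hN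
    ((contDiffOn_infty_iff_fderiv_of_isOpen hN).1 hW).2 hq
  have hsymm : IsSymmSndFDerivAt ℝ W q :=
    (hW.contDiffAt (hN.mem_nhds hq)).isSymmSndFDerivAt (by
      rw [minSmoothness_of_isRCLikeNormedField]
      exact WithTop.coe_le_coe.2 (le_top (a := (2 : ℕ∞))))
  have happly : ∀ w v : V3, fderiv ℝ (fun p => fderiv ℝ W p w) q v =
      fderiv ℝ (fderiv ℝ W) q v w := fun w v => by
    have hw : HasFDerivAt (fun p => fderiv ℝ W p w) _ q :=
      (ContinuousLinearMap.apply ℝ ℝ w).hasFDerivAt.comp q hd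
    rw [hw.fderiv]
    rfl
  rw [happly, happly]
  exact hsymm v u

end GeneratingFunctions

/-- Generating functions, on an open set `N`, of the coorientation preserving contact
transformations that fix the points of the `x`-axis. -/
structure IsAxisGenerating (W : V3 → ℝ) (N : Set V3) : Prop where
  isOpen : IsOpen N
  smooth : ContDiffOn ℝ ∞ W N
  pos : ∀ q ∈ N, 0 < partialZ W q
  zero : ∀ x, (x, 0, 0) ∈ N → W (x, 0, 0) = 0
  partialY_eq : ∀ x, (x, 0, 0) ∈ N → partialY W (x, 0, 0) = -x

namespace IsAxisGenerating

variable {W : V3 → ℝ} {N : Set V3}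

theorem mono (h : IsAxisGenerating W N) {N' : Set V3} (hN' : IsOpen N') (hsub : N' ⊆ N) :
    IsAxisGenerating W N' :=
  ⟨hN', h.smooth.mono hsub, fun q hq => h.pos q (hsub hq), fun x hx => h.zero x (hsub hx),
    fun x hx => h.partialY_eq x (hsub hx)⟩

theorem contDiffOn_genSource (h : IsAxisGenerating W N) : ContDiffOn ℝ ∞ (genSource W) N :=
  ContactTopology.contDiffOn_genSource h.isOpen h.smooth fun q hq => (h.pos q hq).ne'

theorem contDiffOn_genTarget (h : IsAxisGenerating W N) : ContDiffOn ℝ ∞ (genTarget W) N :=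
  ContactTopology.contDiffOn_genTarget h.isOpen h.smooth

theorem partialX_axis (h : IsAxisGenerating W N) {x : ℝ} (hx : (x, 0, 0) ∈ N) :
    partialX W (x, 0, 0) = 0 :=
  fderiv_axis_of_hasDerivAt h.isOpen h.smooth (hasDerivAt_const x 0) h.zero hx

theorem genSource_axis (h : IsAxisGenerating W N) {x : ℝ} (hx : (x, 0, 0) ∈ N) :
    genSource W (x, 0, 0) = (x, 0, 0) := by
  simp [genSource, h.partialX_axis hx]

theorem genTarget_axis (h : IsAxisGenerating W N) {x : ℝ} (hx : (x, 0, 0) ∈ N) :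
    genTarget W (x, 0, 0) = (x, 0, 0) := by
  simp [genTarget, h.partialY_eq x hx, h.zero x hx]

theorem fderiv_partialY_axis (h : IsAxisGenerating W N) {x : ℝ} (hx : (x, 0, 0) ∈ N) :
    fderiv ℝ (partialY W) (x, 0, 0) (1, 0, 0) = -1 :=
  fderiv_axis_of_hasDerivAt h.isOpen (contDiffOn_partialY h.isOpen h.smooth)
    (hasDerivAt_id x).neg h.partialY_eq hx

theorem fderiv_partialX_axis (h : IsAxisGenerating W N) {x : ℝ} (hx : (x, 0, 0) ∈ N) :
    fderiv ℝ (partialX W) (x, 0, 0) (0, 1, 0) = -1 :=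
  (fderiv_fderiv_apply_comm h.isOpen h.smooth hx _ _).trans (h.fderiv_partialY_axis hx)

theorem fderiv_genTarget_axis_injective (h : IsAxisGenerating W N) {x : ℝ}
    (hx : (x, 0, 0) ∈ N) (v : V3) (hv : fderiv ℝ (genTarget W) (x, 0, 0) v = 0) : v = 0 := by
  rw [fderiv_genTarget_apply h.isOpen h.smooth hx, Prod.mk_eq_zero, Prod.mk_eq_zero] at hv
  obtain ⟨hX, hy, hZ⟩ := hv
  have hW : fderiv ℝ W (x, 0, 0) v = v.1 * partialX W (x, 0, 0) +
      v.2.1 * partialY W (x, 0, 0) + v.2.2 * partialZ W (x, 0, 0) := clm_apply_eq _ v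
  have hz : v.2.2 = 0 := by
    simpa [hW, hy, h.partialX_axis hx, (h.pos _ hx).ne'] using hZ
  have hx₁ : v.1 = 0 := by
    rw [clm_apply_eq, h.fderiv_partialY_axis hx, hy, hz] at hX
    simpa using hX
  exact Prod.ext hx₁ (Prod.ext hy hz)

theorem fderiv_genSource_axis_injective (h : IsAxisGenerating W N) {x : ℝ}
    (hx : (x, 0, 0) ∈ N) (v : V3) (hv : fderiv ℝ (genSource W) (x, 0, 0) v = 0) : v = 0 := by
  have hpos := (h.pos _ hx).ne'
  rw [fderiv_genSource_apply h.isOpen h.smooth hx hpos, Prod.mk_eq_zero, Prod.mk_eq_zero] at hv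
  obtain ⟨hx₁, hY, hz⟩ := hv
  have hy : v.2.1 = 0 := by
    rw [clm_apply_eq, h.fderiv_partialX_axis hx, hx₁, hz] at hY
    simpa [h.partialX_axis hx, hpos] using hY
  exact Prod.ext hx₁ (Prod.ext hy hz)

theorem exists_openPartialHomeomorph {J : Set V3} (h : IsAxisGenerating W N) (hJ : IsCompact J)
    (hJN : J ⊆ N) (hJ₀ : ∀ q ∈ J, q.2 = 0) :
    ∃ N' ⊆ N, J ⊆ N' ∧
      (∃ e : OpenPartialHomeomorph V3 V3, e.source = N' ∧ (∀ q, e q = genSource W q) ∧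
        ContDiffOn ℝ ∞ e.symm e.target) ∧
      (∃ e : OpenPartialHomeomorph V3 V3, e.source = N' ∧ (∀ q, e q = genTarget W q) ∧
        ContDiffOn ℝ ∞ e.symm e.target) ∧
      ∀ q ∈ N', (genTarget W q).2 = 0 → q.2 = 0 := by
  obtain ⟨eS, hJS, -, heS, hSsymm⟩ := exists_openPartialHomeomorph_near_axis h.isOpen
    h.contDiffOn_genSource (fun x => h.genSource_axis)
    (fun x => h.fderiv_genSource_axis_injective) hJ hJN hJ₀
  obtain ⟨eT, hJT, hTN, heT, hTsymm⟩ := exists_openPartialHomeomorph_near_axis h.isOpen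
    h.contDiffOn_genTarget (fun x => h.genTarget_axis)
    (fun x => h.fderiv_genTarget_axis_injective) hJ hJN hJ₀
  have hST : IsOpen (eS.source ∩ eT.source) := eS.open_source.inter eT.open_source
  set N' := eS.source ∩ eT.source ∩ genTarget W ⁻¹' (eS.source ∩ eT.source)
  have hN' : IsOpen N' := (h.contDiffOn_genTarget.mono fun q hq => hTN hq.2).continuousOn
    |>.isOpen_inter_preimage hST hST
  refine ⟨N', fun q hq => hTN hq.1.2, fun q hq => ⟨⟨hJS hq, hJT hq⟩, ?_⟩,
    ⟨eS.restrOpen N' hN', ?_, heS, hSsymm.mono Set.inter_subset_left⟩,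
    ⟨eT.restrOpen N' hN', ?_, heT, hTsymm.mono Set.inter_subset_left⟩, fun q hq hq₀ => ?_⟩
  · have haxis := axis_eq_of_snd_eq_zero (hJ₀ q hq)
    have hT := h.genTarget_axis (x := q.1) (by rw [haxis]; exact hJN hq)
    rw [haxis] at hT
    rw [Set.mem_preimage, hT]
    exact ⟨hJS hq, hJT hq⟩
  · exact Set.inter_eq_right.2 fun q hq => hq.1.1
  · exact Set.inter_eq_right.2 fun q hq => hq.1.2
  · have haxis := axis_eq_of_snd_eq_zero hq₀
    have hmem : ((genTarget W q).1, 0, 0) ∈ eT.source := haxis ▸ hq.2.2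
    have heq := eT.injOn hmem hq.1.2 (by rw [heT, heT, h.genTarget_axis (hTN hmem), haxis])
    rw [← heq]
    rfl

end IsAxisGenerating

/-- The admissible perturbations of the functions in `IsAxisGenerating`: they vanish on the
`x`-axis together with their derivative in the direction `y`. -/
structure IsAxisPerturbation (Q : V3 → ℝ) (N : Set V3) : Prop where
  smooth : ContDiffOn ℝ ∞ Q N
  zero : ∀ x, (x, 0, 0) ∈ N → Q (x, 0, 0) = 0
  partialY_zero : ∀ x, (x, 0, 0) ∈ N → partialY Q (x, 0, 0) = 0

theorem fderiv_add_mul_apply {W Q : V3 → ℝ} {N : Set V3} (hN : IsOpen N)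
    (hW : ContDiffOn ℝ ∞ W N) (hQ : ContDiffOn ℝ ∞ Q N) {q : V3} (hq : q ∈ N) (s : ℝ) (v : V3) :
    fderiv ℝ (fun p => W p + s * Q p) q v = fderiv ℝ W q v + s * fderiv ℝ Q q v := by
  have h : HasFDerivAt (fun p => W p + s * Q p) _ q :=
    (hasFDerivAt_fderiv_of_contDiffOn hN hW hq).add
      ((hasFDerivAt_fderiv_of_contDiffOn hN hQ hq).const_mul s)
  rw [h.fderiv]
  rfl

theorem IsAxisGenerating.add_mul {W Q : V3 → ℝ} {N : Set V3} (h : IsAxisGenerating W N)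
    (hQ : IsAxisPerturbation Q N) {s : ℝ}
    (hpos : ∀ q ∈ N, 0 < partialZ W q + s * partialZ Q q) :
    IsAxisGenerating (fun q => W q + s * Q q) N where
  isOpen := h.isOpen
  smooth := h.smooth.add (contDiffOn_const.mul hQ.smooth)
  pos q hq := by
    rw [partialZ, fderiv_add_mul_apply h.isOpen h.smooth hQ.smooth hq]
    exact hpos q hq
  zero x hx := by simp [h.zero x hx, hQ.zero x hx]
  partialY_eq x hx := by
    rw [partialY, fderiv_add_mul_apply h.isOpen h.smooth hQ.smooth hx]
    change partialY W _ + s * partialY Q _ = -x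
    rw [h.partialY_eq x hx, hQ.partialY_zero x hx, mul_zero, add_zero]

theorem IsAxisPerturbation.mono {Q : V3 → ℝ} {N N' : Set V3} (hQ : IsAxisPerturbation Q N)
    (hsub : N' ⊆ N) : IsAxisPerturbation Q N' :=
  ⟨hQ.smooth.mono hsub, fun x hx => hQ.zero x (hsub hx), fun x hx => hQ.partialY_zero x (hsub hx)⟩

theorem IsAxisPerturbation.mul {Q χ : V3 → ℝ} {N N' : Set V3} (hQ : IsAxisPerturbation Q N)
    (hN' : IsOpen N') (hsub : N' ⊆ N) (hχ : ContDiff ℝ ∞ χ) :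
    IsAxisPerturbation (fun q => χ q * Q q) N' where
  smooth := hχ.contDiffOn.mul (hQ.smooth.mono hsub)
  zero x hx := by simp [hQ.zero x (hsub hx)]
  partialY_zero x hx := by
    have hmul : HasFDerivAt (fun q => χ q * Q q) _ (x, 0, 0) :=
      (hχ.differentiable (by simp) _).hasFDerivAt.mul
        (hasFDerivAt_fderiv_of_contDiffOn hN' (hQ.smooth.mono hsub) hx)
    have hY : fderiv ℝ Q (x, 0, 0) (0, 1, 0) = 0 := hQ.partialY_zero x (hsub hx)
    rw [partialY, hmul.fderiv]
    simp [hY, hQ.zero x (hsub hx)]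

namespace DiffeoFamily

variable {E : Type*} [NormedAddCommGroup E] [NormedSpace ℝ E] {I : Set ℝ} {C : Set E}

theorem contDiff_map (Θ : DiffeoFamily I C) {s : ℝ} (hs : s ∈ I) : ContDiff ℝ ∞ (Θ.map s) :=
  contDiffOn_univ.1 <| Θ.contDiffOn_map.comp (f := fun q : E => (s, q)) (by fun_prop)
    fun _ _ => ⟨hs, trivial⟩

/-- The family of inverse diffeomorphisms. -/
def symm (Θ : DiffeoFamily I C) : DiffeoFamily I C where
  map := Θ.inv
  inv := Θ.map
  contDiffOn_map := Θ.contDiffOn_inv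
  contDiffOn_inv := Θ.contDiffOn_map
  inv_map := Θ.map_inv
  map_inv := Θ.inv_map
  map_eq_self s hs q hq := by
    have hinv := Θ.inv_map s hs q
    rwa [Θ.map_eq_self s hs q hq] at hinv

/-- The family `s ↦ Ω s ∘ Θ s`. -/
def comp (Ω Θ : DiffeoFamily I C) : DiffeoFamily I C where
  map s q := Ω.map s (Θ.map s q)
  inv s q := Θ.inv s (Ω.inv s q)
  contDiffOn_map := Ω.contDiffOn_map.comp (contDiffOn_fst.prodMk Θ.contDiffOn_map)
    fun _ hp => ⟨hp.1, trivial⟩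
  contDiffOn_inv := Θ.contDiffOn_inv.comp (contDiffOn_fst.prodMk Ω.contDiffOn_inv)
    fun _ hp => ⟨hp.1, trivial⟩
  inv_map s hs q := by rw [Ω.inv_map s hs, Θ.inv_map s hs]
  map_inv s hs q := by rw [Θ.map_inv s hs, Ω.map_inv s hs]
  map_eq_self s hs q hq := by rw [Θ.map_eq_self s hs q hq, Ω.map_eq_self s hs q hq]

/-- The restriction to a smaller set of parameters. -/
def mono (Θ : DiffeoFamily I C) {I' : Set ℝ} (hI : I' ⊆ I) : DiffeoFamily I' C where
  map := Θ.map
  inv := Θ.inv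
  contDiffOn_map := Θ.contDiffOn_map.mono (Set.prod_mono hI subset_rfl)
  contDiffOn_inv := Θ.contDiffOn_inv.mono (Set.prod_mono hI subset_rfl)
  inv_map s hs := Θ.inv_map s (hI hs)
  map_inv s hs := Θ.map_inv s (hI hs)
  map_eq_self s hs := Θ.map_eq_self s (hI hs)

theorem inv_eq_self (Θ : DiffeoFamily I C) {s : ℝ} (hs : s ∈ I) {q : E} (hq : Θ.map s q = q) :
    Θ.inv s q = q := by
  conv_lhs => rw [← hq]
  exact Θ.inv_map s hs q

theorem map_mem (Θ : DiffeoFamily I C) {s : ℝ} (hs : s ∈ I) {N : Set E} (hCN : C ⊆ N) {q : E}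
    (hq : q ∈ N) : Θ.map s q ∈ N := by
  by_contra hmem
  have hfix : Θ.map s q = q :=
    (Θ.symm.map_eq_self s hs _ fun hC => hmem (hCN hC)).symm.trans (Θ.inv_map s hs q)
  rw [hfix] at hmem
  exact hmem hq

/-- The homeomorphism at the parameter `s`. -/
def toHomeomorph (Θ : DiffeoFamily I C) {s : ℝ} (hs : s ∈ I) : E ≃ₜ E where
  toFun := Θ.map s
  invFun := Θ.inv s
  left_inv := Θ.inv_map s hs
  right_inv := Θ.map_inv s hs
  continuous_toFun := (Θ.contDiff_map hs).continuous
  continuous_invFun := (Θ.symm.contDiff_map hs).continuous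

end DiffeoFamily

theorem exists_bump {E : Type*} [NormedAddCommGroup E] [NormedSpace ℝ E] [FiniteDimensional ℝ E]
    {J N : Set E} (hJ : IsCompact J) (hN : IsOpen N) (hJN : J ⊆ N) :
    ∃ (C : Set E) (χ : E → ℝ), IsCompact C ∧ C ⊆ N ∧ ContDiff ℝ ∞ χ ∧
      (∀ᶠ q in 𝓝ˢ J, χ q = 1) ∧ ∀ q ∉ C, χ q = 0 := by
  obtain ⟨C, hC, hJC, hCN⟩ := exists_compact_between hJ hN hJN
  obtain ⟨χ, hχ₁, hχ₀, -⟩ := exists_contMDiffMap_one_nhds_of_subset_interior (n := ⊤)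
    𝓘(ℝ, E) hJ.isClosed hJC
  exact ⟨C, χ, hC, hCN, χ.contMDiff.contDiff, hχ₁, hχ₀⟩

section Family

variable {W R : V3 → ℝ} {N C : Set V3} {I : Set ℝ}

theorem contDiffOn_fderiv_add_mul (hN : IsOpen N) (hW : ContDiffOn ℝ ∞ W N)
    (hR : ContDiffOn ℝ ∞ R N) (v : V3) :
    ContDiffOn ℝ ∞ (fun p : ℝ × V3 => fderiv ℝ (fun q => W q + p.1 * R q) p.2 v) (I ×ˢ N) := by
  have hsnd : Set.MapsTo (fun p : ℝ × V3 => p.2) (I ×ˢ N) N := fun p hp => hp.2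
  exact (((contDiffOn_fderiv_apply hN hW v).comp contDiffOn_snd hsnd).add
    (contDiffOn_fst.mul ((contDiffOn_fderiv_apply hN hR v).comp contDiffOn_snd hsnd))).congr
    fun p hp => fderiv_add_mul_apply hN hW hR hp.2 p.1 v

theorem contDiffOn_genSource_add_mul (hN : IsOpen N) (hW : ContDiffOn ℝ ∞ W N)
    (hR : ContDiffOn ℝ ∞ R N)
    (hz : ∀ s ∈ I, ∀ q ∈ N, partialZ (fun q => W q + s * R q) q ≠ 0) :
    ContDiffOn ℝ ∞ (fun p : ℝ × V3 => genSource (fun q => W q + p.1 * R q) p.2) (I ×ˢ N) :=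
  contDiff_snd.fst.contDiffOn.prodMk
    (((contDiffOn_fderiv_add_mul hN hW hR (1, 0, 0)).div
      (contDiffOn_fderiv_add_mul hN hW hR (0, 0, 1)) fun p hp => hz p.1 hp.1 p.2 hp.2).neg.prodMk
      contDiff_snd.snd.snd.contDiffOn)

theorem contDiffOn_genTarget_add_mul (hN : IsOpen N) (hW : ContDiffOn ℝ ∞ W N)
    (hR : ContDiffOn ℝ ∞ R N) :
    ContDiffOn ℝ ∞ (fun p : ℝ × V3 => genTarget (fun q => W q + p.1 * R q) p.2) (I ×ˢ N) := by
  have hsnd : Set.MapsTo (fun p : ℝ × V3 => p.2) (I ×ˢ N) N := fun p hp => hp.2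
  have hY := contDiffOn_fderiv_add_mul (I := I) hN hW hR (0, 1, 0)
  have hy : ContDiffOn ℝ ∞ (fun p : ℝ × V3 => p.2.2.1) (I ×ˢ N) :=
    contDiff_snd.snd.fst.contDiffOn
  have hval : ContDiffOn ℝ ∞ (fun p : ℝ × V3 => W p.2 + p.1 * R p.2) (I ×ˢ N) :=
    (hW.comp contDiffOn_snd hsnd).add (contDiffOn_fst.mul (hR.comp contDiffOn_snd hsnd))
  exact hY.neg.prodMk (hy.prodMk (hval.sub (hy.mul hY)))

theorem exists_pos_forall_partialZ_add_mul_pos (hN : IsOpen N) (hW : ContDiffOn ℝ ∞ W N)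
    (hpos : ∀ q ∈ N, 0 < partialZ W q) (hR : ContDiffOn ℝ ∞ R N) (hC : IsCompact C)
    (hCN : C ⊆ N) (hRC : ∀ q ∉ C, R =ᶠ[𝓝 q] 0) :
    ∃ r > 0, ∀ s ∈ Set.Ioo (-r) r, ∀ q ∈ N, 0 < partialZ W q + s * partialZ R q := by
  have hsnd : Set.MapsTo (fun p : ℝ × V3 => p.2) (Set.univ ×ˢ N) N := fun p hp => hp.2
  have hcont : ContinuousOn (fun p : ℝ × V3 => partialZ W p.2 + p.1 * partialZ R p.2)
      (Set.univ ×ˢ N) :=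
    ((contDiffOn_partialZ hN hW).continuousOn.comp continuousOn_snd hsnd).add
      (continuousOn_fst.mul
        ((contDiffOn_partialZ hN hR).continuousOn.comp continuousOn_snd hsnd))
  obtain ⟨r, hr, -, hrC⟩ := exists_pos_le_forall_Ioo_of_isOpen hC
    (hcont.isOpen_inter_preimage (isOpen_univ.prod hN) isOpen_Ioi)
    (fun q hq => ⟨⟨trivial, hCN hq⟩, by simpa using hpos q (hCN hq)⟩) one_pos
  refine ⟨r, hr, fun s hs q hq => ?_⟩
  by_cases hqC : q ∈ C
  · exact (hrC s hs q hqC).2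
  · have hRZ : partialZ R q = 0 := by
      rw [partialZ, (hRC q hqC).fderiv_eq]
      simp
    rw [hRZ, mul_zero, add_zero]
    exact hpos q hq

end Family

section Factor

variable {E F : Type*} [NormedAddCommGroup E] [NormedSpace ℝ E] [NormedAddCommGroup F]
  [NormedSpace ℝ F]

theorem fderiv_apply_fderiv_of_comp_eq {f g : E → F} {Ω : E → E} {N : Set E} (hN : IsOpen N)
    (hΩ : Differentiable ℝ Ω) (hf : ∀ q ∈ N, DifferentiableAt ℝ f q)
    (hΩN : ∀ q ∈ N, Ω q ∈ N ∧ f (Ω q) = g q) {q : E} (hq : q ∈ N) (v : E) :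
    fderiv ℝ f (Ω q) (fderiv ℝ Ω q v) = fderiv ℝ g q v := by
  have heq : g =ᶠ[𝓝 q] f ∘ Ω := by
    filter_upwards [hN.mem_nhds hq] with p hp using (hΩN p hp).2.symm
  rw [heq.fderiv_eq, ((hf _ (hΩN q hq).1).hasFDerivAt.comp q (hΩ q).hasFDerivAt).fderiv]
  rfl

theorem fderiv_apply_fderiv_of_rightInverse {Θ Θ' : E → E} (hΘ : Differentiable ℝ Θ)
    (hΘ' : Differentiable ℝ Θ') (hinv : Function.RightInverse Θ' Θ) (q v : E) :
    fderiv ℝ Θ (Θ' q) (fderiv ℝ Θ' q v) = v := by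
  have hcomp := (hΘ (Θ' q)).hasFDerivAt.comp q (hΘ' q).hasFDerivAt
  rw [hinv.comp_eq_id] at hcomp
  exact (DFunLike.congr_fun (hcomp.unique (hasFDerivAt_id q)) v :)

end Factor

theorem stdForm_comp_of_factor {W U : V3 → ℝ} {N : Set V3} (hW : IsAxisGenerating W N)
    (hU : IsAxisGenerating U N) {Θ Θ' Ω : V3 → V3} (hΘ : Differentiable ℝ Θ)
    (hΘ' : Differentiable ℝ Θ') (hΩ : Differentiable ℝ Ω) (hinv : Function.RightInverse Θ' Θ)
    (hΘN : ∀ q ∈ N, Θ q ∈ N ∧ genSource W (Θ q) = genSource U q)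
    (hΩN : ∀ q ∈ N, Ω q ∈ N ∧ genTarget W (Ω q) = genTarget U q) {q : V3} (hq : q ∈ N)
    (hq' : Θ' q ∈ N) :
    ∃ c > 0, ∀ v, stdForm (genTarget W (Ω (Θ' q)))
        (fderiv ℝ (genTarget W) (Ω (Θ' q)) (fderiv ℝ (fun p => Ω (Θ' p)) q v)) =
      c * stdForm (genTarget W q) (fderiv ℝ (genTarget W) q v) := by
  refine ⟨partialZ U (Θ' q) / partialZ W q, div_pos (hU.pos _ hq') (hW.pos _ hq), fun v => ?_⟩
  set w := fderiv ℝ Θ' q v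
  have hchain : fderiv ℝ (fun p => Ω (Θ' p)) q v = fderiv ℝ Ω (Θ' q) w := by
    have hcomp := ((hΩ (Θ' q)).hasFDerivAt.comp q (hΘ' q).hasFDerivAt).fderiv
    exact DFunLike.congr_fun hcomp v
  have htarget : fderiv ℝ (genTarget W) (Ω (Θ' q)) (fderiv ℝ Ω (Θ' q) w) =
      fderiv ℝ (genTarget U) (Θ' q) w :=
    fderiv_apply_fderiv_of_comp_eq hW.isOpen hΩ (fun p hp => (hasFDerivAt_fderiv_of_contDiffOn
      hW.isOpen hW.contDiffOn_genTarget hp).differentiableAt) hΩN hq' w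
  have hsource : fderiv ℝ (genSource U) (Θ' q) w = fderiv ℝ (genSource W) q v := by
    rw [← fderiv_apply_fderiv_of_comp_eq hW.isOpen hΘ (fun p hp =>
      (hasFDerivAt_fderiv_of_contDiffOn hW.isOpen hW.contDiffOn_genSource hp).differentiableAt)
      hΘN hq' w, fderiv_apply_fderiv_of_rightInverse hΘ hΘ' hinv, hinv]
  have hpoint : genSource U (Θ' q) = genSource W q := by rw [← (hΘN _ hq').2, hinv]
  rw [hchain, htarget, (hΩN _ hq').2, stdForm_genTarget hU.isOpen hU.smooth hq' (hU.pos _ hq').ne',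
    hpoint, hsource, stdForm_genTarget hW.isOpen hW.smooth hq (hW.pos _ hq).ne', ← mul_assoc,
    div_mul_cancel₀ _ (hW.pos _ hq).ne']

/-- The data that moves the contact transformation generated by `W` to the ones generated by
`W + s Q`, along the compact set `J`. The perturbation is `R`, a cut-off of `Q`. In the mixed
coordinates, `Θ s` and `Ω s` describe how the source and the target points move, so that
`Ω s ∘ (Θ s)⁻¹` is the change of target at a fixed source. -/
structure GeneratingStep (W Q : V3 → ℝ) (J N : Set V3) where
  chart : OpenPartialHomeomorph V3 V3
  chart_source_subset : chart.source ⊆ N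
  chart_apply : ∀ q, chart q = genTarget W q
  chart_axis : ∀ q ∈ chart.source, (genTarget W q).2 = 0 → q.2 = 0
  contDiffOn_chart_symm : ContDiffOn ℝ ∞ chart.symm chart.target
  injOn_genSource : Set.InjOn (genSource W) chart.source
  axis_of_mem : ∀ q ∈ J, q.2 = 0
  subset_source : J ⊆ chart.source
  R : V3 → ℝ
  R_eq : ∀ᶠ q in 𝓝ˢ J, R q = Q q
  R_eq_zero : ∀ q, Q q = 0 → R q = 0
  supp : Set V3
  isCompact_supp : IsCompact supp
  supp_subset : supp ⊆ chart.source
  r : ℝ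
  r_pos : 0 < r
  isAxisGenerating : ∀ s ∈ Set.Ioo (-r) r, IsAxisGenerating (fun p => W p + s * R p) chart.source
  Θ : DiffeoFamily (Set.Ioo (-r) r) supp
  Ω : DiffeoFamily (Set.Ioo (-r) r) supp
  genSource_Θ : ∀ s ∈ Set.Ioo (-r) r, ∀ q ∈ chart.source,
    genSource W (Θ.map s q) = genSource (fun p => W p + s * R p) q
  genTarget_Ω : ∀ s ∈ Set.Ioo (-r) r, ∀ q ∈ chart.source,
    genTarget W (Ω.map s q) = genTarget (fun p => W p + s * R p) q

namespace GeneratingStep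

variable {W Q : V3 → ℝ} {J N : Set V3} (T : GeneratingStep W Q J N) {s : ℝ}

/-- The motion of the target at a fixed source, in the coordinates `genTarget W`. -/
def family : DiffeoFamily (Set.Ioo (-T.r) T.r) T.supp := T.Ω.comp T.Θ.symm

theorem zero_mem : (0 : ℝ) ∈ Set.Ioo (-T.r) T.r := ⟨neg_lt_zero.2 T.r_pos, T.r_pos⟩

theorem isAxisGenerating_source : IsAxisGenerating W T.chart.source := by
  simpa using T.isAxisGenerating 0 T.zero_mem

theorem Θ_map_eq_self (hs : s ∈ Set.Ioo (-T.r) T.r) {q : V3}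
    (hq : q ∈ T.chart.source → genSource (fun p => W p + s * T.R p) q = genSource W q) :
    T.Θ.map s q = q := by
  by_cases hmem : q ∈ T.chart.source
  · exact T.injOn_genSource (T.Θ.map_mem hs T.supp_subset hmem) hmem
      ((T.genSource_Θ s hs q hmem).trans (hq hmem))
  · exact T.Θ.map_eq_self s hs q fun hsupp => hmem (T.supp_subset hsupp)

theorem Ω_map_eq_self (hs : s ∈ Set.Ioo (-T.r) T.r) {q : V3}
    (hq : q ∈ T.chart.source → genTarget (fun p => W p + s * T.R p) q = genTarget W q) :
    T.Ω.map s q = q := by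
  by_cases hmem : q ∈ T.chart.source
  · refine T.chart.injOn (T.Ω.map_mem hs T.supp_subset hmem) hmem ?_
    rw [T.chart_apply, T.chart_apply, T.genTarget_Ω s hs q hmem, hq hmem]
  · exact T.Ω.map_eq_self s hs q fun hsupp => hmem (T.supp_subset hsupp)

theorem family_map_eq_self (hs : s ∈ Set.Ioo (-T.r) T.r) {q : V3}
    (hq : q ∈ T.chart.source → genSource (fun p => W p + s * T.R p) q = genSource W q ∧
      genTarget (fun p => W p + s * T.R p) q = genTarget W q) :
    T.family.map s q = q := by
  change T.Ω.map s (T.Θ.inv s q) = q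
  rw [T.Θ.inv_eq_self hs (T.Θ_map_eq_self hs fun hmem => (hq hmem).1),
    T.Ω_map_eq_self hs fun hmem => (hq hmem).2]

theorem family_map_zero (q : V3) : T.family.map 0 q = q :=
  T.family_map_eq_self T.zero_mem fun _ => by simp

theorem family_map_axis (hs : s ∈ Set.Ioo (-T.r) T.r) (x : ℝ) :
    T.family.map s (x, 0, 0) = (x, 0, 0) :=
  have hW := T.isAxisGenerating_source
  have hU := T.isAxisGenerating s hs
  T.family_map_eq_self hs fun hx => ⟨(hU.genSource_axis hx).trans (hW.genSource_axis hx).symm,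
    (hU.genTarget_axis hx).trans (hW.genTarget_axis hx).symm⟩

theorem eventually_family_map_eq_self (hs : s ∈ Set.Ioo (-T.r) T.r) {p : V3}
    (hp : ∀ᶠ q in 𝓝 p, Q q = 0) : ∀ᶠ q in 𝓝 p, T.family.map s q = q := by
  filter_upwards [hp.eventually_nhds] with q hq
  have hUW : (fun p => W p + s * T.R p) =ᶠ[𝓝 q] W := by
    filter_upwards [hq] with y hy
    rw [T.R_eq_zero y hy, mul_zero, add_zero]
  exact T.family_map_eq_self hs fun _ => ⟨genSource_congr hUW, genTarget_congr hUW⟩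

theorem exists_stdForm_family (hs : s ∈ Set.Ioo (-T.r) T.r) {q : V3} (hq : q ∈ T.chart.source) :
    ∃ c > 0, ∀ v, stdForm (genTarget W (T.family.map s q))
        (fderiv ℝ (genTarget W) (T.family.map s q) (fderiv ℝ (T.family.map s) q v)) =
      c * stdForm (genTarget W q) (fderiv ℝ (genTarget W) q v) :=
  stdForm_comp_of_factor T.isAxisGenerating_source (T.isAxisGenerating s hs)
    ((T.Θ.contDiff_map hs).differentiable (by simp))
    ((T.Θ.symm.contDiff_map hs).differentiable (by simp))
    ((T.Ω.contDiff_map hs).differentiable (by simp)) (T.Θ.map_inv s hs)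
    (fun q hq => ⟨T.Θ.map_mem hs T.supp_subset hq, T.genSource_Θ s hs q hq⟩)
    (fun q hq => ⟨T.Ω.map_mem hs T.supp_subset hq, T.genTarget_Ω s hs q hq⟩) hq
    (T.Θ.symm.map_mem hs T.supp_subset hq)

theorem exists_homeomorph_genTarget_eq (hs : s ∈ Set.Ioo (-T.r) T.r) :
    ∃ θ : V3 ≃ₜ V3, (∀ q ∈ J, θ q = q) ∧
      ∀ᶠ q in 𝓝ˢ J, θ q ∈ T.chart.source ∧ T.family.map s (θ q) ∈ T.chart.source ∧
        genSource (fun p => W p + s * Q p) q = genSource W (θ q) ∧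
        genTarget (fun p => W p + s * Q p) q = genTarget W (T.family.map s (θ q)) := by
  refine ⟨T.Θ.toHomeomorph hs, fun q hq => ?_, ?_⟩
  · rw [← axis_eq_of_snd_eq_zero (T.axis_of_mem q hq)]
    exact T.Θ_map_eq_self hs fun hx => ((T.isAxisGenerating s hs).genSource_axis hx).trans
      (T.isAxisGenerating_source.genSource_axis hx).symm
  · obtain ⟨B, hB, hJB, hBR⟩ := mem_nhdsSet_iff_exists.1 T.R_eq
    filter_upwards [hB.mem_nhdsSet.2 hJB, T.chart.open_source.mem_nhdsSet.2 T.subset_source]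
      with q hqB hq
    have hQR : (fun p => W p + s * Q p) =ᶠ[𝓝 q] fun p => W p + s * T.R p := by
      filter_upwards [hB.mem_nhds hqB] with y hy
      rw [show T.R y = Q y from hBR hy]
    have hfamily : T.family.map s (T.Θ.map s q) = T.Ω.map s q :=
      congrArg (T.Ω.map s) (T.Θ.inv_map s hs q)
    change T.Θ.map s q ∈ _ ∧ T.family.map s (T.Θ.map s q) ∈ _ ∧
      _ = genSource W (T.Θ.map s q) ∧ _ = genTarget W (T.family.map s (T.Θ.map s q))
    rw [hfamily, genSource_congr hQR, genTarget_congr hQR]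
    exact ⟨T.Θ.map_mem hs T.supp_subset hq, T.Ω.map_mem hs T.supp_subset hq,
      (T.genSource_Θ s hs q hq).symm, (T.genTarget_Ω s hs q hq).symm⟩

end GeneratingStep

theorem IsAxisPerturbation.exists_cutoff {Q : V3 → ℝ} {N N' J : Set V3}
    (hQ : IsAxisPerturbation Q N) (hJ : IsCompact J) (hN' : IsOpen N') (hsub : N' ⊆ N)
    (hJN' : J ⊆ N') :
    ∃ (R : V3 → ℝ) (C : Set V3), IsAxisPerturbation R N' ∧ (∀ᶠ q in 𝓝ˢ J, R q = Q q) ∧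
      (∀ q, Q q = 0 → R q = 0) ∧ IsCompact C ∧ C ⊆ N' ∧ ∀ q ∉ C, R =ᶠ[𝓝 q] 0 := by
  obtain ⟨C, χ, hC, hCN', hχ, hχ₁, hχ₀⟩ := exists_bump hJ hN' hJN'
  refine ⟨fun q => χ q * Q q, C, hQ.mul hN' hsub hχ, hχ₁.mono fun q hq => by
      simp only [hq, one_mul],
    fun q hq => by simp only [hq, mul_zero], hC, hCN', fun q hq => ?_⟩
  filter_upwards [hC.isClosed.isOpen_compl.mem_nhds hq] with p hp
  rw [hχ₀ p hp, zero_mul, Pi.zero_apply]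

theorem IsAxisGenerating.nonempty_generatingStep {W Q : V3 → ℝ} {N J : Set V3}
    (h : IsAxisGenerating W N) (hJ : IsCompact J) (hJN : J ⊆ N) (hJ₀ : ∀ q ∈ J, q.2 = 0)
    (hQ : IsAxisPerturbation Q N) : Nonempty (GeneratingStep W Q J N) := by
  obtain ⟨N', hN'N, hJN', ⟨eS, hSs, heS, hSsymm⟩, ⟨eT, rfl, heT, hTsymm⟩, haxis⟩ :=
    h.exists_openPartialHomeomorph hJ hJN hJ₀
  have hN' := eT.open_source
  have hW := h.mono hN' hN'N
  obtain ⟨R, C, hR, hRQ, hR₀, hC, hCN', hRC⟩ := hQ.exists_cutoff hJ hN' hN'N hJN'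
  obtain ⟨r₀, hr₀, hpos⟩ := exists_pos_forall_partialZ_add_mul_pos hN' hW.smooth hW.pos
    hR.smooth hC hCN' hRC
  have hU : ∀ s ∈ Set.Ioo (-r₀) r₀, IsAxisGenerating (fun q => W q + s * R q) eT.source :=
    fun s hs => hW.add_mul hR (hpos s hs)
  have hoff : ∀ s t : ℝ, ∀ q ∉ C, (fun p => W p + s * R p) =ᶠ[𝓝 q] fun p => W p + t * R p :=
    fun s t q hq => by
      filter_upwards [hRC q hq] with p hp
      simp [hp]
  have hzero : (fun q => W q + 0 * R q) = W := by simp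
  obtain ⟨r₁, hr₁, hle₁, Θ, -, hΘ⟩ := exists_diffeoFamily_comp_eq hN' hC hCN' hr₀
    (ρ := fun s => genSource fun q => W q + s * R q)
    (contDiffOn_genSource_add_mul hN' hW.smooth hR.smooth fun s hs q hq => ((hU s hs).pos q hq).ne')
    (fun s _ q _ hq => genSource_congr (hoff s 0 q hq)) hSs (fun q _ => by rw [hzero, heS]) hSsymm
  obtain ⟨r₂, hr₂, -, Ω, -, hΩ⟩ := exists_diffeoFamily_comp_eq hN' hC hCN' hr₀
    (ρ := fun s => genTarget fun q => W q + s * R q)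
    (contDiffOn_genTarget_add_mul hN' hW.smooth hR.smooth)
    (fun s _ q _ hq => genTarget_congr (hoff s 0 q hq)) rfl (fun q _ => by rw [hzero, heT]) hTsymm
  simp only [hzero] at hΘ hΩ
  have hI₁ := Ioo_neg_subset (min_le_left r₁ r₂)
  have hI₂ := Ioo_neg_subset (min_le_right r₁ r₂)
  exact ⟨{
    chart := eT
    chart_source_subset := hN'N
    chart_apply := heT
    chart_axis := haxis
    contDiffOn_chart_symm := hTsymm
    injOn_genSource := hSs ▸ eS.injOn.congr fun q _ => heS q
    axis_of_mem := hJ₀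
    subset_source := hJN'
    R := R
    R_eq := hRQ
    R_eq_zero := hR₀
    supp := C
    isCompact_supp := hC
    supp_subset := hCN'
    r := min r₁ r₂
    r_pos := lt_min hr₁ hr₂
    isAxisGenerating := fun s hs => hU s (Ioo_neg_subset hle₁ (hI₁ hs))
    Θ := Θ.mono hI₁
    Ω := Ω.mono hI₂
    genSource_Θ := fun s hs q hq => (hΘ s (hI₁ hs) q hq).2
    genTarget_Ω := fun s hs q hq => (hΩ s (hI₂ hs) q hq).2 }⟩

section ExistenceOfGeneratingFunction

theorem fderiv_components {G : V3 → V3} {q : V3} (hG : DifferentiableAt ℝ G q) (v : V3) :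
    fderiv ℝ G q v = (fderiv ℝ (fun q => (G q).1) q v, fderiv ℝ (fun q => (G q).2.1) q v,
      fderiv ℝ (fun q => (G q).2.2) q v) := by
  have hprod : HasFDerivAt G _ q :=
    hG.fst.hasFDerivAt.prodMk (hG.snd.fst.hasFDerivAt.prodMk hG.snd.snd.hasFDerivAt)
  rw [hprod.fderiv]
  rfl

/-- A local coorientation preserving contact transformation of `ℝ³` that fixes the points of the
`x`-axis. -/
structure IsAxisContact (G : V3 → V3) (D : Set V3) : Prop where
  isOpen : IsOpen D
  smooth : ContDiffOn ℝ ∞ G D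
  axis : ∀ x, (x, 0, 0) ∈ D → G (x, 0, 0) = (x, 0, 0)
  contact : ∀ q ∈ D, ∃ c > 0, ∀ v, stdForm (G q) (fderiv ℝ G q v) = c * stdForm q v

/-- The conformal factor of a contact transformation: `G` pulls back `dz - y dx` to
`contactFactor G` times itself. -/
def contactFactor (G : V3 → V3) (q : V3) : ℝ := stdForm (G q) (fderiv ℝ G q (0, 0, 1))

/-- The mixed coordinates `(x, Y, z)` of the map `G`: first and last coordinate of the source,
second one of the target. -/
def mixedCoord (G : V3 → V3) (q : V3) : V3 := (q.1, (G q).2.1, q.2.2)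

/-- The generating function `Z - X Y` of the contact transformation `G`, as a function of the
source point. -/
def genPotential (G : V3 → V3) (q : V3) : ℝ := (G q).2.2 - (G q).1 * (G q).2.1

/-- The generating function `z - x Y` of the identity. -/
def genIdentity (q : V3) : ℝ := q.2.2 - q.1 * q.2.1

namespace IsAxisContact

variable {G : V3 → V3} {D : Set V3}

theorem hasFDerivAt (h : IsAxisContact G D) {q : V3} (hq : q ∈ D) :
    HasFDerivAt G (fderiv ℝ G q) q :=
  hasFDerivAt_fderiv_of_contDiffOn h.isOpen h.smooth hq

theorem contactFactor_pos (h : IsAxisContact G D) {q : V3} (hq : q ∈ D) :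
    0 < contactFactor G q := by
  obtain ⟨c, hc, hcv⟩ := h.contact q hq
  rw [contactFactor, hcv]
  simpa [stdForm] using hc

theorem stdForm_fderiv (h : IsAxisContact G D) {q : V3} (hq : q ∈ D) (v : V3) :
    stdForm (G q) (fderiv ℝ G q v) = contactFactor G q * stdForm q v := by
  obtain ⟨c, -, hcv⟩ := h.contact q hq
  rw [contactFactor, hcv, hcv]
  simp [stdForm]

theorem fderiv_snd_snd (h : IsAxisContact G D) {q : V3} (hq : q ∈ D) (v : V3) :
    fderiv ℝ (fun q => (G q).2.2) q v =
      (G q).2.1 * fderiv ℝ (fun q => (G q).1) q v + contactFactor G q * stdForm q v := by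
  have hform := h.stdForm_fderiv hq v
  rw [fderiv_components (h.hasFDerivAt hq).differentiableAt, stdForm] at hform
  linarith

theorem contDiffOn_contactFactor (h : IsAxisContact G D) :
    ContDiffOn ℝ ∞ (contactFactor G) D := by
  have hd : ContDiffOn ℝ ∞ (fun q => fderiv ℝ G q (0, 0, 1)) D :=
    ((contDiffOn_infty_iff_fderiv_of_isOpen h.isOpen).1 h.smooth).2.clm_apply contDiffOn_const
  exact hd.snd.snd.sub (h.smooth.snd.fst.mul hd.fst)

theorem fderiv_axis (h : IsAxisContact G D) {x : ℝ} (hx : (x, 0, 0) ∈ D) :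
    fderiv ℝ G (x, 0, 0) (1, 0, 0) = (1, 0, 0) :=
  fderiv_axis_of_hasDerivAt h.isOpen h.smooth (hasDerivAt_axis x) h.axis hx

theorem fderiv_partialX_axis (h : IsAxisContact G D) {x : ℝ} (hx : (x, 0, 0) ∈ D) :
    fderiv ℝ (partialX fun q => (G q).2.2) (x, 0, 0) (0, 1, 0) = 0 := by
  have hvanish : ∀ t, (t, 0, 0) ∈ D → partialY (fun q => (G q).2.2) (t, 0, 0) = 0 :=
    fun t ht => by
      rw [partialY, h.fderiv_snd_snd ht, h.axis t ht]
      simp [stdForm]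
  exact (fderiv_fderiv_apply_comm h.isOpen h.smooth.snd.snd hx _ _).trans
    (fderiv_axis_of_hasDerivAt h.isOpen (contDiffOn_partialY h.isOpen h.smooth.snd.snd)
      (hasDerivAt_const x 0) hvanish hx)

theorem partialY_axis (h : IsAxisContact G D) {x : ℝ} (hx : (x, 0, 0) ∈ D) :
    partialY (fun q => (G q).2.1) (x, 0, 0) = contactFactor G (x, 0, 0) := by
  have hY := hasFDerivAt_fderiv_of_contDiffOn h.isOpen h.smooth.snd.fst hx
  have hX := hasFDerivAt_fderiv_of_contDiffOn h.isOpen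
    (contDiffOn_partialX h.isOpen h.smooth.fst) hx
  have hfac := hasFDerivAt_fderiv_of_contDiffOn h.isOpen h.contDiffOn_contactFactor hx
  have hy := (hasFDerivAt_snd (𝕜 := ℝ) (p := ((x, 0, 0) : V3))).fst
  have hrhs := (hY.mul hX).sub (hfac.mul hy)
  have heq : (partialX fun q => (G q).2.2) =ᶠ[𝓝 (x, 0, 0)]
      fun q => (G q).2.1 * partialX (fun q => (G q).1) q - contactFactor G q * q.2.1 := by
    filter_upwards [h.isOpen.mem_nhds hx] with q hq
    rw [partialX, h.fderiv_snd_snd hq, stdForm, partialX]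
    ring
  have hdX : partialX (fun q => (G q).1) (x, 0, 0) = 1 := by
    have hax := h.fderiv_axis hx
    rw [fderiv_components (h.hasFDerivAt hx).differentiableAt] at hax
    exact congrArg Prod.fst hax
  have hzero := h.fderiv_partialX_axis hx
  rw [heq.fderiv_eq.trans hrhs.fderiv] at hzero
  simp only [h.axis x hx, zero_smul, hdX, one_smul, zero_add, add_zero, sub_apply, smul_apply,
    ContinuousLinearMap.comp_apply, ContinuousLinearMap.coe_snd', ContinuousLinearMap.coe_fst',
    smul_eq_mul, mul_one] at hzero
  rw [partialY]
  linarith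

theorem contDiffOn_mixedCoord (h : IsAxisContact G D) : ContDiffOn ℝ ∞ (mixedCoord G) D :=
  contDiffOn_fst.prodMk (h.smooth.snd.fst.prodMk contDiff_snd.snd.contDiffOn)

theorem fderiv_mixedCoord (h : IsAxisContact G D) {q : V3} (hq : q ∈ D) (v : V3) :
    fderiv ℝ (mixedCoord G) q v = (v.1, fderiv ℝ (fun q => (G q).2.1) q v, v.2.2) := by
  have hprod : HasFDerivAt (mixedCoord G) _ q :=
    hasFDerivAt_fst.prodMk ((h.hasFDerivAt hq).differentiableAt.snd.fst.hasFDerivAt.prodMk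
      (hasFDerivAt_snd.snd))
  rw [hprod.fderiv]
  rfl

theorem mixedCoord_axis (h : IsAxisContact G D) {x : ℝ} (hx : (x, 0, 0) ∈ D) :
    mixedCoord G (x, 0, 0) = (x, 0, 0) := by
  simp [mixedCoord, h.axis x hx]

theorem fderiv_mixedCoord_axis_injective (h : IsAxisContact G D) {x : ℝ} (hx : (x, 0, 0) ∈ D)
    (v : V3) (hv : fderiv ℝ (mixedCoord G) (x, 0, 0) v = 0) : v = 0 := by
  rw [h.fderiv_mixedCoord hx, Prod.mk_eq_zero, Prod.mk_eq_zero, clm_apply_eq] at hv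
  obtain ⟨hv₁, hv₂, hv₃⟩ := hv
  have hY := h.partialY_axis hx
  rw [partialY] at hY
  rw [hY, hv₁, hv₃] at hv₂
  have hv₂' : v.2.1 = 0 := by simpa [(h.contactFactor_pos hx).ne'] using hv₂
  exact Prod.ext hv₁ (Prod.ext hv₂' hv₃)

theorem contDiffOn_genPotential (h : IsAxisContact G D) : ContDiffOn ℝ ∞ (genPotential G) D :=
  h.smooth.snd.snd.sub (h.smooth.fst.mul h.smooth.snd.fst)

theorem fderiv_genPotential (h : IsAxisContact G D) {q : V3} (hq : q ∈ D) (v : V3) :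
    fderiv ℝ (genPotential G) q v =
      contactFactor G q * stdForm q v - (G q).1 * fderiv ℝ (fun q => (G q).2.1) q v := by
  have hG := (h.hasFDerivAt hq).differentiableAt
  have hd : HasFDerivAt (genPotential G) _ q :=
    hG.snd.snd.hasFDerivAt.sub (hG.fst.hasFDerivAt.mul hG.snd.fst.hasFDerivAt)
  rw [hd.fderiv]
  simp only [sub_apply, add_apply, smul_apply, smul_eq_mul, h.fderiv_snd_snd hq]
  ring

variable {e : OpenPartialHomeomorph V3 V3}

theorem fderiv_genPotential_comp_symm (h : IsAxisContact G D) (heD : e.source ⊆ D)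
    (he : ∀ q, e q = mixedCoord G q) (hsymm : ContDiffOn ℝ ∞ e.symm e.target) {q : V3}
    (hq : q ∈ e.target) (u : V3) :
    fderiv ℝ (fun p => genPotential G (e.symm p)) q u =
      contactFactor G (e.symm q) * stdForm (e.symm q) u - (G (e.symm q)).1 * u.2.1 := by
  have hpD := heD (e.map_target hq)
  have hd := hasFDerivAt_fderiv_of_contDiffOn e.open_target hsymm hq
  have hinv : fderiv ℝ (mixedCoord G) (e.symm q) (fderiv ℝ e.symm q u) = u := by
    have hcomp := (hasFDerivAt_fderiv_of_contDiffOn h.isOpen h.contDiffOn_mixedCoord hpD).comp q hd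
    have hid : mixedCoord G ∘ e.symm =ᶠ[𝓝 q] id := by
      filter_upwards [e.open_target.mem_nhds hq] with y hy
      rw [Function.comp_apply, ← he, e.right_inv hy, id]
    exact (DFunLike.congr_fun (hcomp.unique ((hasFDerivAt_id q).congr_of_eventuallyEq hid)) u :)
  have hW : HasFDerivAt (fun p => genPotential G (e.symm p)) _ q :=
    (hasFDerivAt_fderiv_of_contDiffOn h.isOpen h.contDiffOn_genPotential hpD).comp q hd
  rw [h.fderiv_mixedCoord hpD, Prod.ext_iff, Prod.ext_iff] at hinv
  obtain ⟨hx, hY, hz⟩ := hinv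
  rw [hW.fderiv, ContinuousLinearMap.comp_apply, h.fderiv_genPotential hpD, ← hY, stdForm,
    stdForm, hx, hz]

theorem symm_eq_self (he : ∀ q, e q = mixedCoord G q) {q : V3} (hq : q ∈ e.source)
    (hGq : mixedCoord G q = q) : e.symm q = q := by
  have hleft := e.left_inv hq
  rwa [he, hGq] at hleft

theorem isAxisGenerating_genPotential (h : IsAxisContact G D) (heD : e.source ⊆ D)
    (he : ∀ q, e q = mixedCoord G q) (hsymm : ContDiffOn ℝ ∞ e.symm e.target) :
    IsAxisGenerating (fun q => genPotential G (e.symm q)) (e.target ∩ e.source) where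
  isOpen := e.open_target.inter e.open_source
  smooth := (h.contDiffOn_genPotential.comp hsymm fun _ hq => heD (e.map_target hq)).mono
    Set.inter_subset_left
  pos q hq := by
    rw [partialZ, h.fderiv_genPotential_comp_symm heD he hsymm hq.1]
    simpa [stdForm] using h.contactFactor_pos (heD (e.map_target hq.1))
  zero x hx := by
    rw [symm_eq_self he hx.2 (h.mixedCoord_axis (heD hx.2)), genPotential, h.axis x (heD hx.2)]
    simp
  partialY_eq x hx := by
    rw [partialY, h.fderiv_genPotential_comp_symm heD he hsymm hx.1,
      symm_eq_self he hx.2 (h.mixedCoord_axis (heD hx.2)), h.axis x (heD hx.2)]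
    simp [stdForm]

theorem genSource_genPotential (h : IsAxisContact G D) (heD : e.source ⊆ D)
    (he : ∀ q, e q = mixedCoord G q) (hsymm : ContDiffOn ℝ ∞ e.symm e.target) {q : V3}
    (hq : q ∈ e.target) : genSource (fun p => genPotential G (e.symm p)) q = e.symm q := by
  have hright : mixedCoord G (e.symm q) = q := by rw [← he, e.right_inv hq]
  have hfac := (h.contactFactor_pos (heD (e.map_target hq))).ne'
  rw [genSource, partialX, partialZ, h.fderiv_genPotential_comp_symm heD he hsymm hq,
    h.fderiv_genPotential_comp_symm heD he hsymm hq]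
  refine Prod.ext (congrArg Prod.fst hright).symm (Prod.ext ?_
    (congrArg (fun v : V3 => v.2.2) hright).symm)
  simp [stdForm, neg_div, hfac]

theorem genTarget_genPotential (h : IsAxisContact G D) (heD : e.source ⊆ D)
    (he : ∀ q, e q = mixedCoord G q) (hsymm : ContDiffOn ℝ ∞ e.symm e.target) {q : V3}
    (hq : q ∈ e.target) : genTarget (fun p => genPotential G (e.symm p)) q = G (e.symm q) := by
  have hright : mixedCoord G (e.symm q) = q := by rw [← he, e.right_inv hq]
  have hY : q.2.1 = (G (e.symm q)).2.1 := (congrArg (fun v : V3 => v.2.1) hright).symm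
  rw [genTarget, partialY, h.fderiv_genPotential_comp_symm heD he hsymm hq, hY]
  simp only [stdForm, genPotential]
  ext <;> simp
  ring

theorem exists_generating (h : IsAxisContact G D) {J : Set V3} (hJ : IsCompact J) (hJD : J ⊆ D)
    (hJ₀ : ∀ q ∈ J, q.2 = 0) :
    ∃ (W : V3 → ℝ) (N : Set V3), IsAxisGenerating W N ∧ J ⊆ N ∧
      (∀ q ∈ N, genSource W q ∈ D ∧ G (genSource W q) = genTarget W q) ∧
      ∀ p ∈ N, (∀ᶠ q in 𝓝 p, G q = q) → ∀ᶠ q in 𝓝 p, W q = genIdentity q := by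
  obtain ⟨e, hJe, heD, he, hsymm⟩ := exists_openPartialHomeomorph_near_axis h.isOpen
    h.contDiffOn_mixedCoord (fun x => h.mixedCoord_axis)
    (fun x hx => h.fderiv_mixedCoord_axis_injective hx) hJ hJD hJ₀
  refine ⟨fun q => genPotential G (e.symm q), e.target ∩ e.source,
    h.isAxisGenerating_genPotential heD he hsymm, fun q hq => ⟨?_, hJe hq⟩, fun q hq => ?_,
    fun p hp hG => ?_⟩
  · have haxis := axis_eq_of_snd_eq_zero (hJ₀ q hq)
    have hfix := h.mixedCoord_axis (x := q.1) (by rw [haxis]; exact hJD hq)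
    rw [haxis, ← he] at hfix
    exact hfix ▸ e.map_source (hJe hq)
  · rw [h.genSource_genPotential heD he hsymm hq.1, h.genTarget_genPotential heD he hsymm hq.1]
    exact ⟨heD (e.map_target hq.1), rfl⟩
  · filter_upwards [hG, e.open_source.mem_nhds hp.2] with q hq hqe
    rw [symm_eq_self he hqe (by rw [mixedCoord, hq]), genPotential, hq, genIdentity]

end IsAxisContact

end ExistenceOfGeneratingFunction

section AffinePath

theorem contDiff_genIdentity : ContDiff ℝ ∞ genIdentity := by
  unfold genIdentity
  fun_prop

theorem fderiv_genIdentity_apply (q v : V3) :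
    fderiv ℝ genIdentity q v = v.2.2 - (q.1 * v.2.1 + q.2.1 * v.1) := by
  have hsnd := hasFDerivAt_snd (𝕜 := ℝ) (p := q)
  have hd : HasFDerivAt genIdentity _ q :=
    hsnd.snd.sub (hasFDerivAt_fst.mul hsnd.fst)
  rw [hd.fderiv]
  simp

theorem genSource_genIdentity (q : V3) : genSource genIdentity q = q := by
  simp [genSource, partialX, partialZ, fderiv_genIdentity_apply]

theorem genTarget_genIdentity (q : V3) : genTarget genIdentity q = q := by
  ext <;> simp [genTarget, partialY, fderiv_genIdentity_apply, genIdentity]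
  ring

variable {W : V3 → ℝ} {N : Set V3}

theorem IsAxisGenerating.fderiv_genIdentity_sub (h : IsAxisGenerating W N) {q : V3} (hq : q ∈ N)
    (v : V3) : fderiv ℝ (fun p => genIdentity p - W p) q v =
      fderiv ℝ genIdentity q v - fderiv ℝ W q v := by
  have hd : HasFDerivAt (fun p => genIdentity p - W p) _ q :=
    (contDiff_genIdentity.differentiable (by simp) q).hasFDerivAt.sub
      (hasFDerivAt_fderiv_of_contDiffOn h.isOpen h.smooth hq)
  rw [hd.fderiv]
  rfl

theorem IsAxisGenerating.isAxisPerturbation (h : IsAxisGenerating W N) :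
    IsAxisPerturbation (fun q => genIdentity q - W q) N where
  smooth := contDiff_genIdentity.contDiffOn.sub h.smooth
  zero x hx := by simp [genIdentity, h.zero x hx]
  partialY_zero x hx := by
    have hY := h.partialY_eq x hx
    rw [partialY] at hY
    rw [partialY, h.fderiv_genIdentity_sub hx, fderiv_genIdentity_apply, hY]
    simp

theorem IsAxisGenerating.affinePath (h : IsAxisGenerating W N) {t : ℝ}
    (ht : t ∈ Set.Icc (0 : ℝ) 1) :
    IsAxisGenerating (fun q => W q + t * (genIdentity q - W q)) N := by
  refine h.add_mul h.isAxisPerturbation fun q hq => ?_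
  have hZ : partialZ (fun p => genIdentity p - W p) q = 1 - partialZ W q := by
    rw [partialZ, h.fderiv_genIdentity_sub hq, fderiv_genIdentity_apply, partialZ]
    simp
  have hpos := h.pos q hq
  rw [hZ]
  rcases eq_or_lt_of_le ht.1 with rfl | ht₀
  · simpa using hpos
  · nlinarith [mul_nonneg (sub_nonneg.2 ht.2) hpos.le]

end AffinePath

section Diffeomorphisms

variable {M : Type*} [TopologicalSpace M] [ChartedSpace E3 M]

theorem mdifferentiableAt_diffeomorph (g : M ≃ₘ^∞⟮𝓡 3, 𝓡 3⟯ M) (x : M) :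
    MDifferentiableAt (𝓡 3) (𝓡 3) g x := g.contMDiff.mdifferentiable (by simp) x

theorem mfderiv_diffeomorph_trans (g h : M ≃ₘ^∞⟮𝓡 3, 𝓡 3⟯ M) (x : M) :
    mfderiv (𝓡 3) (𝓡 3) (g.trans h) x =
      (mfderiv (𝓡 3) (𝓡 3) h (g x)).comp (mfderiv (𝓡 3) (𝓡 3) g x) :=
  mfderiv_comp (g := h) (f := g) x (mdifferentiableAt_diffeomorph h (g x))
    (mdifferentiableAt_diffeomorph g x)

theorem bijective_mfderiv_diffeomorph (g : M ≃ₘ^∞⟮𝓡 3, 𝓡 3⟯ M) (x : M) :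
    Function.Bijective (mfderiv (𝓡 3) (𝓡 3) g x) :=
  (g.mfderivToContinuousLinearEquiv (by simp) x).bijective

end Diffeomorphisms

section Contactomorphisms

variable {M : Type*} [TopologicalSpace M] [ChartedSpace E3 M] [IsManifold (𝓡 3) ∞ M]

namespace CoorientedContactStructure

variable (ξ : CoorientedContactStructure M)

/-- `L` maps the contact plane at `x` onto the one at `y` and preserves the coorientation. It is
typed as a map of `E3` so that the points `x` and `y` can be rewritten. -/
def PreservesAt (x y : M) (L : E3 →L[ℝ] E3) : Prop :=
  ∀ v : E3, ((L v : TangentSpace (𝓡 3) y) ∈ ξ.plane y ↔ (v : TangentSpace (𝓡 3) x) ∈ ξ.plane x) ∧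
    ((L v : TangentSpace (𝓡 3) y) ∈ ξ.pos y ↔ (v : TangentSpace (𝓡 3) x) ∈ ξ.pos x)

variable {ξ}

theorem PreservesAt.comp {x y z : M} {L L' : E3 →L[ℝ] E3} (hL' : ξ.PreservesAt y z L')
    (hL : ξ.PreservesAt x y L) : ξ.PreservesAt x z (L'.comp L) := fun v =>
  ⟨(hL' (L v)).1.trans (hL v).1, (hL' (L v)).2.trans (hL v).2⟩

theorem PreservesAt.of_comp {x y z : M} {L L' : E3 →L[ℝ] E3} (hL : ξ.PreservesAt x y L)
    (hsurj : Function.Surjective L) (hcomp : ξ.PreservesAt x z (L'.comp L)) :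
    ξ.PreservesAt y z L' := fun w => by
  obtain ⟨v, rfl⟩ := hsurj w
  exact ⟨(hcomp v).1.trans (hL v).1.symm, (hcomp v).2.trans (hL v).2.symm⟩

theorem preservesAt_id (x : M) : ξ.PreservesAt x x (ContinuousLinearMap.id ℝ E3) :=
  fun _ => ⟨Iff.rfl, Iff.rfl⟩

theorem preservesAt_mfderiv_of_eventuallyEq_id {f : M → M} {x : M} (hf : f =ᶠ[𝓝 x] id) :
    ξ.PreservesAt x (f x) (mfderiv (𝓡 3) (𝓡 3) f x) := by
  have hd : (mfderiv (𝓡 3) (𝓡 3) f x : E3 →L[ℝ] E3) = .id ℝ E3 := hf.mfderiv_eq.trans mfderiv_id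
  rw [hd, hf.eq_of_nhds]
  exact preservesAt_id x

theorem isContactomorphism_iff (g : M ≃ₘ^∞⟮𝓡 3, 𝓡 3⟯ M) :
    ξ.IsContactomorphism g ↔ ∀ x, ξ.PreservesAt x (g x) (mfderiv (𝓡 3) (𝓡 3) g x) := by
  refine forall_congr' fun x => ?_
  have hbij := bijective_mfderiv_diffeomorph g x
  rw [← SetLike.coe_set_eq, Submodule.map_coe]
  refine (and_congr (Set.eq_preimage_iff_image_eq hbij).symm
    (Set.eq_preimage_iff_image_eq hbij).symm).trans ?_
  rw [Set.ext_iff, Set.ext_iff, ← forall_and]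
  exact forall_congr' fun v => and_congr Iff.comm Iff.comm

theorem IsContactomorphism.trans {g h : M ≃ₘ^∞⟮𝓡 3, 𝓡 3⟯ M} (hg : ξ.IsContactomorphism g)
    (hh : ξ.IsContactomorphism h) : ξ.IsContactomorphism (g.trans h) := by
  rw [isContactomorphism_iff] at *
  intro x
  rw [mfderiv_diffeomorph_trans]
  exact (hh (g x)).comp (hg x)

theorem isContactomorphism_refl : ξ.IsContactomorphism (Diffeomorph.refl (𝓡 3) M ∞) :=
  (isContactomorphism_iff _).2 fun _ => preservesAt_mfderiv_of_eventuallyEq_id .rfl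

theorem IsContactomorphism.symm {g : M ≃ₘ^∞⟮𝓡 3, 𝓡 3⟯ M} (hg : ξ.IsContactomorphism g) :
    ξ.IsContactomorphism g.symm := by
  rw [isContactomorphism_iff] at *
  intro y
  obtain ⟨x, rfl⟩ := g.surjective y
  refine (hg x).of_comp (bijective_mfderiv_diffeomorph g x).surjective ?_
  have hid := (isContactomorphism_iff _).1 (isContactomorphism_refl (ξ := ξ)) x
  rw [← g.self_trans_symm, mfderiv_diffeomorph_trans] at hid
  exact hid

namespace ContactIsotopic

variable {g g' h h' k φ : M ≃ₘ^∞⟮𝓡 3, 𝓡 3⟯ M}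

theorem isContactomorphism_left (hgh : ξ.ContactIsotopic g h) : ξ.IsContactomorphism g := by
  obtain ⟨φ, -, hφ, rfl, -⟩ := hgh
  exact hφ 0 (by simp)

theorem isContactomorphism_right (hgh : ξ.ContactIsotopic g h) : ξ.IsContactomorphism h := by
  obtain ⟨φ, -, hφ, -, rfl⟩ := hgh
  exact hφ 1 (by simp)

theorem refl (hg : ξ.IsContactomorphism g) : ξ.ContactIsotopic g g :=
  ⟨fun _ => g, (g.contMDiff.comp contMDiff_snd).contMDiffOn, fun _ _ => hg, rfl, rfl⟩

theorem symm (hgh : ξ.ContactIsotopic g h) : ξ.ContactIsotopic h g := by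
  obtain ⟨φ, hsmooth, hφ, rfl, rfl⟩ := hgh
  have hmem : ∀ t ∈ Set.Icc (0 : ℝ) 1, 1 - t ∈ Set.Icc (0 : ℝ) 1 := fun t ht =>
    ⟨sub_nonneg.2 ht.2, sub_le_self 1 ht.1⟩
  have hrev : ContMDiff (𝓘(ℝ, ℝ).prod (𝓡 3)) 𝓘(ℝ, ℝ) ∞ (fun p : ℝ × M => 1 - p.1) :=
    (contDiff_const.sub contDiff_id).contMDiff.comp contMDiff_fst
  exact ⟨fun t => φ (1 - t), hsmooth.comp (hrev.prodMk contMDiff_snd).contMDiffOn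
    fun p hp => ⟨hmem _ hp.1, trivial⟩, fun t ht => hφ _ (hmem t ht), by simp, by simp⟩

theorem diffeomorph_trans (hgh : ξ.ContactIsotopic g h) (hgh' : ξ.ContactIsotopic g' h') :
    ξ.ContactIsotopic (g.trans g') (h.trans h') := by
  obtain ⟨φ, hsmooth, hφ, rfl, rfl⟩ := hgh
  obtain ⟨φ', hsmooth', hφ', rfl, rfl⟩ := hgh'
  exact ⟨fun t => (φ t).trans (φ' t),
    hsmooth'.comp (contMDiffOn_fst.prodMk hsmooth) fun p hp => ⟨hp.1, trivial⟩,
    fun t ht => (hφ t ht).trans (hφ' t ht), rfl, rfl⟩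

theorem diffeomorph_symm (hφ : ξ.ContactIsotopic (Diffeomorph.refl (𝓡 3) M ∞) φ) :
    ξ.ContactIsotopic (Diffeomorph.refl (𝓡 3) M ∞) φ.symm := by
  have hcomp := hφ.symm.diffeomorph_trans (.refl hφ.isContactomorphism_right.symm)
  rwa [φ.self_trans_symm, Diffeomorph.refl_trans] at hcomp

theorem trans (hgh : ξ.ContactIsotopic g h) (hhk : ξ.ContactIsotopic h k) :
    ξ.ContactIsotopic g k := by
  have hcomp := (hgh.diffeomorph_trans (.refl hhk.isContactomorphism_left.symm)).diffeomorph_trans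
    hhk
  rw [h.self_trans_symm, Diffeomorph.refl_trans] at hcomp
  convert hcomp
  ext x
  simp

theorem refl_of_family {r s : ℝ} {Φ : ℝ → (M ≃ₘ^∞⟮𝓡 3, 𝓡 3⟯ M)}
    (hsmooth : ContMDiffOn (𝓘(ℝ, ℝ).prod (𝓡 3)) (𝓡 3) ∞ (fun p : ℝ × M => Φ p.1 p.2)
      (Set.Ioo (-r) r ×ˢ Set.univ))
    (hΦ : ∀ s ∈ Set.Ioo (-r) r, ξ.IsContactomorphism (Φ s))
    (hΦ₀ : Φ 0 = Diffeomorph.refl (𝓡 3) M ∞) (hs : s ∈ Set.Ioo (-r) r) :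
    ξ.ContactIsotopic (Diffeomorph.refl (𝓡 3) M ∞) (Φ s) := by
  have hmem : ∀ t ∈ Set.Icc (0 : ℝ) 1, t * s ∈ Set.Ioo (-r) r := fun t ht => by
    rw [Set.mem_Ioo, ← abs_lt, abs_mul, abs_of_nonneg ht.1]
    exact (mul_le_of_le_one_left (abs_nonneg s) ht.2).trans_lt (abs_lt.2 hs)
  have hmul : ContMDiff (𝓘(ℝ, ℝ).prod (𝓡 3)) 𝓘(ℝ, ℝ) ∞ (fun p : ℝ × M => p.1 * s) :=
    (contDiff_id.mul contDiff_const).contMDiff.comp contMDiff_fst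
  exact ⟨fun t => Φ (t * s), hsmooth.comp (hmul.prodMk contMDiff_snd).contMDiffOn
    fun p hp => ⟨hmem _ hp.1, trivial⟩, fun t ht => hΦ _ (hmem t ht), by simpa using hΦ₀, by simp⟩

end ContactIsotopic

end CoorientedContactStructure

end Contactomorphisms

section Extension

variable {M : Type*} [TopologicalSpace M]

open Classical in
/-- Extend a self-map of `ℝ³`, read in a chart, by the identity. -/
def extendByChart (κ : OpenPartialHomeomorph M V3) (f : V3 → V3) (x : M) : M :=
  if x ∈ κ.source then κ.symm (f (κ x)) else x

variable {κ : OpenPartialHomeomorph M V3} {f : V3 → V3} {C : Set V3}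

theorem extendByChart_of_mem {x : M} (hx : x ∈ κ.source) :
    extendByChart κ f x = κ.symm (f (κ x)) := if_pos hx

theorem extendByChart_of_notMem {x : M} (hx : x ∉ κ.source) : extendByChart κ f x = x := if_neg hx

theorem extendByChart_eq_self {x : M} (hf : x ∈ κ.source → f (κ x) = κ x) :
    extendByChart κ f x = x := by
  by_cases hx : x ∈ κ.source
  · rw [extendByChart_of_mem hx, hf hx, κ.left_inv hx]
  · exact extendByChart_of_notMem hx

theorem eventually_notMem_image_symm [T2Space M] (hC : IsCompact C) (hCκ : C ⊆ κ.target) {x : M}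
    (hx : x ∉ κ.source) : ∀ᶠ y in 𝓝 x, y ∉ κ.symm '' C := by
  have himage : IsCompact (κ.symm '' C) :=
    hC.image_of_continuousOn (κ.continuousOn_symm.mono hCκ)
  refine himage.isClosed.isOpen_compl.mem_nhds ?_
  rintro ⟨q, hq, rfl⟩
  exact hx (κ.map_target (hCκ hq))

theorem extendByChart_of_notMem_image (hf : ∀ q ∉ C, f q = q) {y : M}
    (hy : y ∉ κ.symm '' C) : extendByChart κ f y = y :=
  extendByChart_eq_self fun hys => hf _ fun hC => hy ⟨κ y, hC, κ.left_inv hys⟩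

/-- A local coordinate system with values in `ℝ × ℝ × ℝ` that is smooth in both directions. -/
structure IsSmoothChart [ChartedSpace E3 M] (κ : OpenPartialHomeomorph M V3) : Prop where
  smooth : ContMDiffOn (𝓡 3) 𝓘(ℝ, V3) ∞ κ κ.source
  smooth_symm : ContMDiffOn 𝓘(ℝ, V3) (𝓡 3) ∞ κ.symm κ.target

namespace DiffeoFamily

variable {I : Set ℝ} {s : ℝ}

theorem extendByChart_inv_map (Θ : DiffeoFamily I C) (hCκ : C ⊆ κ.target) (hs : s ∈ I) (x : M) :
    extendByChart κ (Θ.inv s) (extendByChart κ (Θ.map s) x) = x := by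
  by_cases hx : x ∈ κ.source
  · have hmem := Θ.map_mem hs hCκ (κ.map_source hx)
    rw [extendByChart_of_mem hx, extendByChart_of_mem (κ.map_target hmem), κ.right_inv hmem,
      Θ.inv_map s hs, κ.left_inv hx]
  · rw [extendByChart_of_notMem hx, extendByChart_of_notMem hx]

variable [T2Space M] [ChartedSpace E3 M]

theorem contMDiffOn_extendByChart (Θ : DiffeoFamily I C) (hκ : IsSmoothChart κ)
    (hC : IsCompact C) (hCκ : C ⊆ κ.target) (hI : IsOpen I) :
    ContMDiffOn (𝓘(ℝ, ℝ).prod (𝓡 3)) (𝓡 3) ∞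
      (fun p : ℝ × M => extendByChart κ (Θ.map p.1) p.2) (I ×ˢ Set.univ) := by
  rintro ⟨s, x⟩ ⟨hs, -⟩
  refine ContMDiffAt.contMDiffWithinAt ?_
  by_cases hx : x ∈ κ.source
  · have hpair : ContMDiffAt (𝓘(ℝ, ℝ).prod (𝓡 3)) 𝓘(ℝ, ℝ × V3) ∞
        (fun p : ℝ × M => (p.1, κ p.2)) (s, x) :=
      contMDiffAt_fst.prodMk_space <| ContMDiffAt.comp (g := κ) (s, x)
        (hκ.smooth.contMDiffAt (κ.open_source.mem_nhds hx)) contMDiffAt_snd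
    have hmap : ContMDiffAt 𝓘(ℝ, ℝ × V3) 𝓘(ℝ, V3) ∞
        (fun q : ℝ × V3 => Θ.map q.1 q.2) (s, κ x) :=
      (Θ.contDiffOn_map.contDiffAt ((hI.prod isOpen_univ).mem_nhds ⟨hs, trivial⟩)).contMDiffAt
    have hsymm : ContMDiffAt 𝓘(ℝ, V3) (𝓡 3) ∞ κ.symm (Θ.map s (κ x)) :=
      hκ.smooth_symm.contMDiffAt
        (κ.open_target.mem_nhds (Θ.map_mem hs hCκ (κ.map_source hx)))
    have hchart : ContMDiffAt (𝓘(ℝ, ℝ).prod (𝓡 3)) (𝓡 3) ∞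
        (fun p : ℝ × M => κ.symm (Θ.map p.1 (κ p.2))) (s, x) :=
      ContMDiffAt.comp (g := κ.symm) (f := fun p : ℝ × M => Θ.map p.1 (κ p.2)) (s, x) hsymm
        (ContMDiffAt.comp (g := fun q : ℝ × V3 => Θ.map q.1 q.2)
          (f := fun p : ℝ × M => (p.1, κ p.2)) (s, x) hmap hpair)
    refine hchart.congr_of_eventuallyEq ?_
    filter_upwards [continuousAt_snd.eventually_mem (κ.open_source.mem_nhds hx)] with p hp
    exact extendByChart_of_mem hp
  · refine contMDiffAt_snd.congr_of_eventuallyEq ?_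
    filter_upwards [continuousAt_fst.eventually_mem (hI.mem_nhds hs),
      continuousAt_snd.eventually (eventually_notMem_image_symm hC hCκ hx)] with p hpI hpC
    exact extendByChart_of_notMem_image (Θ.map_eq_self _ hpI) hpC

theorem contMDiff_extendByChart (Θ : DiffeoFamily I C) (hκ : IsSmoothChart κ)
    (hC : IsCompact C) (hCκ : C ⊆ κ.target) (hI : IsOpen I) (hs : s ∈ I) :
    ContMDiff (𝓡 3) (𝓡 3) ∞ (extendByChart κ (Θ.map s)) :=
  contMDiffOn_univ.1 <| (Θ.contMDiffOn_extendByChart hκ hC hCκ hI).comp (f := fun x : M => (s, x))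
    (contMDiff_const.prodMk contMDiff_id).contMDiffOn fun _ _ => ⟨hs, trivial⟩

theorem exists_diffeomorph_extendByChart (Θ : DiffeoFamily I C) (hκ : IsSmoothChart κ)
    (hC : IsCompact C) (hCκ : C ⊆ κ.target) (hI : IsOpen I) :
    ∃ Φ : ℝ → (M ≃ₘ^∞⟮𝓡 3, 𝓡 3⟯ M), (∀ s ∈ I, ∀ x, Φ s x = extendByChart κ (Θ.map s) x) ∧
      ContMDiffOn (𝓘(ℝ, ℝ).prod (𝓡 3)) (𝓡 3) ∞ (fun p : ℝ × M => Φ p.1 p.2)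
        (I ×ˢ Set.univ) := by
  classical
  let Φ : ℝ → (M ≃ₘ^∞⟮𝓡 3, 𝓡 3⟯ M) := fun s =>
    if hs : s ∈ I then
      { toFun := extendByChart κ (Θ.map s)
        invFun := extendByChart κ (Θ.inv s)
        left_inv := Θ.extendByChart_inv_map hCκ hs
        right_inv := Θ.symm.extendByChart_inv_map hCκ hs
        contMDiff_toFun := Θ.contMDiff_extendByChart hκ hC hCκ hI hs
        contMDiff_invFun := Θ.symm.contMDiff_extendByChart hκ hC hCκ hI hs }
    else Diffeomorph.refl (𝓡 3) M ∞
  have hΦ : ∀ s ∈ I, ∀ x, Φ s x = extendByChart κ (Θ.map s) x := fun s hs x => by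
    simp only [Φ, dif_pos hs]
    rfl
  exact ⟨Φ, hΦ, (Θ.contMDiffOn_extendByChart hκ hC hCκ hI).congr fun p hp => hΦ p.1 hp.1 p.2⟩

end DiffeoFamily

namespace IsSmoothChart

variable [ChartedSpace E3 M]

theorem mdifferentiableAt (hκ : IsSmoothChart κ) {x : M} (hx : x ∈ κ.source) :
    MDifferentiableAt (𝓡 3) 𝓘(ℝ, V3) κ x :=
  (hκ.smooth.contMDiffAt (κ.open_source.mem_nhds hx)).mdifferentiableAt (by simp)

theorem mdifferentiableAt_symm (hκ : IsSmoothChart κ) {q : V3} (hq : q ∈ κ.target) :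
    MDifferentiableAt 𝓘(ℝ, V3) (𝓡 3) κ.symm q :=
  (hκ.smooth_symm.contMDiffAt (κ.open_target.mem_nhds hq)).mdifferentiableAt (by simp)

theorem mfderiv_mfderiv_apply (hκ : IsSmoothChart κ) {φ : M → M} {x : M} (hx : x ∈ κ.source)
    (hφx : φ x ∈ κ.source) (hφ : MDifferentiableAt (𝓡 3) (𝓡 3) φ x)
    (hf : DifferentiableAt ℝ f (κ x)) (hφf : ∀ᶠ y in 𝓝 x, κ (φ y) = f (κ y)) (v : E3) :
    (mfderiv (𝓡 3) 𝓘(ℝ, V3) κ (φ x) : E3 →L[ℝ] V3) ((mfderiv (𝓡 3) (𝓡 3) φ x : E3 →L[ℝ] E3) v) =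
      fderiv ℝ f (κ x) ((mfderiv (𝓡 3) 𝓘(ℝ, V3) κ x : E3 →L[ℝ] V3) v) := by
  have hκφ := mfderiv_comp (g := κ) (f := φ) x (hκ.mdifferentiableAt hφx) hφ
  have hfκ := mfderiv_comp (g := f) (f := κ) x hf.mdifferentiableAt (hκ.mdifferentiableAt hx)
  have heq : (κ : M → V3) ∘ φ =ᶠ[𝓝 x] f ∘ κ := hφf
  rw [mfderiv_eq_fderiv] at hfκ
  exact DFunLike.congr_fun (hκφ.symm.trans (heq.mfderiv_eq.trans hfκ)) v

theorem surjective_mfderiv (hκ : IsSmoothChart κ) {x : M} (hx : x ∈ κ.source) :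
    Function.Surjective (mfderiv (𝓡 3) 𝓘(ℝ, V3) κ x : E3 →L[ℝ] V3) := fun u => by
  obtain ⟨q, hq, rfl⟩ := κ.symm.surjOn hx
  have hcomp := mfderiv_comp (g := κ) (f := κ.symm) q (hκ.mdifferentiableAt hx)
    (hκ.mdifferentiableAt_symm hq)
  have hid : (κ : M → V3) ∘ κ.symm =ᶠ[𝓝 q] id := by
    filter_upwards [κ.open_target.mem_nhds hq] with p hp using κ.right_inv hp
  rw [hid.mfderiv_eq, mfderiv_id] at hcomp
  exact ⟨(mfderiv 𝓘(ℝ, V3) (𝓡 3) κ.symm q : V3 →L[ℝ] E3) u, (DFunLike.congr_fun hcomp u).symm⟩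

end IsSmoothChart

end Extension

section ContactExtension

variable {M : Type*} [TopologicalSpace M] [ChartedSpace E3 M] [IsManifold (𝓡 3) ∞ M]
  {ξ : CoorientedContactStructure M} {κ : OpenPartialHomeomorph M V3} {μ : V3 → V3 → ℝ}

namespace CoorientedContactStructure

variable (ξ κ μ) in
/-- The contact structure is read in the chart `κ` as the kernel of `μ`, with its positive side. -/
def IsChartForm : Prop :=
  ∀ x ∈ κ.source, ∀ v : TangentSpace (𝓡 3) x,
    (v ∈ ξ.plane x ↔ μ (κ x) (mfderiv (𝓡 3) 𝓘(ℝ, V3) κ x v) = 0) ∧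
    (v ∈ ξ.pos x ↔ 0 < μ (κ x) (mfderiv (𝓡 3) 𝓘(ℝ, V3) κ x v))

theorem IsChartForm.preservesAt (hμ : ξ.IsChartForm κ μ) {x y : M} (hx : x ∈ κ.source)
    (hy : y ∈ κ.source) {L : E3 →L[ℝ] E3} {c : ℝ} (hc : 0 < c)
    (h : ∀ v : E3, μ (κ y) ((mfderiv (𝓡 3) 𝓘(ℝ, V3) κ y : E3 →L[ℝ] V3) (L v)) =
      c * μ (κ x) ((mfderiv (𝓡 3) 𝓘(ℝ, V3) κ x : E3 →L[ℝ] V3) v)) :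
    ξ.PreservesAt x y L := by
  intro v
  refine ⟨(hμ y hy (L v)).1.trans (Iff.trans ?_ (hμ x hx v).1.symm),
    (hμ y hy (L v)).2.trans (Iff.trans ?_ (hμ x hx v).2.symm)⟩
  · exact (Iff.of_eq (congrArg (· = 0) (h v))).trans (mul_eq_zero_iff_left hc.ne')
  · exact (Iff.of_eq (congrArg (0 < ·) (h v))).trans (mul_pos_iff_of_pos_left hc)

variable {I : Set ℝ} {s : ℝ} {C : Set V3} {Θ : DiffeoFamily I C}

theorem IsChartForm.isContactomorphism_of_extendByChart [T2Space M] (hμ : ξ.IsChartForm κ μ)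
    (hκ : IsSmoothChart κ) (hC : IsCompact C) (hCκ : C ⊆ κ.target) (hs : s ∈ I)
    {φ : M ≃ₘ^∞⟮𝓡 3, 𝓡 3⟯ M} (hφ : ∀ x, φ x = extendByChart κ (Θ.map s) x)
    (h : ∀ q ∈ κ.target, ∃ c > 0, ∀ v, μ (Θ.map s q) (fderiv ℝ (Θ.map s) q v) = c * μ q v) :
    ξ.IsContactomorphism φ := by
  rw [isContactomorphism_iff]
  intro x
  by_cases hx : x ∈ κ.source
  · have hφκ : ∀ y ∈ κ.source, φ y ∈ κ.source ∧ κ (φ y) = Θ.map s (κ y) := fun y hy => by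
      have hmem := Θ.map_mem hs hCκ (κ.map_source hy)
      rw [hφ, extendByChart_of_mem hy]
      exact ⟨κ.map_target hmem, κ.right_inv hmem⟩
    obtain ⟨c, hc, hcv⟩ := h (κ x) (κ.map_source hx)
    refine hμ.preservesAt hx (hφκ x hx).1 hc fun v => ?_
    have hd := hκ.mfderiv_mfderiv_apply hx (hφκ x hx).1 (mdifferentiableAt_diffeomorph φ x)
      ((Θ.contDiff_map hs).differentiable (by simp) _)
      (by filter_upwards [κ.open_source.mem_nhds hx] with y hy using (hφκ y hy).2) v
    exact (congrArg₂ (fun q w => μ q w) (hφκ x hx).2 hd).trans (hcv _)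
  · refine preservesAt_mfderiv_of_eventuallyEq_id ?_
    filter_upwards [eventually_notMem_image_symm hC hCκ hx] with y hy
    rw [hφ]
    exact extendByChart_of_notMem_image (Θ.map_eq_self s hs) hy

end CoorientedContactStructure

end ContactExtension

section TargetChart

variable {M : Type*} [TopologicalSpace M]

theorem IsSmoothChart.trans_symm [ChartedSpace E3 M] {e : OpenPartialHomeomorph M V3}
    (he : IsSmoothChart e) {c : OpenPartialHomeomorph V3 V3} (hc : ContDiffOn ℝ ∞ c c.source)
    (hc' : ContDiffOn ℝ ∞ c.symm c.target) : IsSmoothChart (e.trans c.symm) :=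
  ⟨hc'.contMDiffOn.comp (he.smooth.mono fun _ hx => hx.1) fun _ hx => hx.2,
    he.smooth_symm.comp (hc.contMDiffOn.mono fun _ hx => hx.1) fun _ hx => hx.2⟩

variable {e : OpenPartialHomeomorph M V3} {W Q : V3 → ℝ}
  {J N : Set V3} (T : GeneratingStep W Q J N)

namespace GeneratingStep

variable (e) in
/-- The coordinates on `M` in which the target motion of `T` takes place: `e` followed by the
inverse of `genTarget W`. -/
def targetChart : OpenPartialHomeomorph M V3 := e.trans T.chart.symm

theorem targetChart_target (hNe : Set.MapsTo (genTarget W) N e.target) :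
    (T.targetChart e).target = T.chart.source := by
  refine Set.inter_eq_left.2 fun q hq => ?_
  simpa [T.chart_apply] using hNe (T.chart_source_subset hq)

theorem targetChart_symm_apply (q : V3) : (T.targetChart e).symm q = e.symm (genTarget W q) :=
  congrArg e.symm (T.chart_apply q)

theorem contDiffOn_chart : ContDiffOn ℝ ∞ T.chart T.chart.source :=
  T.isAxisGenerating_source.contDiffOn_genTarget.congr fun q _ => T.chart_apply q

theorem isSmoothChart_targetChart [ChartedSpace E3 M] (he : IsSmoothChart e) :
    IsSmoothChart (T.targetChart e) :=
  he.trans_symm T.contDiffOn_chart T.contDiffOn_chart_symm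

end GeneratingStep

end TargetChart

section LocalModification

variable {M : Type*} [TopologicalSpace M] [ChartedSpace E3 M] [IsManifold (𝓡 3) ∞ M]
  {ξ : CoorientedContactStructure M} {K : Set M} {e : OpenPartialHomeomorph M V3}

theorem CoorientedContactStructure.IsChartForm.trans_symm {μ : V3 → V3 → ℝ}
    (hμ : ξ.IsChartForm e μ) (he : IsSmoothChart e) {c : OpenPartialHomeomorph V3 V3}
    (hc : ContDiffOn ℝ ∞ c c.source) (hc' : ContDiffOn ℝ ∞ c.symm c.target) :
    ξ.IsChartForm (e.trans c.symm) fun q v => μ (c q) (fderiv ℝ c q v) := by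
  intro x hx v
  have hdc : DifferentiableAt ℝ c (c.symm (e x)) :=
    (hc.contDiffAt (c.open_source.mem_nhds (c.map_target hx.2))).differentiableAt (by simp)
  have hcomp := mfderiv_comp (g := c) (f := e.trans c.symm) x hdc.mdifferentiableAt
    ((he.trans_symm hc hc').mdifferentiableAt hx)
  have heq : c ∘ e.trans c.symm =ᶠ[𝓝 x] e := by
    filter_upwards [(e.trans c.symm).open_source.mem_nhds hx] with y hy using c.right_inv hy.2
  rw [heq.mfderiv_eq, mfderiv_eq_fderiv] at hcomp
  have hform : μ (e x) ((mfderiv (𝓡 3) 𝓘(ℝ, V3) e x : E3 →L[ℝ] V3) v) = _ :=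
    congrArg₂ μ (c.right_inv hx.2).symm (DFunLike.congr_fun hcomp v)
  exact ⟨(hμ x hx.1 v).1.trans (Iff.of_eq (congrArg (· = 0) hform)),
    (hμ x hx.1 v).2.trans (Iff.of_eq (congrArg (0 < ·) hform))⟩

variable (ξ K e) in
/-- A chart in which `ξ` is the standard contact structure and `K` is the first coordinate axis. -/
structure IsDarbouxChart : Prop where
  smooth : IsSmoothChart e
  form : ξ.IsChartForm e stdForm
  axis : ∀ x ∈ e.source, x ∈ K ↔ (e x).2 = 0

theorem IsAxisGenerating.genTarget_eq_self {W : V3 → ℝ} {N : Set V3} (h : IsAxisGenerating W N)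
    {q : V3} (hq : q ∈ N) (hq₀ : q.2 = 0) : genTarget W q = q := by
  rw [← axis_eq_of_snd_eq_zero hq₀] at hq ⊢
  exact h.genTarget_axis hq

namespace GeneratingStep

variable {W Q : V3 → ℝ} {J N : Set V3} (T : GeneratingStep W Q J N) {s : ℝ}

theorem targetChart_eq (he : IsDarbouxChart ξ K e) {a : M} (ha : a ∈ K)
    (hsource : a ∈ (T.targetChart e).source) :
    T.targetChart e a = e a ∧ (e a).2 = 0 ∧ e a ∈ N := by
  have hmem : T.chart.symm (e a) ∈ T.chart.source := T.chart.map_target hsource.2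
  have hright : genTarget W (T.chart.symm (e a)) = e a := by
    rw [← T.chart_apply]
    exact T.chart.right_inv hsource.2
  have haxis : (e a).2 = 0 := (he.axis a hsource.1).1 ha
  have hfixed := (T.isAxisGenerating_source.genTarget_eq_self hmem
    (T.chart_axis _ hmem (by rwa [hright]))).symm.trans hright
  exact ⟨hfixed, haxis, T.chart_source_subset (hfixed ▸ hmem)⟩

theorem exists_contactIsotopic [T2Space M] (he : IsDarbouxChart ξ K e)
    (hNe : Set.MapsTo (genTarget W) N e.target) (hs : s ∈ Set.Ioo (-T.r) T.r) :
    ∃ φ : M ≃ₘ^∞⟮𝓡 3, 𝓡 3⟯ M, ξ.ContactIsotopic (Diffeomorph.refl (𝓡 3) M ∞) φ ∧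
      ∀ x, φ x = extendByChart (T.targetChart e) (T.family.map s) x := by
  have hκ := T.isSmoothChart_targetChart he.smooth
  have htarget := T.targetChart_target hNe
  have hsupp : T.supp ⊆ (T.targetChart e).target := htarget ▸ T.supp_subset
  obtain ⟨Φ, hΦ, hsmooth⟩ :=
    T.family.exists_diffeomorph_extendByChart hκ T.isCompact_supp hsupp isOpen_Ioo
  refine ⟨Φ s, .refl_of_family hsmooth (fun t ht => ?_) ?_ hs, hΦ s hs⟩
  · refine (he.form.trans_symm he.smooth T.contDiffOn_chart
      T.contDiffOn_chart_symm).isContactomorphism_of_extendByChart hκ T.isCompact_supp hsupp ht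
      (hΦ t ht) ?_
    rw [show (T.chart : V3 → V3) = genTarget W from funext T.chart_apply]
    exact fun q hq => T.exists_stdForm_family ht (htarget ▸ hq)
  · ext x
    rw [hΦ 0 T.zero_mem]
    exact extendByChart_eq_self fun _ => T.family_map_zero _

theorem extendByChart_eq_self_of_mem (he : IsDarbouxChart ξ K e)
    (hs : s ∈ Set.Ioo (-T.r) T.r) {x : M} (hx : x ∈ K) :
    extendByChart (T.targetChart e) (T.family.map s) x = x := by
  refine extendByChart_eq_self fun hsource => ?_
  obtain ⟨heq, haxis, -⟩ := T.targetChart_eq he hx hsource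
  rw [heq, ← axis_eq_of_snd_eq_zero haxis]
  exact T.family_map_axis hs _

theorem eventually_extendByChart_eq_self [T2Space M] (he : IsDarbouxChart ξ K e)
    (hNe : Set.MapsTo (genTarget W) N e.target) (hs : s ∈ Set.Ioo (-T.r) T.r) {a : M}
    (ha : a ∈ K) (haQ : a ∈ e.source → e a ∈ N → ∀ᶠ q in 𝓝 (e a), Q q = 0) :
    ∀ᶠ x in 𝓝 a, extendByChart (T.targetChart e) (T.family.map s) x = x := by
  by_cases hsource : a ∈ (T.targetChart e).source
  · obtain ⟨heq, -, haN⟩ := T.targetChart_eq he ha hsource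
    have hfixed := T.eventually_family_map_eq_self hs (heq ▸ haQ hsource.1 haN)
    filter_upwards [((T.targetChart e).continuousAt hsource).eventually hfixed] with x hx
    exact extendByChart_eq_self fun _ => hx
  · have hsupp : T.supp ⊆ (T.targetChart e).target := T.targetChart_target hNe ▸ T.supp_subset
    filter_upwards [eventually_notMem_image_symm T.isCompact_supp hsupp hsource] with x hx
    exact extendByChart_of_notMem_image (T.family.map_eq_self s hs) hx

end GeneratingStep

variable (ξ K e) in
/-- A contact isotopy of `M`, relative to `K` and to the germ of `A`, carries the contact germ along
`J` with generating function `W` in the chart `e` to the one with generating function `U`. The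
homeomorphism `θ` compares the mixed coordinates of the two germs at the same source point. -/
def GeneratingIsotopic (A : Set M) (J : Set V3) (W U : V3 → ℝ) : Prop :=
  ∃ φ : M ≃ₘ^∞⟮𝓡 3, 𝓡 3⟯ M, ξ.ContactIsotopic (Diffeomorph.refl (𝓡 3) M ∞) φ ∧
    (∀ x ∈ K, φ x = x) ∧ (∀ a ∈ A, ∀ᶠ x in 𝓝 a, φ x = x) ∧
    ∃ θ : V3 ≃ₜ V3, (∀ q ∈ J, θ q = q) ∧ ∀ᶠ q in 𝓝ˢ J,
      genSource U q = genSource W (θ q) ∧ φ (e.symm (genTarget W (θ q))) = e.symm (genTarget U q)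

theorem tendsto_nhdsSet_of_forall_eq_self {X : Type*} [TopologicalSpace X] {f : X → X}
    {J : Set X} (hf : Continuous f) (hJ : ∀ q ∈ J, f q = q) : Filter.Tendsto f (𝓝ˢ J) (𝓝ˢ J) :=
  hf.tendsto_nhdsSet fun q hq => (hJ q hq).symm ▸ hq

namespace GeneratingIsotopic

variable {A : Set M} {J : Set V3} {W U V : V3 → ℝ}

theorem symm (h : GeneratingIsotopic ξ K e A J W U) : GeneratingIsotopic ξ K e A J U W := by
  obtain ⟨φ, hφ, hK, hA, θ, hθJ, hθ⟩ := h
  have hφ_symm : ∀ x, φ x = x → φ.symm x = x := fun x hx =>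
    φ.toEquiv.symm_apply_eq.2 hx.symm
  have hθ_symm : ∀ q ∈ J, θ.symm q = q := fun q hq => θ.toEquiv.symm_apply_eq.2 (hθJ q hq).symm
  refine ⟨φ.symm, hφ.diffeomorph_symm, fun x hx => hφ_symm x (hK x hx),
    fun a ha => (hA a ha).mono hφ_symm, θ.symm, hθ_symm, ?_⟩
  filter_upwards [(tendsto_nhdsSet_of_forall_eq_self θ.symm.continuous hθ_symm).eventually hθ]
    with q hq
  rw [θ.apply_symm_apply] at hq
  exact ⟨hq.1.symm, φ.toEquiv.symm_apply_eq.2 hq.2.symm⟩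

theorem trans (hWU : GeneratingIsotopic ξ K e A J W U) (hUV : GeneratingIsotopic ξ K e A J U V) :
    GeneratingIsotopic ξ K e A J W V := by
  obtain ⟨φ, hφ, hφK, hφA, θ, hθJ, hθ⟩ := hWU
  obtain ⟨ψ, hψ, hψK, hψA, η, hηJ, hη⟩ := hUV
  refine ⟨φ.trans ψ, ?_, fun x hx => ?_, fun a ha => ?_, η.trans θ, fun q hq => ?_, ?_⟩
  · simpa only [Diffeomorph.refl_trans] using hφ.diffeomorph_trans hψ
  · exact (congrArg ψ (hφK x hx)).trans (hψK x hx)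
  · filter_upwards [hφA a ha, hψA a ha] with x hφx hψx
    exact (congrArg ψ hφx).trans hψx
  · exact (congrArg θ (hηJ q hq)).trans (hθJ q hq)
  · filter_upwards [hη, (tendsto_nhdsSet_of_forall_eq_self η.continuous hηJ).eventually hθ]
      with q hq hηq
    exact ⟨hq.1.trans hηq.1, (congrArg ψ hηq.2).trans hq.2⟩

end GeneratingIsotopic

theorem IsDarbouxChart.exists_generatingIsotopic_add_mul [T2Space M]
    (he : IsDarbouxChart ξ K e) {W Q : V3 → ℝ} {N J : Set V3} (h : IsAxisGenerating W N)
    (hJ : IsCompact J) (hJN : J ⊆ N) (hJ₀ : ∀ q ∈ J, q.2 = 0) (hJe : J ⊆ e.target)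
    (hQ : IsAxisPerturbation Q N) {A : Set M} (hA : A ⊆ K)
    (hAQ : ∀ a ∈ A, a ∈ e.source → e a ∈ N → ∀ᶠ q in 𝓝 (e a), Q q = 0) :
    ∃ r > 0, ∀ s ∈ Set.Ioo (-r) r, GeneratingIsotopic ξ K e A J W fun q => W q + s * Q q := by
  let N' := N ∩ genTarget W ⁻¹' e.target
  have hN' : IsOpen N' :=
    h.contDiffOn_genTarget.continuousOn.isOpen_inter_preimage h.isOpen e.open_target
  have hN'N : N' ⊆ N := Set.inter_subset_left
  have hN'e : Set.MapsTo (genTarget W) N' e.target := fun _ hq => hq.2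
  have hJN' : J ⊆ N' := fun q hq =>
    ⟨hJN hq, by rw [Set.mem_preimage, h.genTarget_eq_self (hJN hq) (hJ₀ q hq)]; exact hJe hq⟩
  obtain ⟨T⟩ := (h.mono hN' hN'N).nonempty_generatingStep hJ hJN' hJ₀ (hQ.mono hN'N)
  refine ⟨T.r, T.r_pos, fun s hs => ?_⟩
  obtain ⟨φ, hφ, hφx⟩ := T.exists_contactIsotopic he hN'e hs
  obtain ⟨θ, hθJ, hθ⟩ := T.exists_homeomorph_genTarget_eq hs
  refine ⟨φ, hφ, fun x hx => ?_, fun a ha => ?_, θ, hθJ, ?_⟩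
  · rw [hφx, T.extendByChart_eq_self_of_mem he hs hx]
  · simp only [hφx]
    exact T.eventually_extendByChart_eq_self he hN'e hs (hA ha) fun hae haN =>
      hAQ a ha hae (hN'N haN)
  · filter_upwards [hθ] with q ⟨hmem, _, hsource, htarget⟩
    have hmem' : θ q ∈ (T.targetChart e).target := T.targetChart_target hN'e ▸ hmem
    refine ⟨hsource, ?_⟩
    rw [htarget, ← T.targetChart_symm_apply, ← T.targetChart_symm_apply, hφx,
      extendByChart_of_mem ((T.targetChart e).map_target hmem'), (T.targetChart e).right_inv hmem']

end LocalModification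

section LocalIsotopy

theorem eventually_apply_symm_eq_self {X Y : Type*} [TopologicalSpace X] [TopologicalSpace Y]
    {e : OpenPartialHomeomorph X Y} {g : X → X} {a : X} (ha : a ∈ e.source)
    (hg : ∀ᶠ x in 𝓝 a, g x = x) : ∀ᶠ q in 𝓝 (e a), e (g (e.symm q)) = q := by
  have hsymm := e.continuousAt_symm (e.map_source ha)
  rw [ContinuousAt, e.left_inv ha] at hsymm
  filter_upwards [hsymm.eventually hg, e.open_target.mem_nhds (e.map_source ha)] with q hq hqt
  rw [hq, e.right_inv hqt]

variable {M : Type*} [TopologicalSpace M] [ChartedSpace E3 M] [IsManifold (𝓡 3) ∞ M]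

theorem exists_pos_forall_stdForm_eq {q p : V3} (L : V3 →L[ℝ] V3)
    (hzero : ∀ v, stdForm q v = 0 → stdForm p (L v) = 0)
    (hpos : ∀ v, 0 < stdForm q v → 0 < stdForm p (L v)) :
    ∃ c > 0, ∀ v, stdForm p (L v) = c * stdForm q v := by
  refine ⟨stdForm p (L (0, 0, 1)), hpos _ (by simp [stdForm]), fun v => ?_⟩
  have hv := hzero (v - stdForm q v • (0, 0, 1)) (by simp [stdForm])
  rw [map_sub, map_smul] at hv
  simp only [stdForm, Prod.snd_sub, Prod.fst_sub, Prod.smul_fst, Prod.smul_snd, smul_eq_mul]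
    at hv ⊢
  linear_combination hv

namespace IsDarbouxChart

variable {ξ : CoorientedContactStructure M} {K : Set M} {e : OpenPartialHomeomorph M V3}

theorem isAxisContact (he : IsDarbouxChart ξ K e) {g : M ≃ₘ^∞⟮𝓡 3, 𝓡 3⟯ M}
    (hg : ξ.IsContactomorphism g) (hgK : ∀ x ∈ K, g x = x) :
    IsAxisContact (fun q => e (g (e.symm q))) (e.target ∩ e.symm ⁻¹' (g ⁻¹' e.source)) := by
  have hD : IsOpen (e.target ∩ e.symm ⁻¹' (g ⁻¹' e.source)) :=
    e.isOpen_inter_preimage_symm (e.open_source.preimage g.continuous)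
  have hsmooth : ContDiffOn ℝ ∞ (fun q => e (g (e.symm q)))
      (e.target ∩ e.symm ⁻¹' (g ⁻¹' e.source)) :=
    contMDiffOn_iff_contDiffOn.1 <| he.smooth.smooth.comp (g.contMDiff.comp_contMDiffOn
      (he.smooth.smooth_symm.mono Set.inter_subset_left)) fun _ hq => hq.2
  refine ⟨hD, hsmooth, fun x hx => ?_, fun q hq => ?_⟩
  · rw [hgK _ ((he.axis _ (e.map_target hx.1)).2 (congrArg Prod.snd (e.right_inv hx.1))),
      e.right_inv hx.1]
  obtain ⟨x, hx, rfl⟩ := e.surjOn hq.1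
  have hgx : g x ∈ e.source := by simpa [e.left_inv hx] using hq.2
  have hread : ∀ y ∈ e.source, e (g y) = e (g (e.symm (e y))) := fun y hy => by
    rw [e.left_inv hy]
  have hd := he.smooth.mfderiv_mfderiv_apply hx hgx (mdifferentiableAt_diffeomorph g x)
    ((hsmooth.contDiffAt (hD.mem_nhds hq)).differentiableAt (by simp))
    (by filter_upwards [e.open_source.mem_nhds hx] with y hy using hread y hy)
  have hcontact := (CoorientedContactStructure.isContactomorphism_iff g).1 hg x
  rw [← hread x hx]
  refine exists_pos_forall_stdForm_eq _ (fun u hu => ?_) fun u hu => ?_ <;>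
    obtain ⟨v, rfl⟩ := he.smooth.surjective_mfderiv hx u <;> rw [← hd v]
  · exact (he.form (g x) hgx _).1.1 ((hcontact v).1.2 ((he.form x hx v).1.2 hu))
  · exact (he.form (g x) hgx _).2.1 ((hcontact v).2.2 ((he.form x hx v).2.2 hu))

theorem generatingIsotopic_genIdentity [T2Space M] (he : IsDarbouxChart ξ K e) {W : V3 → ℝ}
    {N J : Set V3} (hW : IsAxisGenerating W N) (hJ : IsCompact J) (hJN : J ⊆ N)
    (hJ₀ : ∀ q ∈ J, q.2 = 0) (hJe : J ⊆ e.target) {A : Set M} (hA : A ⊆ K)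
    (hAW : ∀ a ∈ A, a ∈ e.source → e a ∈ N → ∀ᶠ q in 𝓝 (e a), W q = genIdentity q) :
    GeneratingIsotopic ξ K e A J W genIdentity := by
  let path : ℝ → V3 → ℝ := fun t q => W q + t * (genIdentity q - W q)
  suffices h : GeneratingIsotopic ξ K e A J (path 0) (path 1) by simpa [path] using h
  refine isPreconnected_Icc.induction₂
    (fun t u => GeneratingIsotopic ξ K e A J (path t) (path u)) (fun t ht => ?_)
    (fun _ _ _ _ _ _ => .trans) (fun _ _ _ _ => .symm)
    (Set.left_mem_Icc.2 zero_le_one) (Set.right_mem_Icc.2 zero_le_one)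
  obtain ⟨r, hr, hstep⟩ := he.exists_generatingIsotopic_add_mul (hW.affinePath ht) hJ hJN hJ₀ hJe
    hW.isAxisPerturbation hA fun a ha hae haN =>
      (hAW a ha hae haN).mono fun q hq => sub_eq_zero.2 hq.symm
  refine nhdsWithin_le_nhds ?_
  filter_upwards [Ioo_mem_nhds (sub_lt_self t hr) (lt_add_of_pos_right t hr)] with u hu
  convert hstep (u - t) ⟨by linarith [hu.1], by linarith [hu.2]⟩ using 2 with q
  ring

theorem exists_contactIsotopic_eq_self [T2Space M] (he : IsDarbouxChart ξ K e)
    {g : M ≃ₘ^∞⟮𝓡 3, 𝓡 3⟯ M} (hg : ξ.IsContactomorphism g) (hgK : ∀ x ∈ K, g x = x)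
    {A J : Set M} (hA : A ⊆ K) (hgA : ∀ a ∈ A, ∀ᶠ x in 𝓝 a, g x = x) (hJ : IsCompact J)
    (hJK : J ⊆ K) (hJe : J ⊆ e.source) :
    ∃ h : M ≃ₘ^∞⟮𝓡 3, 𝓡 3⟯ M, ξ.ContactIsotopic g h ∧
      (∀ x ∈ K, h x = x) ∧ ∀ a ∈ A ∪ J, ∀ᶠ x in 𝓝 a, h x = x := by
  have hJ₀ : ∀ q ∈ e '' J, q.2 = 0 :=
    Set.forall_mem_image.2 fun x hx => (he.axis x (hJe hx)).1 (hJK hx)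
  have hJt : e '' J ⊆ e.target := (e.mapsTo.mono_left hJe).image_subset
  have hJD : e '' J ⊆ e.target ∩ e.symm ⁻¹' (g ⁻¹' e.source) :=
    Set.image_subset_iff.2 fun x hx => ⟨e.map_source (hJe hx), by
      simpa [e.left_inv (hJe hx), hgK x (hJK hx)] using hJe hx⟩
  have hJc : IsCompact (e '' J) := hJ.image_of_continuousOn (e.continuousOn.mono hJe)
  obtain ⟨W, N, hW, hJN, hWg, hWid⟩ := (he.isAxisContact hg hgK).exists_generating hJc hJD hJ₀
  have hAW : ∀ a ∈ A, a ∈ e.source → e a ∈ N → ∀ᶠ q in 𝓝 (e a), W q = genIdentity q :=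
    fun a ha hae haN => hWid (e a) haN (eventually_apply_symm_eq_self hae (hgA a ha))
  obtain ⟨φ, hφ, hφK, hφA, θ, hθJ, hθ⟩ :=
    he.generatingIsotopic_genIdentity hW hJc hJN hJ₀ hJt hA hAW
  refine ⟨g.trans φ, ?_, fun x hx => (congrArg φ (hgK x hx)).trans (hφK x hx), ?_⟩
  · simpa only [Diffeomorph.trans_refl] using
      (CoorientedContactStructure.ContactIsotopic.refl hg).diffeomorph_trans hφ
  rintro a (ha | ha)
  · filter_upwards [hgA a ha, hφA a ha] with x hgx hφx using (congrArg φ hgx).trans hφx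
  have hsource : ∀ᶠ q in 𝓝ˢ (e '' J), θ q ∈ N :=
    (tendsto_nhdsSet_of_forall_eq_self θ.continuous hθJ).eventually
      (hW.isOpen.mem_nhdsSet.2 hJN)
  filter_upwards [(e.continuousAt (hJe ha)).eventually ((hsource.and hθ).filter_mono
    (nhds_le_nhdsSet (Set.mem_image_of_mem e ha))), e.open_source.mem_nhds (hJe ha)]
    with x ⟨hxN, hxs, hxt⟩ hx
  obtain ⟨hD, hgW⟩ := hWg _ hxN
  rw [genSource_genIdentity] at hxs
  rw [← hxs, Set.mem_inter_iff, Set.mem_preimage, e.left_inv hx] at hD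
  rwa [genTarget_genIdentity, ← hgW, ← hxs, e.left_inv hx, e.left_inv hD.2] at hxt

end IsDarbouxChart

end LocalIsotopy

section Globalization

variable {M : Type*} [TopologicalSpace M] [ChartedSpace E3 M] [IsManifold (𝓡 3) ∞ M]
  {ξ : CoorientedContactStructure M}

variable (ξ) in
/-- Contactomorphisms fixing `K` can be made the identity near `S ∩ K` by a contact isotopy which
fixes `K` and does not spoil the points of `K` near which they already are the identity. -/
def CanTrivializeNear (K S : Set M) : Prop :=
  ∀ g : M ≃ₘ^∞⟮𝓡 3, 𝓡 3⟯ M, ξ.IsContactomorphism g → (∀ x ∈ K, g x = x) →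
    ∀ A ⊆ K, (∀ a ∈ A, ∀ᶠ x in 𝓝 a, g x = x) →
      ∃ h : M ≃ₘ^∞⟮𝓡 3, 𝓡 3⟯ M, ξ.ContactIsotopic g h ∧
        (∀ x ∈ K, h x = x) ∧ ∀ a ∈ A ∪ (S ∩ K), ∀ᶠ x in 𝓝 a, h x = x

namespace CanTrivializeNear

variable {K S S' : Set M}

theorem empty : CanTrivializeNear ξ K ∅ := fun g hg hgK A _ hgA =>
  ⟨g, .refl hg, hgK, by simpa using hgA⟩

theorem mono (hS : S ⊆ S') (h : CanTrivializeNear ξ K S') : CanTrivializeNear ξ K S :=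
  fun g hg hgK A hA hgA =>
    have ⟨f, hgf, hfK, hf⟩ := h g hg hgK A hA hgA
    ⟨f, hgf, hfK, fun a ha => hf a (ha.imp_right fun h => ⟨hS h.1, h.2⟩)⟩

theorem union (hS : CanTrivializeNear ξ K S) (hS' : CanTrivializeNear ξ K S') :
    CanTrivializeNear ξ K (S ∪ S') := by
  intro g hg hgK A hA hgA
  obtain ⟨f, hgf, hfK, hf⟩ := hS g hg hgK A hA hgA
  obtain ⟨h, hfh, hhK, hh⟩ := hS' f hgf.isContactomorphism_right hfK _
    (Set.union_subset hA Set.inter_subset_right) hf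
  refine ⟨h, hgf.trans hfh, hhK, fun a ha => hh a ?_⟩
  rwa [Set.union_inter_distrib_right, ← Set.union_assoc] at ha

end CanTrivializeNear

theorem exists_contactIsotopic_eq_self_near [T2Space M] {K : Set M} (hK : IsCompact K)
    (hD : ∀ x ∈ K, ∃ e : OpenPartialHomeomorph M V3, IsDarbouxChart ξ K e ∧ x ∈ e.source)
    {g : M ≃ₘ^∞⟮𝓡 3, 𝓡 3⟯ M} (hg : ξ.IsContactomorphism g) (hgK : ∀ x ∈ K, g x = x) :
    ∃ h : M ≃ₘ^∞⟮𝓡 3, 𝓡 3⟯ M, ξ.ContactIsotopic g h ∧ ∀ a ∈ K, ∀ᶠ x in 𝓝 a, h x = x := by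
  have : LocallyCompactSpace M := ChartedSpace.locallyCompactSpace E3 M
  have hlocal : ∀ x ∈ K, ∃ C ∈ 𝓝[K] x, CanTrivializeNear ξ K C := fun x hx => by
    obtain ⟨e, he, hxe⟩ := hD x hx
    obtain ⟨C, hC, hCe, hCc⟩ := local_compact_nhds (e.open_source.mem_nhds hxe)
    exact ⟨C, mem_nhdsWithin_of_mem_nhds hC, fun g hg hgK A hA hgA =>
      he.exists_contactIsotopic_eq_self hg hgK hA hgA (hCc.inter_right hK.isClosed)
        Set.inter_subset_right (Set.inter_subset_left.trans hCe)⟩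
  have htriv : CanTrivializeNear ξ K K :=
    hK.induction_on (p := CanTrivializeNear ξ K) .empty (fun _ _ => .mono) (fun _ _ => .union)
      hlocal
  obtain ⟨h, hgh, -, hh⟩ := htriv g hg hgK ∅ (Set.empty_subset _) (by simp)
  exact ⟨h, hgh, fun a ha => hh a (.inr ⟨ha, ha⟩)⟩

end Globalization

section Pullback

section ExteriorDerivative

variable {V V' : Type*} [NormedAddCommGroup V] [NormedSpace ℝ V] [NormedAddCommGroup V']
  [NormedSpace ℝ V']

/-- The exterior derivative of a `1`-form on a normed space, a `1`-form being given as a function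
with values in the dual space. -/
def extDerivForm (β : V → V →L[ℝ] ℝ) (q : V) : V [⋀^Fin 2]→L[ℝ] ℝ :=
  extDeriv (fun y => ContinuousAlternatingMap.ofSubsingleton ℝ V ℝ (0 : Fin 1) (β y)) q

theorem extDerivForm_congr {β β' : V → V →L[ℝ] ℝ} {q : V} (h : β =ᶠ[𝓝 q] β') :
    extDerivForm β q = extDerivForm β' q :=
  Filter.EventuallyEq.extDeriv_eq (h.fun_comp _)

theorem differentiableAt_ofSubsingleton {β : V → V →L[ℝ] ℝ} {q : V}
    (hβ : DifferentiableAt ℝ β q) : DifferentiableAt ℝ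
      (fun y => ContinuousAlternatingMap.ofSubsingleton ℝ V ℝ (0 : Fin 1) (β y)) q :=
  (ContinuousAlternatingMap.ofSubsingletonLIE (𝕜 := ℝ) (E := V) (F := ℝ)
    (0 : Fin 1)).toContinuousLinearEquiv.differentiableAt.comp q hβ

theorem hasFDerivAt_form_apply {β : V → V →L[ℝ] ℝ} {q : V} (hβ : DifferentiableAt ℝ β q) (v : V) :
    HasFDerivAt (fun y => β y v) ((fderiv ℝ β q).flip v) q := by
  simpa using hβ.hasFDerivAt.clm_apply (hasFDerivAt_const v q)

theorem extDerivForm_apply {β : V → V →L[ℝ] ℝ} {q : V} (hβ : DifferentiableAt ℝ β q) (v w : V) :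
    extDerivForm β q ![v, w] = fderiv ℝ β q v w - fderiv ℝ β q w v := by
  rw [extDerivForm, extDeriv_apply (differentiableAt_ofSubsingleton hβ), Fin.sum_univ_two]
  have hv := (hasFDerivAt_form_apply hβ v).fderiv
  have hw := (hasFDerivAt_form_apply hβ w).fderiv
  simp [Fin.removeNth, hv, hw, sub_eq_add_neg]

theorem extDerivForm_comp {η : V' → V' →L[ℝ] ℝ} {ψ : V → V'} {q : V}
    (hη : DifferentiableAt ℝ η (ψ q)) (hψ : ContDiffAt ℝ ∞ ψ q) :
    extDerivForm (fun p => (η (ψ p)).comp (fderiv ℝ ψ p)) q =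
      (extDerivForm η (ψ q)).compContinuousLinearMap (fderiv ℝ ψ q) :=
  extDeriv_pullback (differentiableAt_ofSubsingleton hη) hψ (by
    rw [minSmoothness_of_isRCLikeNormedField]
    exact WithTop.coe_le_coe.2 (le_top (a := (2 : ℕ∞))))

end ExteriorDerivative

variable {M : Type*} [TopologicalSpace M] [ChartedSpace E3 M] [IsManifold (𝓡 3) ∞ M]
  {V : Type*} [NormedAddCommGroup V] [NormedSpace ℝ V]

namespace OneForm

theorem apply_congr (α : OneForm M) {x y : M} (h : x = y) :
    (α x : E3 →L[ℝ] ℝ) = (α y : E3 →L[ℝ] ℝ) := by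
  subst h
  rfl

/-- The pullback of a `1`-form on `M` by a map from a normed space. -/
def pullback (α : OneForm M) (f : V → M) (q : V) : V →L[ℝ] ℝ :=
  (α (f q) : E3 →L[ℝ] ℝ).comp (mfderiv 𝓘(ℝ, V) (𝓡 3) f q : V →L[ℝ] E3)

variable (α : OneForm M)

theorem pullback_congr {f f' : V → M} {q : V} (h : f =ᶠ[𝓝 q] f') :
    α.pullback f q = α.pullback f' q :=
  congrArg₂ ContinuousLinearMap.comp (α.apply_congr h.eq_of_nhds)
    (show (mfderiv 𝓘(ℝ, V) (𝓡 3) f q : V →L[ℝ] E3) = mfderiv 𝓘(ℝ, V) (𝓡 3) f' q from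
      h.mfderiv_eq)

theorem pullback_comp {V' : Type*} [NormedAddCommGroup V'] [NormedSpace ℝ V']
    {f : V → M} {c : V' → V} {q : V'} (hf : MDifferentiableAt 𝓘(ℝ, V) (𝓡 3) f (c q))
    (hc : DifferentiableAt ℝ c q) :
    α.pullback (fun p => f (c p)) q = (α.pullback f (c q)).comp (fderiv ℝ c q) := by
  have hcomp := mfderiv_comp (g := f) (f := c) q hf hc.mdifferentiableAt
  rw [mfderiv_eq_fderiv] at hcomp
  ext v
  exact congrArg (α (f (c q)) : E3 →L[ℝ] ℝ) (DFunLike.congr_fun hcomp v)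

theorem contDiffOn_pullback [FiniteDimensional ℝ V] {f : V → M} {S : Set V} (hS : IsOpen S)
    (hf : ContMDiffOn 𝓘(ℝ, V) (𝓡 3) ∞ f S) : ContDiffOn ℝ ∞ (α.pullback f) S := by
  rw [contDiffOn_clm_apply]
  intro v
  have htangent := hf.contMDiffOn_tangentMapWithin (m := ∞) (by simp) hS.uniqueMDiffOn
  have hconst : ContMDiffOn 𝓘(ℝ, V) 𝓘(ℝ, V).tangent ∞
      (fun q : V => (⟨q, v⟩ : TangentBundle 𝓘(ℝ, V) V)) S :=
    contMDiffOn_vectorSpace_iff_contDiffOn.2 contDiffOn_const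
  have hpush : ContMDiffOn 𝓘(ℝ, V) (𝓡 3).tangent ∞
      (fun q : V => (⟨f q, (mfderiv 𝓘(ℝ, V) (𝓡 3) f q : V →L[ℝ] E3) v⟩ :
        TangentBundle (𝓡 3) M)) S := by
    refine (htangent.comp hconst fun q hq => hq).congr fun q hq => ?_
    simp only [Function.comp, tangentMapWithin]
    rw [mfderivWithin_of_isOpen hS hq]
  intro q hq
  have hpair := (α.contMDiff.comp_contMDiffOn hf).clm_bundle_apply hpush q hq
  rw [Bundle.contMDiffWithinAt_totalSpace] at hpair
  exact hpair.2.contDiffWithinAt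

theorem inChart_eq_pullback (x : M) : α.inChart x = α.pullback (extChartAt (𝓡 3) x).symm := rfl

theorem differentiableAt_inChart (x : M) :
    DifferentiableAt ℝ (α.inChart x) (extChartAt (𝓡 3) x x) := by
  rw [inChart_eq_pullback]
  exact ((α.contDiffOn_pullback (isOpen_extChartAt_target x)
    (contMDiffOn_extChartAt_symm x)).contDiffAt
      (extChartAt_target_mem_nhds x)).differentiableAt (by simp)

end OneForm

namespace IsSmoothChart

variable {e : OpenPartialHomeomorph M V3} (α : OneForm M)

theorem contDiffOn_pullback (he : IsSmoothChart e) :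
    ContDiffOn ℝ ∞ (α.pullback e.symm) e.target :=
  α.contDiffOn_pullback e.open_target he.smooth_symm

theorem pullback_apply_mfderiv (he : IsSmoothChart e) {x : M} (hx : x ∈ e.source) (v : E3) :
    α.pullback e.symm (e x) ((mfderiv (𝓡 3) 𝓘(ℝ, V3) e x : E3 →L[ℝ] V3) v) =
      (α x : E3 →L[ℝ] ℝ) v := by
  have hcomp := mfderiv_comp (g := e.symm) (f := e) x
    (he.mdifferentiableAt_symm (e.map_source hx)) (he.mdifferentiableAt hx)
  have hid : (e.symm : V3 → M) ∘ e =ᶠ[𝓝 x] id := by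
    filter_upwards [e.open_source.mem_nhds hx] with p hp using e.left_inv hp
  rw [hid.mfderiv_eq, mfderiv_id] at hcomp
  have hv : (mfderiv 𝓘(ℝ, V3) (𝓡 3) e.symm (e x) : V3 →L[ℝ] E3)
      ((mfderiv (𝓡 3) 𝓘(ℝ, V3) e x : E3 →L[ℝ] V3) v) = v := (DFunLike.congr_fun hcomp v).symm
  have hα : (α (e.symm (e x)) : E3 →L[ℝ] ℝ) v = (α x : E3 →L[ℝ] ℝ) v := by
    rw [α.apply_congr (e.left_inv hx)]
    rfl
  exact (congrArg (α (e.symm (e x)) : E3 →L[ℝ] ℝ) hv).trans hα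

theorem contDiffAt_extChartAt_comp_symm (he : IsSmoothChart e) {x : M} (hx : x ∈ e.source) :
    ∀ᶠ q in 𝓝 (e x), e.symm q ∈ (extChartAt (𝓡 3) x).source ∧
      ContDiffAt ℝ ∞ (fun q => extChartAt (𝓡 3) x (e.symm q)) q := by
  filter_upwards [(e.isOpen_inter_preimage_symm (isOpen_extChartAt_source (I := 𝓡 3) x)).mem_nhds
    ⟨e.map_source hx, by simp [e.left_inv hx]⟩] with q hq
  exact ⟨hq.2, ((contMDiffAt_extChartAt' (I := 𝓡 3) (x := x) (by simpa using hq.2)).comp q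
    (he.smooth_symm.contMDiffAt (e.open_target.mem_nhds hq.1))).contDiffAt⟩

theorem pullback_eventuallyEq_inChart (he : IsSmoothChart e) {x : M} (hx : x ∈ e.source) :
    α.pullback e.symm =ᶠ[𝓝 (e x)] fun q => (α.inChart x (extChartAt (𝓡 3) x (e.symm q))).comp
      (fderiv ℝ (fun q => extChartAt (𝓡 3) x (e.symm q)) q) := by
  filter_upwards [(he.contDiffAt_extChartAt_comp_symm hx).eventually_nhds] with q hq
  obtain ⟨hqs, hqd⟩ := hq.self_of_nhds
  rw [α.inChart_eq_pullback, ← α.pullback_comp (f := (extChartAt (𝓡 3) x).symm)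
    (c := fun q => extChartAt (𝓡 3) x (e.symm q))
    (((contMDiffOn_extChartAt_symm (n := ∞) x).contMDiffAt ((isOpen_extChartAt_target x).mem_nhds
      ((extChartAt (𝓡 3) x).map_source hqs))).mdifferentiableAt (by simp))
    (hqd.differentiableAt (by simp))]
  refine α.pullback_congr ?_
  filter_upwards [hq] with p hp using ((extChartAt (𝓡 3) x).left_inv hp.1).symm

theorem d_eq_compContinuousLinearMap (he : IsSmoothChart e) {x : M} (hx : x ∈ e.source) :
    α.d x = (extDerivForm (α.pullback e.symm) (e x)).compContinuousLinearMap
      (mfderiv (𝓡 3) 𝓘(ℝ, V3) e x : E3 →L[ℝ] V3) := by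
  let ψ : V3 → E3 := fun q => extChartAt (𝓡 3) x (e.symm q)
  have hψ : ContDiffAt ℝ ∞ ψ (e x) := (he.contDiffAt_extChartAt_comp_symm hx).self_of_nhds.2
  have hψx : ψ (e x) = extChartAt (𝓡 3) x x := congrArg _ (e.left_inv hx)
  have hcomp := mfderiv_comp (g := ψ) (f := e) x
    (hψ.differentiableAt (by simp)).mdifferentiableAt (he.mdifferentiableAt hx)
  have hψe : ψ ∘ e =ᶠ[𝓝 x] extChartAt (𝓡 3) x := by
    filter_upwards [e.open_source.mem_nhds hx] with y hy using congrArg _ (e.left_inv hy)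
  rw [hψe.mfderiv_eq, mfderiv_eq_fderiv] at hcomp
  have hdiff : DifferentiableAt ℝ (α.inChart x) (ψ (e x)) := hψx ▸ α.differentiableAt_inChart x
  rw [extDerivForm_congr (he.pullback_eventuallyEq_inChart α hx), extDerivForm_comp hdiff hψ, hψx]
  ext v
  exact congrArg (extDerivForm (α.inChart x) (extChartAt (𝓡 3) x x))
    (funext fun i => DFunLike.congr_fun hcomp (v i))

theorem exists_wedge_ne_zero (he : IsSmoothChart e) (hα : α.IsContact) {x : M} (hx : x ∈ e.source) :
    ∃ u v w : V3, α.pullback e.symm (e x) u * extDerivForm (α.pullback e.symm) (e x) ![v, w] +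
      α.pullback e.symm (e x) v * extDerivForm (α.pullback e.symm) (e x) ![w, u] +
      α.pullback e.symm (e x) w * extDerivForm (α.pullback e.symm) (e x) ![u, v] ≠ 0 := by
  obtain ⟨u, v, w, h⟩ : ∃ u v w : E3, α.wedgeD x u v w ≠ 0 := hα x
  let D : E3 →L[ℝ] V3 := mfderiv (𝓡 3) 𝓘(ℝ, V3) e x
  have hd : ∀ a b : E3, extDerivForm (α.pullback e.symm) (e x) ![D a, D b] = α.d x ![a, b] :=
    fun a b => by
      rw [he.d_eq_compContinuousLinearMap α hx]
      exact congrArg _ (funext (Fin.forall_fin_two.2 ⟨rfl, rfl⟩))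
  have happly : ∀ a : E3, α.pullback e.symm (e x) (D a) = (α x : E3 →L[ℝ] ℝ) a :=
    he.pullback_apply_mfderiv α hx
  refine ⟨D u, D v, D w, ?_⟩
  rw [hd, hd, hd, happly, happly, happly]
  exact h

end IsSmoothChart

end Pullback

section AxisCharts

/-- A local diffeomorphism of `ℝ³`, defined near the origin, that fixes the points of the `x`-axis
and maps no other point to the axis. -/
structure IsAxisChart (c : OpenPartialHomeomorph V3 V3) : Prop where
  smooth : ContDiffOn ℝ ∞ c c.source
  smooth_symm : ContDiffOn ℝ ∞ c.symm c.target
  zero_mem : 0 ∈ c.source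
  fix : ∀ t, (t, 0, 0) ∈ c.source → c (t, 0, 0) = (t, 0, 0)
  axis : ∀ q ∈ c.source, (c q).2 = 0 ↔ q.2 = 0

namespace IsAxisChart

variable {c : OpenPartialHomeomorph V3 V3}

theorem apply_zero (hc : IsAxisChart c) : c 0 = 0 := hc.fix 0 hc.zero_mem

theorem symm (hc : IsAxisChart c) : IsAxisChart c.symm where
  smooth := hc.smooth_symm
  smooth_symm := hc.smooth
  zero_mem := by
    have hmem := c.map_source hc.zero_mem
    rwa [hc.apply_zero] at hmem
  fix t ht := by
    have hq := c.map_target ht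
    have haxis := axis_eq_of_snd_eq_zero ((hc.axis _ hq).1 (congrArg Prod.snd (c.right_inv ht)))
    have hfix := hc.fix _ (haxis.symm ▸ hq)
    rw [haxis, c.right_inv ht] at hfix
    exact hfix.symm
  axis q hq := by
    rw [← hc.axis _ (c.map_target hq), c.right_inv hq]

theorem restrOpen (hc : IsAxisChart c) {O : Set V3} (hO : IsOpen O) (h₀ : 0 ∈ O) :
    IsAxisChart (c.restrOpen O hO) where
  smooth := hc.smooth.mono Set.inter_subset_left
  smooth_symm := hc.smooth_symm.mono Set.inter_subset_left
  zero_mem := ⟨hc.zero_mem, h₀⟩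
  fix t ht := hc.fix t ht.1
  axis q hq := hc.axis q hq.1

end IsAxisChart

theorem exists_isAxisChart {Ψ : V3 → V3} {S : Set V3} (hS : IsOpen S) (h₀ : 0 ∈ S)
    (hΨ : ContDiffOn ℝ ∞ Ψ S) (hfix : ∀ t, (t, 0, 0) ∈ S → Ψ (t, 0, 0) = (t, 0, 0))
    (hd : ∀ v, fderiv ℝ Ψ 0 v = 0 → v = 0) :
    ∃ c, IsAxisChart c ∧ c.source ⊆ S ∧ ∀ q, c q = Ψ q := by
  obtain ⟨A, hA⟩ := exists_equiv_of_injective _ hd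
  obtain ⟨e, he₀, heS, heΨ, hsymm⟩ := exists_openPartialHomeomorph_of_hasFDerivAt hS hΨ h₀
    (hA ▸ hasFDerivAt_fderiv_of_contDiffOn hS hΨ h₀)
  let O : Set V3 := e.source ∩ e ⁻¹' {q | (q.1, 0, 0) ∈ e.source}
  have hO : IsOpen O := e.isOpen_inter_preimage
    (e.open_source.preimage (by fun_prop : Continuous fun q : V3 => ((q.1, 0, 0) : V3)))
  have hfix' : ∀ t, (t, 0, 0) ∈ e.source → e (t, 0, 0) = (t, 0, 0) := fun t ht =>
    (heΨ _).trans (hfix t (heS ht))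
  refine ⟨e.restrOpen O hO, ⟨?_, hsymm.mono Set.inter_subset_left, ⟨he₀, he₀, ?_⟩,
    fun t ht => hfix' t ht.1, fun q hq => ⟨fun hq₀ => ?_, fun hq₀ => ?_⟩⟩,
    fun q hq => heS hq.1, heΨ⟩
  · exact (hΨ.mono fun q hq => heS hq.1).congr fun q _ => heΨ q
  · rw [Set.mem_preimage, show e 0 = 0 from hfix' 0 he₀]
    exact he₀
  · change (e q).2 = 0 at hq₀
    have heq := e.injOn hq.2.2 hq.1 (by rw [hfix' _ hq.2.2, axis_eq_of_snd_eq_zero hq₀])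
    exact congrArg Prod.snd heq.symm
  · change (e q).2 = 0
    have haxis := axis_eq_of_snd_eq_zero hq₀
    have hq' := hfix' q.1 (haxis.symm ▸ hq.1)
    rw [haxis] at hq'
    rw [hq', hq₀]

theorem exists_contDiff_smul {E F : Type*} [NormedAddCommGroup E] [NormedSpace ℝ E]
    [FiniteDimensional ℝ E] [NormedAddCommGroup F] [NormedSpace ℝ F] {f : E → F} {N : Set E}
    (hN : IsOpen N) (hf : ContDiffOn ℝ ∞ f N) {x : E} (hx : x ∈ N) :
    ∃ χ : E → ℝ, χ x = 1 ∧ ContDiff ℝ ∞ fun q => χ q • f q := by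
  obtain ⟨C, χ, hC, hCN, hχ, hχ₁, hχ₀⟩ := exists_bump isCompact_singleton hN
    (Set.singleton_subset_iff.2 hx)
  refine ⟨χ, hχ₁.self_of_nhdsSet x rfl, contDiff_iff_contDiffAt.2 fun q => ?_⟩
  by_cases hq : q ∈ C
  · exact (hχ.contDiffOn.smul hf).contDiffAt (hN.mem_nhds (hCN hq))
  · refine (contDiffAt_const (c := (0 : F))).congr_of_eventuallyEq ?_
    filter_upwards [hC.isClosed.isOpen_compl.mem_nhds hq] with y hy
    rw [hχ₀ y hy, zero_smul]

theorem fderiv_apply_of_eq_self {E : Type*} [NormedAddCommGroup E] [NormedSpace ℝ E]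
    {P : ℝ × E → E} {S : Set (ℝ × E)} (hS : IsOpen S) {c : E} (hc : (0, c) ∈ S)
    (hP : DifferentiableAt ℝ P (0, c)) (hinit : ∀ y, (0, y) ∈ S → P (0, y) = y) (u : E) :
    fderiv ℝ P (0, c) (0, u) = u := by
  have hslice : HasFDerivAt (fun y : E => P (0, y)) _ c :=
    hP.hasFDerivAt.comp c (hasFDerivAt_prodMk_right 0 c)
  have hid : (fun y : E => P (0, y)) =ᶠ[𝓝 c] id := by
    filter_upwards [(by fun_prop : ContinuousAt (fun y : E => ((0 : ℝ), y)) c).eventually_mem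
      (hS.mem_nhds hc)] with y hy using hinit y hy
  exact DFunLike.congr_fun (hslice.unique ((hasFDerivAt_id c).congr_of_eventuallyEq hid)) u

theorem exists_isAxisChart_of_vectorField {X : V3 → V3} (hX : ContDiff ℝ ∞ X) {w : ℝ × ℝ}
    (hXw : ∀ v : V3, v.2.1 • X 0 + (v.1, v.2.2 • w) = 0 → v = 0) :
    ∃ c, IsAxisChart c ∧ (∀ q ∈ c.source, fderiv ℝ c q (0, 1, 0) = X (c q)) ∧
      fderiv ℝ c 0 (0, 0, 1) = (0, w) := by
  obtain ⟨S, P, hS, h₀, hP, hPinit, hPflow⟩ := exists_smooth_flow (F := ⟨X, hX.continuous⟩) hX 0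
  let ℓ : V3 →L[ℝ] ℝ × V3 := ((ContinuousLinearMap.fst ℝ ℝ ℝ).comp (.snd ℝ ℝ (ℝ × ℝ))).prod
    ((ContinuousLinearMap.fst ℝ ℝ (ℝ × ℝ)).prod
      (((ContinuousLinearMap.snd ℝ ℝ ℝ).comp (.snd ℝ ℝ (ℝ × ℝ))).smulRight w))
  have hℓ : ∀ q, ℓ q = (q.2.1, q.1, q.2.2 • w) := fun _ => rfl
  have hSℓ : IsOpen (ℓ ⁻¹' S) := hS.preimage ℓ.continuous
  have h₀ℓ : ℓ 0 ∈ S := by rwa [map_zero]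
  have hd : ∀ q ∈ ℓ ⁻¹' S, ∀ v, fderiv ℝ (fun q => P (ℓ q)) q v = fderiv ℝ P (ℓ q) (ℓ v) :=
    fun q hq v => by
      have hcomp : HasFDerivAt (fun q => P (ℓ q)) _ q :=
        (hasFDerivAt_fderiv_of_contDiffOn hS hP hq).comp q ℓ.hasFDerivAt
      rw [hcomp.fderiv]
      rfl
  have hdinit : ∀ u, fderiv ℝ P 0 (0, u) = u := fderiv_apply_of_eq_self hS h₀
    (hasFDerivAt_fderiv_of_contDiffOn hS hP h₀).differentiableAt hPinit
  have hd₀ : ∀ v, fderiv ℝ (fun q => P (ℓ q)) 0 v = v.2.1 • X 0 + (v.1, v.2.2 • w) := fun v => by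
    have hsplit : ℓ v = v.2.1 • ((1, 0) : ℝ × V3) + (0, (v.1, v.2.2 • w)) := by
      rw [hℓ]
      ext <;> simp
    rw [hd 0 h₀ℓ, hsplit, map_zero, map_add, map_smul, hPflow 0 h₀, hdinit]
    exact congrArg (fun p => v.2.1 • X p + _) (hPinit 0 h₀)
  obtain ⟨c, hc, hcS, hcP⟩ := exists_isAxisChart hSℓ h₀ℓ
    (hP.comp ℓ.contDiff.contDiffOn fun _ hq => hq) (fun t ht => by
      have hℓt : ℓ (t, 0, 0) = (0, (t, 0, 0)) :=
        Prod.ext rfl (Prod.ext rfl (zero_smul ℝ w))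
      rw [Function.comp_apply, hℓt]
      exact hPinit _ (hℓt ▸ ht)) (fun v hv => hXw v ((hd₀ v).symm.trans hv))
  have hcfun : (c : V3 → V3) = fun q => P (ℓ q) := funext hcP
  refine ⟨c, hc, fun q hq => ?_, ?_⟩
  · have hℓy : ℓ (0, 1, 0) = (1, 0) := by simp [hℓ]
    rw [hcfun, hd q (hcS hq), hℓy, hPflow _ (hcS hq)]
    rfl
  · rw [hcfun, hd₀]
    simp

theorem eq_zero_of_rotation_eq_zero {a b s t : ℝ} (hab : 0 < a ^ 2 + b ^ 2)
    (h : s * b + t * a = 0) (h' : -(s * a) + t * b = 0) : s = 0 ∧ t = 0 := by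
  have hs : s * (a ^ 2 + b ^ 2) = 0 := by linear_combination b * h - a * h'
  have ht : t * (a ^ 2 + b ^ 2) = 0 := by linear_combination a * h + b * h'
  exact ⟨(mul_eq_zero_iff_right hab.ne').1 hs, (mul_eq_zero_iff_right hab.ne').1 ht⟩

theorem sq_add_sq_pos_of_ne_zero {L : V3 →L[ℝ] ℝ} (hL : L ≠ 0) (hx : L (1, 0, 0) = 0) :
    0 < L (0, 1, 0) ^ 2 + L (0, 0, 1) ^ 2 := by
  refine (by positivity : 0 ≤ L (0, 1, 0) ^ 2 + L (0, 0, 1) ^ 2).lt_of_ne' fun h => hL ?_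
  obtain ⟨hy, hz⟩ := (add_eq_zero_iff_of_nonneg (sq_nonneg _) (sq_nonneg _)).1 h
  refine ContinuousLinearMap.ext fun v => ?_
  rw [clm_apply_eq, hx, pow_eq_zero_iff two_ne_zero |>.1 hy, pow_eq_zero_iff two_ne_zero |>.1 hz]
  simp

variable {β : V3 → V3 →L[ℝ] ℝ} {T : Set V3}

-- The chart is the flow box of `β(∂z) ∂y - β(∂y) ∂z`, a field tangent to the kernel of `β`,
-- started from a line transverse to that kernel.
theorem exists_isAxisChart_flowBox (hT : IsOpen T) (hβ : ContDiffOn ℝ ∞ β T) (h₀ : 0 ∈ T)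
    (hx : β 0 (1, 0, 0) = 0) (hβ₀ : β 0 ≠ 0) :
    ∃ c, IsAxisChart c ∧ ∀ q ∈ c.source, c q ∈ T ∧ β (c q) (fderiv ℝ c q (0, 1, 0)) = 0 ∧
      0 < β (c q) (fderiv ℝ c q (0, 0, 1)) := by
  let X : V3 → V3 := fun q => (0, β q (0, 0, 1), -β q (0, 1, 0))
  have hXsmooth : ContDiffOn ℝ ∞ X T := contDiffOn_const.prodMk
    ((hβ.clm_apply contDiffOn_const).prodMk (hβ.clm_apply contDiffOn_const).neg)
  have hβX : ∀ q, β q (X q) = 0 := fun q => by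
    rw [clm_apply_eq]
    ring
  obtain ⟨χ, hχ₀, hχX⟩ := exists_contDiff_smul hT hXsmooth h₀
  let b : ℝ × ℝ := (β 0 (0, 1, 0), β 0 (0, 0, 1))
  have hb : 0 < b.1 ^ 2 + b.2 ^ 2 := sq_add_sq_pos_of_ne_zero hβ₀ hx
  have hindep : ∀ v : V3, v.2.1 • χ 0 • X 0 + (v.1, v.2.2 • b) = 0 → v = 0 := fun v hv => by
    have hx₁ : v.1 = 0 := by simpa [X] using congrArg Prod.fst hv
    have hy : v.2.1 * b.2 + v.2.2 * b.1 = 0 := by simpa [X, hχ₀] using congrArg (·.2.1) hv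
    have hz : -(v.2.1 * b.1) + v.2.2 * b.2 = 0 := by simpa [X, hχ₀] using congrArg (·.2.2) hv
    exact Prod.ext hx₁ (Prod.ext_iff.2 (eq_zero_of_rotation_eq_zero hb hy hz))
  obtain ⟨c, hc, hcy, hcz⟩ := exists_isAxisChart_of_vectorField hχX hindep
  have hS : IsOpen (c.source ∩ c ⁻¹' T) := c.isOpen_inter_preimage hT
  have h₀S : 0 ∈ c.source ∩ c ⁻¹' T := ⟨hc.zero_mem, by rwa [Set.mem_preimage, hc.apply_zero]⟩
  have hcont : ContinuousOn (fun q => β (c q) (fderiv ℝ c q (0, 0, 1))) (c.source ∩ c ⁻¹' T) :=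
    ((hβ.continuousOn.comp (c.continuousOn.mono Set.inter_subset_left) fun q hq => hq.2).clm_apply
      (((hc.smooth.continuousOn_fderiv_of_isOpen c.open_source (by simp)).clm_apply
        continuousOn_const).mono Set.inter_subset_left))
  refine ⟨_, hc.restrOpen (hcont.isOpen_inter_preimage hS isOpen_Ioi) ⟨h₀S, ?_⟩,
    fun q hq => ⟨hq.2.1.2, ?_, hq.2.2⟩⟩
  · rw [Set.mem_preimage, hcz, hc.apply_zero, clm_apply_eq]
    change 0 < 0 * _ + b.1 * b.1 + b.2 * b.2
    linarith
  · change β (c q) (fderiv ℝ c q (0, 1, 0)) = 0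
    rw [hcy q hq.1, map_smul, hβX, smul_zero]

theorem fderiv_ne_zero_of_wedge_ne_zero {q : V3} (hβ : DifferentiableAt ℝ β q)
    (hx : β q (1, 0, 0) = 0) (hy : ∀ᶠ p in 𝓝 q, β p (0, 1, 0) = 0)
    (hw : ∃ u v w, β q u * extDerivForm β q ![v, w] + β q v * extDerivForm β q ![w, u] +
      β q w * extDerivForm β q ![u, v] ≠ 0) : fderiv ℝ β q (0, 1, 0) (1, 0, 0) ≠ 0 := by
  intro h₀
  obtain ⟨u, v, w, hwedge⟩ := hw
  have hdy : ∀ x, fderiv ℝ β q x (0, 1, 0) = 0 := fun x =>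
    have hzero := (hasFDerivAt_form_apply hβ (0, 1, 0)).unique
      ((hasFDerivAt_const (0 : ℝ) q).congr_of_eventuallyEq hy)
    DFunLike.congr_fun hzero x
  have hd : ∀ x y, fderiv ℝ β q x y = y.1 * (x.1 * fderiv ℝ β q (1, 0, 0) (1, 0, 0) +
      x.2.2 * fderiv ℝ β q (0, 0, 1) (1, 0, 0)) + y.2.2 * fderiv ℝ β q x (0, 0, 1) := fun x y => by
    have hdx := clm_apply_eq ((fderiv ℝ β q).flip (1, 0, 0)) x
    simp only [ContinuousLinearMap.flip_apply, h₀] at hdx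
    rw [clm_apply_eq (fderiv ℝ β q x) y, hdy, hdx]
    ring
  have hβq : ∀ x, β q x = x.2.2 * β q (0, 0, 1) := fun x => by
    rw [clm_apply_eq, hx, hy.self_of_nhds]
    ring
  refine hwedge ?_
  simp only [extDerivForm_apply hβ, hβq u, hβq v, hβq w, hd v w, hd w v, hd w u, hd u w, hd u v,
    hd v u]
  ring

/-- The function `f` for which a `1`-form `β` without `dy`-component is proportional to
`dz - f dx`. -/
def contactSlope (β : V3 → V3 →L[ℝ] ℝ) (q : V3) : ℝ := -(β q (1, 0, 0)) / β q (0, 0, 1)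

theorem apply_eq_mul_contactSlope {q : V3} (hy : β q (0, 1, 0) = 0) (hz : β q (0, 0, 1) ≠ 0)
    (v : V3) : β q v = β q (0, 0, 1) * (v.2.2 - contactSlope β q * v.1) := by
  rw [clm_apply_eq, hy, contactSlope]
  field_simp
  ring

theorem contDiffOn_contactSlope (hβ : ContDiffOn ℝ ∞ β T) (hz : ∀ q ∈ T, β q (0, 0, 1) ≠ 0) :
    ContDiffOn ℝ ∞ (contactSlope β) T :=
  (hβ.clm_apply contDiffOn_const).neg.div (hβ.clm_apply contDiffOn_const) hz

theorem fderiv_contactSlope_ne_zero {q : V3} (hβ : DifferentiableAt ℝ β q)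
    (hf : DifferentiableAt ℝ (contactSlope β) q) (hx : β q (1, 0, 0) = 0)
    (hz : ∀ᶠ p in 𝓝 q, β p (0, 0, 1) ≠ 0) (hxy : fderiv ℝ β q (0, 1, 0) (1, 0, 0) ≠ 0) :
    fderiv ℝ (contactSlope β) q (0, 1, 0) ≠ 0 := by
  intro hfy
  have hprod : (fun p => contactSlope β p * β p (0, 0, 1)) =ᶠ[𝓝 q] fun p => -(β p (1, 0, 0)) := by
    filter_upwards [hz] with p hp using div_mul_cancel₀ _ hp
  have hderiv := (hf.hasFDerivAt.mul (hasFDerivAt_form_apply hβ (0, 0, 1))).unique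
    ((hasFDerivAt_form_apply hβ (1, 0, 0)).neg.congr_of_eventuallyEq hprod)
  have hfq : contactSlope β q = 0 := by simp [contactSlope, hx]
  exact hxy (by simpa [hfq, hfy] using (DFunLike.congr_fun hderiv (0, 1, 0)).symm)

theorem exists_isAxisChart_stdForm (hT : IsOpen T) (hβ : ContDiffOn ℝ ∞ β T) (h₀ : 0 ∈ T)
    (hx : ∀ t, (t, 0, 0) ∈ T → β (t, 0, 0) (1, 0, 0) = 0) (hy : ∀ q ∈ T, β q (0, 1, 0) = 0)
    (hz : ∀ q ∈ T, β q (0, 0, 1) ≠ 0) (hxy : fderiv ℝ β 0 (0, 1, 0) (1, 0, 0) ≠ 0) :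
    ∃ c, IsAxisChart c ∧ ∀ q ∈ c.source, ∀ v,
      β q v = β q (0, 0, 1) * stdForm (c q) (fderiv ℝ c q v) := by
  have hf : ContDiffOn ℝ ∞ (contactSlope β) T := contDiffOn_contactSlope hβ hz
  have hfd := fun {q} => hasFDerivAt_fderiv_of_contDiffOn hT hf (q := q)
  have hfy : fderiv ℝ (contactSlope β) 0 (0, 1, 0) ≠ 0 := fderiv_contactSlope_ne_zero
    (hasFDerivAt_fderiv_of_contDiffOn hT hβ h₀).differentiableAt (hfd h₀).differentiableAt
    (hx 0 h₀) (Filter.eventually_of_mem (hT.mem_nhds h₀) hz) hxy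
  let Θ : V3 → V3 := fun q => (q.1, contactSlope β q, q.2.2)
  have hΘ : ContDiffOn ℝ ∞ Θ T := contDiffOn_fst.prodMk (hf.prodMk contDiff_snd.snd.contDiffOn)
  have hΘd : ∀ q ∈ T, ∀ v, fderiv ℝ Θ q v = (v.1, fderiv ℝ (contactSlope β) q v, v.2.2) :=
    fun q hq v => by
      have hΘq : HasFDerivAt Θ _ q := hasFDerivAt_fst.prodMk ((hfd hq).prodMk hasFDerivAt_snd.snd)
      rw [hΘq.fderiv]
      rfl
  obtain ⟨c, hc, hcT, hcΘ⟩ := exists_isAxisChart hT h₀ hΘ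
    (fun t ht => Prod.ext rfl (Prod.ext (by simp [Θ, contactSlope, hx t ht]) rfl)) fun v hv => by
      rw [hΘd 0 h₀, Prod.mk_eq_zero, Prod.mk_eq_zero] at hv
      obtain ⟨hv₁, hv₂, hv₃⟩ := hv
      rw [clm_apply_eq, hv₁, hv₃] at hv₂
      exact Prod.ext hv₁ (Prod.ext (by simpa [hfy] using hv₂) hv₃)
  refine ⟨c, hc, fun q hq v => ?_⟩
  rw [show (c : V3 → V3) = Θ from funext hcΘ, hΘd q (hcT hq)]
  exact apply_eq_mul_contactSlope (hy q (hcT hq)) (hz q (hcT hq)) v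

end AxisCharts

section LegendrianCharts

variable {M : Type*} [TopologicalSpace M] [ChartedSpace E3 M] [IsManifold (𝓡 3) ∞ M]

/-- A chart centred at `p` in which `K` is the `x`-axis and the axis is tangent to the kernel of
`α`. -/
structure IsLegendrianChart (α : OneForm M) (K : Set M) (p : M) (e : OpenPartialHomeomorph M V3) :
    Prop where
  smooth : IsSmoothChart e
  mem : p ∈ e.source
  zero : e p = 0
  axis : ∀ x ∈ e.source, x ∈ K ↔ (e x).2 = 0
  tangent : ∀ t, (t, 0, 0) ∈ e.target → α.pullback e.symm (t, 0, 0) (1, 0, 0) = 0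

namespace IsLegendrianChart

variable {α : OneForm M} {K : Set M} {p : M} {e : OpenPartialHomeomorph M V3}

theorem zero_mem (he : IsLegendrianChart α K p e) : 0 ∈ e.target :=
  he.zero ▸ e.map_source he.mem

theorem pullback_trans (he : IsLegendrianChart α K p e) {c : OpenPartialHomeomorph V3 V3}
    (hc : IsAxisChart c) {q : V3} (hq : q ∈ (e.trans c).target) :
    α.pullback (e.trans c).symm q =
      (α.pullback e.symm (c.symm q)).comp (fderiv ℝ c.symm q) :=
  α.pullback_comp (f := e.symm) (c := c.symm) (he.smooth.mdifferentiableAt_symm hq.2)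
    ((hc.smooth_symm.contDiffAt (c.open_target.mem_nhds hq.1)).differentiableAt (by simp))

theorem trans (he : IsLegendrianChart α K p e) {c : OpenPartialHomeomorph V3 V3}
    (hc : IsAxisChart c) : IsLegendrianChart α K p (e.trans c) where
  smooth := he.smooth.trans_symm (c := c.symm) hc.smooth_symm hc.smooth
  mem := ⟨he.mem, show e p ∈ c.source from he.zero ▸ hc.zero_mem⟩
  zero := (congrArg c he.zero).trans hc.apply_zero
  axis x hx := (he.axis x hx.1).trans (hc.axis _ hx.2).symm
  tangent t ht := by
    have hfix := hc.symm.fix t ht.1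
    have hd : fderiv ℝ c.symm (t, 0, 0) (1, 0, 0) = (1, 0, 0) :=
      fderiv_axis_of_hasDerivAt c.open_target hc.smooth_symm (hasDerivAt_axis t) hc.symm.fix ht.1
    rw [he.pullback_trans hc ht, ContinuousLinearMap.comp_apply, hd, hfix]
    exact he.tangent t (hfix ▸ ht.2)

theorem exists_normalized (he : IsLegendrianChart α K p e) (hα : α.IsContact) :
    ∃ e', IsLegendrianChart α K p e' ∧ ∀ q ∈ e'.target,
      α.pullback e'.symm q (0, 1, 0) = 0 ∧ 0 < α.pullback e'.symm q (0, 0, 1) := by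
  have hne : α.pullback e.symm 0 ≠ 0 := fun h₀ => by
    obtain ⟨u, v, w, huvw⟩ := he.smooth.exists_wedge_ne_zero α hα he.mem
    rw [he.zero, h₀] at huvw
    simp at huvw
  obtain ⟨c, hc, hcβ⟩ := exists_isAxisChart_flowBox e.open_target
    (he.smooth.contDiffOn_pullback α) he.zero_mem (he.tangent 0 he.zero_mem) hne
  refine ⟨e.trans c.symm, he.trans hc.symm, fun q hq => ?_⟩
  rw [he.pullback_trans hc.symm hq]
  exact (hcβ q hq.1).2

theorem exists_isDarbouxChart (he : IsLegendrianChart α K p e) (hα : α.IsContact)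
    {ξ : CoorientedContactStructure M}
    (hξ : ∀ (x : M) (v : TangentSpace (𝓡 3) x),
      (v ∈ ξ.plane x ↔ (α x v : ℝ) = 0) ∧ (v ∈ ξ.pos x ↔ 0 < (α x v : ℝ))) :
    ∃ e', IsDarbouxChart ξ K e' ∧ p ∈ e'.source := by
  obtain ⟨e, he, hnorm⟩ := he.exists_normalized hα
  have hβ := he.smooth.contDiffOn_pullback α
  have hxy := fderiv_ne_zero_of_wedge_ne_zero
    (hasFDerivAt_fderiv_of_contDiffOn e.open_target hβ he.zero_mem).differentiableAt
    (he.tangent 0 he.zero_mem)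
    (Filter.eventually_of_mem (e.open_target.mem_nhds he.zero_mem) fun q hq => (hnorm q hq).1)
    (by simpa only [he.zero] using he.smooth.exists_wedge_ne_zero α hα he.mem)
  obtain ⟨c, hc, hcβ⟩ := exists_isAxisChart_stdForm e.open_target hβ he.zero_mem he.tangent
    (fun q hq => (hnorm q hq).1) (fun q hq => (hnorm q hq).2.ne') hxy
  have hec := he.trans hc
  refine ⟨e.trans c, ⟨hec.smooth, fun x hx v => ?_, hec.axis⟩, hec.mem⟩
  have hpos := (hnorm (e x) (e.map_source hx.1)).2
  have hchain := mfderiv_comp (g := c) (f := e) x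
    ((hc.smooth.contDiffAt (c.open_source.mem_nhds hx.2)).differentiableAt
      (by simp)).mdifferentiableAt (he.smooth.mdifferentiableAt hx.1)
  rw [mfderiv_eq_fderiv] at hchain
  have hform : (α x : E3 →L[ℝ] ℝ) v = α.pullback e.symm (e x) (0, 0, 1) *
      stdForm ((e.trans c) x) ((mfderiv (𝓡 3) 𝓘(ℝ, V3) (e.trans c) x : E3 →L[ℝ] V3) v) :=
    (he.smooth.pullback_apply_mfderiv α hx.1 v).symm.trans ((hcβ (e x) hx.2 _).trans
      (congrArg (α.pullback e.symm (e x) (0, 0, 1) * stdForm (c (e x)) ·)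
        (DFunLike.congr_fun hchain v).symm))
  exact ⟨(hξ x v).1.trans ((Iff.of_eq (congrArg (· = 0) hform)).trans
      (mul_eq_zero_iff_left hpos.ne')),
    (hξ x v).2.trans ((Iff.of_eq (congrArg (0 < ·) hform)).trans (mul_pos_iff_of_pos_left hpos))⟩

end IsLegendrianChart

end LegendrianCharts

section Straightening

variable {N : Type*} [TopologicalSpace N] [ChartedSpace (EuclideanSpace ℝ (Fin 1)) N]
  {M : Type*} [TopologicalSpace M] [ChartedSpace E3 M]

theorem exists_homeomorph_axis {F : Type*} [NormedAddCommGroup F] [NormedSpace ℝ F]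
    (L : (EuclideanSpace ℝ (Fin 1) × F) ≃L[ℝ] E3) (a : EuclideanSpace ℝ (Fin 1)) :
    ∃ (ι : ℝ ≃ₜ EuclideanSpace ℝ (Fin 1)) (T : E3 ≃ₜ V3), ContDiff ℝ ∞ ι ∧ ContDiff ℝ ∞ T ∧
      ContDiff ℝ ∞ T.symm ∧ ι 0 = a ∧ ∀ t, T (L (ι t, 0)) = (t, 0, 0) := by
  have : FiniteDimensional ℝ F :=
    FiniteDimensional.of_injective (L.toLinearMap ∘ₗ LinearMap.inr ℝ _ F)
      (L.injective.comp LinearMap.inr_injective)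
  have hrank : Module.finrank ℝ F = 2 := by
    have hL := L.toLinearEquiv.finrank_eq
    rw [Module.finrank_prod, finrank_euclideanSpace_fin, finrank_euclideanSpace_fin] at hL
    lia
  let i : EuclideanSpace ℝ (Fin 1) ≃L[ℝ] ℝ := ContinuousLinearEquiv.ofFinrankEq (by simp)
  let j : F ≃L[ℝ] ℝ × ℝ := ContinuousLinearEquiv.ofFinrankEq (by simp [hrank])
  let Λ : E3 ≃L[ℝ] V3 := L.symm.trans (i.prodCongr j)
  refine ⟨i.symm.toHomeomorph.trans (Homeomorph.addRight a),
    (Homeomorph.addRight (-L (a, 0))).trans Λ.toHomeomorph,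
    i.symm.contDiff.add contDiff_const, Λ.contDiff.comp (contDiff_id.add contDiff_const),
    Λ.symm.contDiff.add contDiff_const, by simp, fun t => ?_⟩
  change (i.prodCongr j) (L.symm (L (i.symm t + a, 0) + -L (a, 0))) = _
  simp [← map_neg, ← map_add, Prod.ext_iff]

theorem exists_smoothChart_axis {γ : N → M} {z : N}
    (hγ : Manifold.IsImmersionAt (𝓡 1) (𝓡 3) ∞ γ z) :
    ∃ (e : OpenPartialHomeomorph M V3) (m : OpenPartialHomeomorph ℝ N), IsSmoothChart e ∧
      ContMDiffOn 𝓘(ℝ, ℝ) (𝓡 1) ∞ m m.source ∧ 0 ∈ m.source ∧ m 0 = z ∧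
      ∀ t ∈ m.source, γ (m t) ∈ e.source ∧ e (γ (m t)) = (t, 0, 0) := by
  set d := hγ.domChart
  set k := hγ.codChart
  obtain ⟨ι, T, hι, hT, hTsymm, hι₀, hιT⟩ := exists_homeomorph_axis hγ.equiv (d z)
  have hsource : (k.trans T.toOpenPartialHomeomorph).source = k.source := by simp
  refine ⟨k.trans T.toOpenPartialHomeomorph, ι.toOpenPartialHomeomorph.trans d.symm,
    ⟨?_, ?_⟩, ?_, ?_, ?_, fun t ht => ?_⟩
  · rw [hsource]
    exact hT.contMDiff.comp_contMDiffOn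
      (contMDiffOn_of_mem_maximalAtlas hγ.codChart_mem_maximalAtlas)
  · exact (contMDiffOn_symm_of_mem_maximalAtlas hγ.codChart_mem_maximalAtlas).comp
      hTsymm.contMDiff.contMDiffOn fun q hq => hq.2
  · exact (contMDiffOn_symm_of_mem_maximalAtlas hγ.domChart_mem_maximalAtlas).comp
      hι.contMDiff.contMDiffOn fun t ht => ht.2
  · exact ⟨trivial, show ι 0 ∈ d.target from hι₀ ▸ d.map_source hγ.mem_domChart_source⟩
  · exact (congrArg d.symm hι₀).trans (d.left_inv hγ.mem_domChart_source)
  · have hιt : ι t ∈ d.target := ht.2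
    have hk : k (γ (d.symm (ι t))) = hγ.equiv (ι t, 0) :=
      hγ.writtenInCharts (by simpa [OpenPartialHomeomorph.extend_target] using hιt)
    exact ⟨hsource ▸ hγ.source_subset_preimage_source (d.map_target hιt),
      (congrArg T hk).trans (hιT t)⟩

theorem exists_smoothChart_axis_of_isSmoothEmbedding {γ : N → M}
    (hγ : Manifold.IsSmoothEmbedding (𝓡 1) (𝓡 3) ∞ γ) (z : N) :
    ∃ (e : OpenPartialHomeomorph M V3) (m : OpenPartialHomeomorph ℝ N), IsSmoothChart e ∧
      ContMDiffOn 𝓘(ℝ, ℝ) (𝓡 1) ∞ m m.source ∧ γ z ∈ e.source ∧ e (γ z) = 0 ∧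
      (∀ x ∈ e.source, x ∈ Set.range γ ↔ (e x).2 = 0) ∧
      ∀ t, (t, 0, 0) ∈ e.target → t ∈ m.source ∧ e.symm (t, 0, 0) = γ (m t) := by
  obtain ⟨e, m, he, hm, hm₀, hmz, hγm⟩ := exists_smoothChart_axis (hγ.isImmersion.isImmersionAt z)
  obtain ⟨U, hU, hUm⟩ := hγ.isEmbedding.isOpen_iff.1 m.open_target
  have hS : IsOpen (U ∩ (e.source ∩ e ⁻¹' (Prod.fst ⁻¹' m.source))) :=
    hU.inter (e.isOpen_inter_preimage (m.open_source.preimage continuous_fst))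
  have hmemz : γ z ∈ e.source ∧ e (γ z) = 0 := hmz ▸ hγm 0 hm₀
  refine ⟨e.restrOpen _ hS, m, ⟨he.smooth.mono fun x hx => hx.1,
    he.smooth_symm.mono fun q hq => hq.1⟩, hm, ⟨hmemz.1, ?_, hmemz.1, ?_⟩, hmemz.2, ?_, ?_⟩
  · exact show z ∈ γ ⁻¹' U from hUm ▸ hmz ▸ m.map_source hm₀
  · exact show (e (γ z)).1 ∈ m.source from hmemz.2 ▸ hm₀
  · rintro x ⟨hxe, hxU, -, hxm⟩
    constructor
    · rintro ⟨w, rfl⟩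
      have hw : w ∈ m.target := hUm ▸ hxU
      rw [← m.right_inv hw]
      exact congrArg Prod.snd (hγm _ (m.map_target hw)).2
    · intro hx
      obtain ⟨hmem, heq⟩ := hγm _ hxm
      exact ⟨_, e.injOn hmem hxe (heq.trans (axis_eq_of_snd_eq_zero hx))⟩
  · intro t ht
    have htm : (e (e.symm (t, 0, 0))).1 ∈ m.source := ((e.restrOpen _ hS).map_target ht).2.2.2
    rw [e.right_inv ht.1] at htm
    exact ⟨htm, (e.eq_symm_apply (hγm t htm).1 ht.1).2 (hγm t htm).2 |>.symm⟩

variable [IsManifold (𝓡 3) ∞ M] {ξ : CoorientedContactStructure M}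

theorem exists_isDarbouxChart_of_isSmoothEmbedding {γ : N → M}
    (hγ : Manifold.IsSmoothEmbedding (𝓡 1) (𝓡 3) ∞ γ)
    (hγξ : ∀ (z : N) (v : TangentSpace (𝓡 1) z), mfderiv (𝓡 1) (𝓡 3) γ z v ∈ ξ.plane (γ z))
    (z : N) :
    ∃ e : OpenPartialHomeomorph M V3, IsDarbouxChart ξ (Set.range γ) e ∧ γ z ∈ e.source := by
  obtain ⟨α, hα, hξ⟩ := ξ.exists_form
  obtain ⟨e, m, he, hm, hz, hz₀, haxis, hem⟩ := exists_smoothChart_axis_of_isSmoothEmbedding hγ z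
  refine IsLegendrianChart.exists_isDarbouxChart (α := α) (e := e)
    ⟨he, hz, hz₀, haxis, fun t ht => ?_⟩ hα hξ
  have hpull : α.pullback (fun s : ℝ => e.symm (s, 0, 0)) t 1 =
      α.pullback e.symm (t, 0, 0) (1, 0, 0) := by
    rw [α.pullback_comp (f := e.symm) (c := fun s : ℝ => ((s, 0, 0) : V3))
      (he.mdifferentiableAt_symm ht) (hasDerivAt_axis t).differentiableAt,
      ContinuousLinearMap.comp_apply, fderiv_apply_one_eq_deriv, (hasDerivAt_axis t).deriv]
  have hcurve : (fun s : ℝ => e.symm (s, 0, 0)) =ᶠ[𝓝 t] fun s => γ (m s) :=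
    Filter.eventually_of_mem ((e.open_target.preimage continuous_axis).mem_nhds ht)
      fun s hs => (hem s hs).2
  have hd := mfderiv_comp (g := γ) (f := m) t
    (hγ.isImmersion.contMDiff.mdifferentiable (by simp) _)
    ((hm.contMDiffAt (m.open_source.mem_nhds (hem t ht).1)).mdifferentiableAt (by simp))
  rw [← hpull, α.pullback_congr hcurve]
  exact (congrArg (α (γ (m t)) : E3 →L[ℝ] ℝ) (DFunLike.congr_fun hd (1 : ℝ))).trans
    ((hξ (γ (m t)) _).1.1 (hγξ (m t) _))

end Straightening

end ContactTopology

end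

theorem mainTheorem5_general {M : Type*} [TopologicalSpace M] [T2Space M]
    [ChartedSpace ContactTopology.E3 M] [IsManifold (𝓡 3) ∞ M]
    {N : Type*} [TopologicalSpace N] [CompactSpace N] [ChartedSpace (EuclideanSpace ℝ (Fin 1)) N]
    (ξ : ContactTopology.CoorientedContactStructure M)
    {γ : N → M} (hγ : Manifold.IsSmoothEmbedding (𝓡 1) (𝓡 3) ∞ γ)
    (hγξ : ∀ (z : N) (v : TangentSpace (𝓡 1) z), mfderiv (𝓡 1) (𝓡 3) γ z v ∈ ξ.plane (γ z))
    (g : M ≃ₘ^∞⟮𝓡 3, 𝓡 3⟯ M) (hg : ξ.IsContactomorphism g)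
    (hgγ : ∀ x ∈ Set.range γ, g x = x) :
    ∃ h : M ≃ₘ^∞⟮𝓡 3, 𝓡 3⟯ M,
      ξ.IsContactomorphism h ∧ ξ.ContactIsotopic g h ∧
      ∃ U : Set M, IsOpen U ∧ Set.range γ ⊆ U ∧ ∀ x ∈ U, h x = x := by
  obtain ⟨h, hgh, hh⟩ := ContactTopology.exists_contactIsotopic_eq_self_near
    (isCompact_range hγ.isEmbedding.continuous)
    (Set.forall_mem_range.2 (ContactTopology.exists_isDarbouxChart_of_isSmoothEmbedding hγ hγξ))
    hg hgγ
  exact ⟨h, hgh.isContactomorphism_right, hgh, interior {x | h x = x}, isOpen_interior,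
    fun x hx => mem_interior_iff_mem_nhds.2 (hh x hx),
    fun x hx => interior_subset (s := {x | h x = x}) hx⟩

theorem mainTheorem5 {M : Type*} [TopologicalSpace M] [T2Space M] [SecondCountableTopology M]
    [ChartedSpace ContactTopology.E3 M] [IsManifold (𝓡 3) ∞ M]
    (ξ : ContactTopology.CoorientedContactStructure M)
    (K : Set M) (hK : ξ.IsLegendrianKnot K)
    (g : M ≃ₘ^∞⟮𝓡 3, 𝓡 3⟯ M) (hg : ξ.IsContactomorphism g)
    (hgK : ∀ x ∈ K, g x = x) :
    ∃ h : M ≃ₘ^∞⟮𝓡 3, 𝓡 3⟯ M,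
      ξ.IsContactomorphism h ∧ ξ.ContactIsotopic g h ∧
      ∃ U : Set M, IsOpen U ∧ K ⊆ U ∧ ∀ x ∈ U, h x = x := by
  obtain ⟨γ, hγ, rfl, hγξ⟩ := hK
  exact mainTheorem5_general ξ hγ hγξ g hg hgK
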